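/- Let $2<q<\infty$ and $q'=q/(q-1)$. For $g\in L^2(\mathbb{R})$ let $G(g)=\{e^{2\pi i m x}g(x-n)\}_{(m,n)\in\mathbb{Z}^2}$, and let $\widehat g$ be the Fourier transform of $g$, normalized by $\widehat g(\xi)=\int_{\mathbb{R}} g(x)e^{-2\pi i x\xi}\,dx$ for $g\in L^1\cap L^2$. A system $\{f_i\}_{i\in I}$ in a Hilbert space $H$ is exact if its closed linear span is $H$ and no $f_i$ lies in the closed linear span of $\{f_j: j\neq i\}$. It is a $(C_q)$-system if there is a constant $C>0$ such that for every $h\in H$ and every $\varepsilon>0$ there is a finitely supported family of scalars $(a_i)_{i\in I}$ with $\|h-\sum_i a_i f_i\|<\varepsilon$ and $\left(\sum_i|a_i|^q\right)^{1/q}\le C\|h\|$. An exact $(C_q)$-system is a $(C_q)$-system that is exact. (1) If $g\in L^2(\mathbb{R})$ and $G(g)$ is an exact $(C_q)$-system in $L^2(\mathbb{R})$, then for every $t\ge 4/q'$, $$\int_{\mathbb{R}}|x|^t|g(x)|^2\,dx=\infty\quad\text{or}\quad\int_{\mathbb{R}}|\xi|^t|\widehat g(\xi)|^2\,d\xi=\infty.$$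 (2) This is sharp: for every real $t<4/q'$ there is $g\in L^2(\mathbb{R})$ such that $G(g)$ is an exact $(C_q)$-system in $L^2(\mathbb{R})$ and both of these integrals are finite. -/

import Mathlib

open MeasureTheory
open scoped ENNReal FourierTransform

noncomputable section

/-- The system `f` is complete: its closed linear span is the whole space. -/
def IsCompleteSystem {ι H : Type*} [NormedAddCommGroup H] [InnerProductSpace ℂ H]
    (f : ι → H) : Prop :=
  (Submodule.span ℂ (Set.range f)).topologicalClosure = ⊤

/-- The system `f` is minimal: each element lies outside the closed linear span of the
remaining ones. -/
def IsMinimalSystem {ι H : Type*} [NormedAddCommGroup H] [InnerProductSpace ℂ H]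
    (f : ι → H) : Prop :=
  ∀ i, f i ∉ (Submodule.span ℂ (f '' {j | j ≠ i})).topologicalClosure

/-- The system `f` is exact: complete and minimal. -/
def IsExactSystem {ι H : Type*} [NormedAddCommGroup H] [InnerProductSpace ℂ H]
    (f : ι → H) : Prop :=
  IsCompleteSystem f ∧ IsMinimalSystem f

/-- The system `f` is a `(C_q)`-system: there is a constant `C > 0` such that every vector `h` can
be approximated arbitrarily well by finite linear combinations of elements of `f` whose
coefficients have `ℓ^q` norm at most `C ‖h‖`. -/
def IsCqSystem {ι H : Type*} [NormedAddCommGroup H] [InnerProductSpace ℂ H]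
    (q : ℝ) (f : ι → H) : Prop :=
  ∃ C : ℝ, 0 < C ∧ ∀ h : H, ∀ ε : ℝ, 0 < ε → ∃ a : ι →₀ ℂ,
    ‖h - ∑ i ∈ a.support, a i • f i‖ < ε ∧
      (∑ i ∈ a.support, ‖a i‖ ^ q) ^ (1 / q) ≤ C * ‖h‖

/-- The function `x ↦ e^{2π i m x} g(x - n)`. -/
def gaborFun (g : ℝ → ℂ) (m n : ℤ) (x : ℝ) : ℂ :=
  Complex.exp (2 * Real.pi * Complex.I * m * x) * g (x - n)

theorem memLp_gaborFun (g : Lp ℂ 2 (volume : Measure ℝ)) (m n : ℤ) :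
    MemLp (gaborFun g m n) 2 (volume : Measure ℝ) := by
  have h1 : MemLp (fun x : ℝ => g (x - n)) 2 (volume : Measure ℝ) :=
    (Lp.memLp g).comp_measurePreserving (measurePreserving_sub_right volume (n : ℝ))
  have hc : Continuous fun x : ℝ => Complex.exp (2 * Real.pi * Complex.I * m * x) := by
    fun_prop
  refine h1.of_le (hc.aestronglyMeasurable.mul h1.aestronglyMeasurable) ?_
  refine Filter.Eventually.of_forall fun x => ?_
  have h2 : (2 * Real.pi * Complex.I * m * x : ℂ) = ((2 * Real.pi * m * x : ℝ) : ℂ) * Complex.I := by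
    push_cast
    ring
  rw [gaborFun, norm_mul, h2, Complex.norm_exp_ofReal_mul_I, one_mul]

/-- The Gabor system `G(g) = {e^{2π i m x} g(x - n)}`, `(m, n) ∈ ℤ²`, in `L²(ℝ)`. -/
def gaborSystem (g : Lp ℂ 2 (volume : Measure ℝ)) (k : ℤ × ℤ) : Lp ℂ 2 (volume : Measure ℝ) :=
  (memLp_gaborFun g k.1 k.2).toLp (gaborFun g k.1 k.2)

/-- The weighted integral `∫ |x|^t |h(x)|² dx`, with values in `[0, ∞]`. -/
def weightedIntegral (t : ℝ) (h : Lp ℂ 2 (volume : Measure ℝ)) : ℝ≥0∞ :=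
  ∫⁻ x : ℝ, ENNReal.ofReal (|x| ^ t * ‖h x‖ ^ 2)

end

/-! The Zak transform `zak` is a unitary map onto L² of the unit square that turns the
time-frequency shifts of `g` into the products of Zg with the characters e^{2πi(mx+nξ)}. Put α = 1 -
2/q, so that 4/q' = 2 + 2α. Roughly, the (C_q) property limits how fast Zg may vanish at a point
(order below α), whereas localization of `g` and of its Fourier transform forces a zero of order at
least α when t = 2 + 2α.

Obstruction (`weightedIntegral_eq_top_or`). If both integrals are finite for some t ≥ 2 + 2α, take
the window φ = (1 + cos πx)/2 on (-1, 1] and its modulation ψ = e^{πix}φ. The products H₁ =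
conj(Zφ)·Zg and H₂ = conj(Zψ)·Zg are doubly periodic, and their Fourier coefficients c_k are inner
products of `g` with shifts of φ and ψ. Localization gives Σ (1+|m|+|n|)^{2+2α}|c_k|² < ∞, so H₁ and
H₂ are continuous. Since |Zφ|² + |Zψ|² ≥ 1, they control Zg. The function H₁Zφ + H₂Zψ is continuous
and quasiperiodic, so a winding argument gives it a zero w, and H₁, H₂ vanish there too
(`exists_common_zero`). A trigonometric polynomial P concentrated at w at scale 1/N, with
coefficients p, then gives f = Σ p_k·(k-th shift of g) with ‖f‖ = ‖P·Zg‖ = o(N^{1-α}); the little o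
comes from the tail of the weighted series and settles the endpoint t = 4/q'. Minimality and (C_q)
together give ‖p‖_q ≤ C‖f‖ (`IsCqSystem.exists_sum_rpow_le`), while Hölder gives ‖p‖_q ≥ c·N^{2/q} =
c·N^{1-α}, a contradiction.

Sharpness for t ≥ 0 (`exists_exact_cq_gaborSystem_of_nonneg`). Let s = sin²πx·sin²πξ. Then |Zφ|² = 1
- s, which vanishes only at (1/2, 1/2). For an α' slightly below α and β = (1 - α')/2, choose `g`
with Zg = Σ (j+1)^{β-1} s^j · Zφ, so that |Zg|² is of the size of (1 - s)^{α'}. For localization,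
`g` is a series of the functions F_n with Zak transform s^n·Zφ. These satisfy ‖F_n‖ ≤ 1/(n+1) and
have x²F_n bounded in L², as do their Fourier transforms, and interpolation sums the series when t <
2 + 2α'. For (C_q), Hahn-Banach reduces the claim to ∫ |F|²/|Zg|² ≤ C‖F̂‖_p² with p = q'. The left
side expands into the integrals of s^j|F|², each at most (j+1)^{-α}‖F̂‖_p² by a convolution
inequality (`sum_mul_tsum_le_of_tsum_eq_one`), and the resulting sum converges because α' < α.

Sharpness for t < 0 (`exists_exact_cq_gaborSystem_of_neg`). Only the singularity of |x|^t at the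
origin matters, so an orthonormal Gabor basis suffices whose generator vanishes near 0 and whose
Fourier transform vanishes to high order at 0. -/

noncomputable section

/-! ### Fourier series, time-frequency shifts, and the Zak and Fourier transforms. -/

/-! ### The character `x ↦ exp (2πix)` -/

/-- The character `x ↦ exp (2πix)` of the real line. -/
def unitExp (x : ℝ) : ℂ := Complex.exp (2 * Real.pi * Complex.I * x)

theorem unitExp_eq (x : ℝ) : unitExp x = Complex.exp (((2 * Real.pi * x : ℝ) : ℂ) * Complex.I) := by
  rw [unitExp]; congr 1; push_cast; ring

theorem norm_unitExp (x : ℝ) : ‖unitExp x‖ = 1 := by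
  rw [unitExp_eq, Complex.norm_exp_ofReal_mul_I]

theorem unitExp_add (x y : ℝ) : unitExp (x + y) = unitExp x * unitExp y := by
  rw [unitExp, unitExp, unitExp, ← Complex.exp_add]; congr 1; push_cast; ring

@[simp] theorem unitExp_zero : unitExp 0 = 1 := by simp [unitExp]

theorem unitExp_int (n : ℤ) : unitExp n = 1 := by
  rw [unitExp, Complex.exp_eq_one_iff]
  exact ⟨n, by push_cast; ring⟩

theorem unitExp_neg_mul (x : ℝ) : unitExp (-x) * unitExp x = 1 := by
  rw [← unitExp_add]; simp

theorem conj_unitExp (x : ℝ) : (starRingEnd ℂ) (unitExp x) = unitExp (-x) := by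
  rw [unitExp, unitExp, ← Complex.exp_conj]
  congr 1
  simp only [map_mul, Complex.conj_ofReal, Complex.conj_I, map_ofNat]
  push_cast
  ring

@[fun_prop] theorem continuous_unitExp : Continuous unitExp := by
  unfold unitExp; fun_prop

theorem unitExp_sub_int (x : ℝ) (n : ℤ) : unitExp (x - n) = unitExp x := by
  rw [sub_eq_add_neg, unitExp_add, ← Int.cast_neg, unitExp_int, mul_one]

theorem unitExp_add_int (x : ℝ) (n : ℤ) : unitExp (x + n) = unitExp x := by
  rw [unitExp_add, unitExp_int, mul_one]

theorem unitExp_eq_cos_add (x : ℝ) :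
    unitExp x = (Real.cos (2 * Real.pi * x) : ℂ) + Real.sin (2 * Real.pi * x) * Complex.I := by
  rw [unitExp_eq, Complex.exp_mul_I]; push_cast; rfl

/-! ### Fourier series on unit intervals -/

theorem integral_unitExp_int_mul (m : ℤ) :
    ∫ x in Set.Ioc (0 : ℝ) 1, unitExp (m * x) = if m = 0 then 1 else 0 := by
  rw [← intervalIntegral.integral_of_le zero_le_one]
  split_ifs with h
  · simp [h]
  · have hc : (2 * Real.pi * Complex.I * m : ℂ) ≠ 0 := by
      simp [h, Real.pi_ne_zero, Complex.I_ne_zero]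
    have := integral_exp_mul_complex (a := 0) (b := 1) hc
    have h2 : ∀ x : ℝ, unitExp (m * x) = Complex.exp (2 * Real.pi * Complex.I * m * x) := by
      intro x; rw [unitExp]; congr 1; push_cast; ring
    simp_rw [h2, this]
    have h3 := unitExp_int m
    rw [unitExp] at h3
    have h4 : Complex.exp (2 * Real.pi * Complex.I * m * (1 : ℝ)) = 1 := by
      rw [← h3]; congr 1; push_cast; ring
    rw [h4]; simp

theorem hasSum_sq_fourier_Ioc {f : ℝ → ℂ} (a : ℝ)
    (hf : MemLp f 2 (volume.restrict (Set.Ioc a (a + 1)))) :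
    HasSum (fun m : ℤ => ‖∫ x in Set.Ioc a (a + 1), unitExp (-(m * x)) * f x‖ ^ 2)
      (∫ x in Set.Ioc a (a + 1), ‖f x‖ ^ 2) := by
  have hab : a < a + 1 := by linarith
  have h := hasSum_sq_fourierCoeffOn hab hf
  have h1 : a + 1 - a = 1 := by ring
  convert! h using 1
  · ext m
    rw [fourierCoeffOn_eq_integral]
    congr 2
    rw [intervalIntegral.integral_of_le hab.le, h1]
    simp only [div_one, one_smul]
    refine integral_congr_ae (Filter.Eventually.of_forall fun x => ?_)
    simp only [fourier_coe_apply, smul_eq_mul, unitExp]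
    congr 2
    push_cast
    ring
  · rw [h1, intervalIntegral.integral_of_le hab.le]; simp

theorem ae_eq_zero_of_fourier_Ioc {f : ℝ → ℂ} (a : ℝ)
    (hf : MemLp f 2 (volume.restrict (Set.Ioc a (a + 1))))
    (h : ∀ m : ℤ, ∫ x in Set.Ioc a (a + 1), unitExp (-(m * x)) * f x = 0) :
    f =ᵐ[volume.restrict (Set.Ioc a (a + 1))] 0 := by
  have h1 := hasSum_sq_fourier_Ioc a hf
  simp only [h, norm_zero, ne_eq, OfNat.ofNat_ne_zero, not_false_eq_true, zero_pow] at h1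
  have h2 := h1.unique hasSum_zero
  rw [integral_eq_zero_iff_of_nonneg (fun x => by positivity) hf.integrable_norm_pow'] at h2
  filter_upwards [h2] with x hx
  simpa using hx

/-! ### Fourier series on the unit square -/

/-- Lebesgue measure on the unit square. -/
def unitSq : Measure (ℝ × ℝ) :=
  (volume.restrict (Set.Ioc (0 : ℝ) 1)).prod (volume.restrict (Set.Ioc (0 : ℝ) 1))

instance isProbabilityMeasure_Ioc : IsProbabilityMeasure (volume.restrict (Set.Ioc (0 : ℝ) 1)) :=
  ⟨by simp⟩

instance : IsProbabilityMeasure unitSq := by unfold unitSq; infer_instance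

/-- The characters `(x, ξ) ↦ exp (2πi(mx + nξ))`. -/
def sqChar (k : ℤ × ℤ) (z : ℝ × ℝ) : ℂ := unitExp (k.1 * z.1 + k.2 * z.2)

theorem norm_sqChar (k : ℤ × ℤ) (z : ℝ × ℝ) : ‖sqChar k z‖ = 1 := norm_unitExp _

@[fun_prop] theorem continuous_sqChar (k : ℤ × ℤ) : Continuous (sqChar k) := by
  unfold sqChar; fun_prop

theorem sqChar_add (k l : ℤ × ℤ) (z : ℝ × ℝ) : sqChar (k + l) z = sqChar k z * sqChar l z := by
  simp only [sqChar, ← unitExp_add]; congr 1; push_cast [Prod.fst_add, Prod.snd_add]; ring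

theorem conj_sqChar (k : ℤ × ℤ) (z : ℝ × ℝ) : (starRingEnd ℂ) (sqChar k z) = sqChar (-k) z := by
  simp only [sqChar, conj_unitExp]; congr 1; push_cast [Prod.fst_neg, Prod.snd_neg]; ring

@[simp] theorem sqChar_zero (z : ℝ × ℝ) : sqChar 0 z = 1 := by simp [sqChar]

theorem sqChar_eq_mul (k : ℤ × ℤ) (z : ℝ × ℝ) :
    sqChar k z = unitExp (k.1 * z.1) * unitExp (k.2 * z.2) := unitExp_add _ _

theorem memLp_sqChar_mul (k : ℤ × ℤ) {f : ℝ × ℝ → ℂ} {p : ℝ≥0∞} {μ : Measure (ℝ × ℝ)}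
    (hf : MemLp f p μ) : MemLp (fun z => sqChar k z * f z) p μ := by
  refine hf.of_le ((continuous_sqChar k).aestronglyMeasurable.mul hf.1) ?_
  exact Filter.Eventually.of_forall fun z => by rw [norm_mul, norm_sqChar, one_mul]

theorem memLp_sqChar (k : ℤ × ℤ) : MemLp (sqChar k) 2 unitSq := by
  simpa using memLp_sqChar_mul k (memLp_const (1 : ℂ) (p := 2) (μ := unitSq))

theorem integral_sqChar (k : ℤ × ℤ) : ∫ z, sqChar k z ∂unitSq = if k = 0 then 1 else 0 := by
  simp_rw [sqChar_eq_mul]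
  rw [unitSq, integral_prod_mul (fun x : ℝ => unitExp (k.1 * x)) (fun x : ℝ => unitExp (k.2 * x)),
    integral_unitExp_int_mul, integral_unitExp_int_mul]
  rcases k with ⟨a, b⟩
  by_cases ha : a = 0 <;> by_cases hb : b = 0 <;> simp [ha, hb]

/-- Uniqueness is applied one variable at a time: the Fourier coefficients in the second variable
are L² functions of the first variable, and all of their own Fourier coefficients vanish. -/
theorem ae_eq_zero_of_sq_fourier {f : ℝ × ℝ → ℂ} (hf : MemLp f 2 unitSq)
    (h : ∀ k : ℤ × ℤ, ∫ z, sqChar (-k) z * f z ∂unitSq = 0) : f =ᵐ[unitSq] 0 := by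
  set μ := volume.restrict (Set.Ioc (0 : ℝ) 1) with hμ
  have hμ' : volume.restrict (Set.Ioc (0 : ℝ) (0 + 1)) = μ := by simp [hμ]
  have hsq : Integrable (fun z => ‖f z‖ ^ 2) (μ.prod μ) := hf.integrable_norm_pow'
  have hmeas := hf.1
  have hae : ∀ᵐ x ∂μ, MemLp (fun y => f (x, y)) 2 μ := by
    filter_upwards [hsq.prod_right_ae, AEStronglyMeasurable.prodMk_left hmeas] with x h1 h2
    exact (memLp_two_iff_integrable_sq_norm h2).2 h1
  set F : ℤ → ℝ → ℂ := fun n x => ∫ y, unitExp (-(n * y)) * f (x, y) ∂μ with hF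
  have hint : ∀ k : ℤ × ℤ, Integrable (fun z => sqChar (-k) z * f z) (μ.prod μ) := fun k =>
    (memLp_sqChar_mul (-k) hf).integrable one_le_two
  have hint2 : ∀ n : ℤ, Integrable (fun z : ℝ × ℝ => unitExp (-(n * z.2)) * f z) (μ.prod μ) := by
    intro n
    refine (hint (0, n)).congr (Filter.Eventually.of_forall fun z => ?_)
    simp [sqChar]
  have hFm : ∀ n, AEStronglyMeasurable (F n) μ := fun n =>
    (hint2 n).aestronglyMeasurable.integral_prod_right'
  have hFL : ∀ n, MemLp (F n) 2 μ := by
    intro n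
    rw [memLp_two_iff_integrable_sq_norm (hFm n)]
    refine hsq.integral_prod_left.mono' ((hFm n).norm.pow 2) ?_
    filter_upwards [hae] with x hx
    have h0 : MemLp (fun y => f (x, y)) 2 (volume.restrict (Set.Ioc (0 : ℝ) (0 + 1))) := by
      rwa [hμ']
    have h1 := le_hasSum (hasSum_sq_fourier_Ioc 0 h0) n (fun _ _ => by positivity)
    rw [hμ'] at h1
    rw [Real.norm_of_nonneg (by positivity)]
    exact h1
  have hF0 : ∀ n, F n =ᵐ[μ] 0 := by
    intro n
    have h0 := hFL n
    rw [← hμ'] at h0 ⊢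
    refine ae_eq_zero_of_fourier_Ioc 0 h0 fun m => ?_
    rw [hμ', ← h (m, n), unitSq, integral_prod _ (hint (m, n))]
    refine integral_congr_ae (Filter.Eventually.of_forall fun x => ?_)
    simp only [hF]
    rw [← integral_const_mul]
    refine integral_congr_ae (Filter.Eventually.of_forall fun y => ?_)
    simp only [sqChar, Prod.fst_neg, Prod.snd_neg, ← mul_assoc, ← unitExp_add]
    congr 2; push_cast; ring
  have hF1 : ∀ᵐ x ∂μ, ∀ n, F n x = 0 := ae_all_iff.2 hF0
  have hfin : ∀ᵐ x ∂μ, ∀ᵐ y ∂μ, f (x, y) = 0 := by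
    filter_upwards [hF1, hae] with x h1 h2
    rw [← hμ'] at h2 ⊢
    refine ae_eq_zero_of_fourier_Ioc 0 h2 fun m => ?_
    rw [hμ']; exact h1 m
  have hz : ∫ z, ‖f z‖ ^ 2 ∂(μ.prod μ) = 0 := by
    rw [integral_prod _ hsq]
    refine integral_eq_zero_of_ae ?_
    filter_upwards [hfin] with x hx
    refine integral_eq_zero_of_ae ?_
    filter_upwards [hx] with y hy
    simp [hy]
  rw [integral_eq_zero_iff_of_nonneg (fun x => by positivity) hsq] at hz
  filter_upwards [hz] with x hx
  simpa using hx

/-- The characters as elements of `L²` of the unit square. -/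
def sqCharLp (k : ℤ × ℤ) : Lp ℂ 2 unitSq := (memLp_sqChar k).toLp _

theorem inner_sqCharLp (k : ℤ × ℤ) (f : Lp ℂ 2 unitSq) :
    inner ℂ (sqCharLp k) f = ∫ z, sqChar (-k) z * f z ∂unitSq := by
  rw [L2.inner_def]
  refine integral_congr_ae ?_
  filter_upwards [(memLp_sqChar k).coeFn_toLp] with z hz
  simp only [sqCharLp, hz, RCLike.inner_apply, conj_sqChar]
  ring

theorem orthonormal_sqCharLp : Orthonormal ℂ sqCharLp := by
  rw [orthonormal_iff_ite]
  intro k l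
  rw [inner_sqCharLp]
  have : ∫ z, sqChar (-k) z * sqCharLp l z ∂unitSq = ∫ z, sqChar (l - k) z ∂unitSq := by
    refine integral_congr_ae ?_
    filter_upwards [(memLp_sqChar l).coeFn_toLp] with z hz
    simp only [sqCharLp, hz, ← sqChar_add]; congr 1; abel
  rw [this, integral_sqChar]
  simp [sub_eq_zero, eq_comm]

/-- The Fourier basis of `L²` of the unit square. -/
def sqBasis : HilbertBasis (ℤ × ℤ) ℂ (Lp ℂ 2 unitSq) :=
  HilbertBasis.mkOfOrthogonalEqBot orthonormal_sqCharLp <| by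
    rw [Submodule.eq_bot_iff]
    intro f hf
    rw [Lp.eq_zero_iff_ae_eq_zero]
    refine ae_eq_zero_of_sq_fourier (Lp.memLp f) fun k => ?_
    rw [← inner_sqCharLp]
    exact (Submodule.mem_orthogonal _ _).1 hf _ (Submodule.subset_span ⟨k, rfl⟩)

@[simp] theorem sqBasis_apply (k : ℤ × ℤ) : sqBasis k = sqCharLp k := by
  rw [sqBasis, HilbertBasis.coe_mkOfOrthogonalEqBot]

/-! ### Time-frequency shifts on `L²(ℝ)` -/

theorem gaborFun_eq (g : ℝ → ℂ) (m n : ℤ) (x : ℝ) :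
    gaborFun g m n x = unitExp (m * x) * g (x - n) := by
  rw [gaborFun, unitExp]; congr 2; push_cast; ring

theorem ae_comp_sub_int {p : ℝ → Prop} (h : ∀ᵐ x, p x) (a : ℝ) : ∀ᵐ x, p (x - a) :=
  (measurePreserving_sub_right volume a).quasiMeasurePreserving.ae h

theorem gaborFun_congr_ae {f g : ℝ → ℂ} (h : f =ᵐ[volume] g) (m n : ℤ) :
    gaborFun f m n =ᵐ[volume] gaborFun g m n := by
  filter_upwards [ae_comp_sub_int h n] with x hx
  simp only [gaborFun, hx]

theorem gaborSystem_coeFn (g : Lp ℂ 2 (volume : Measure ℝ)) (k : ℤ × ℤ) :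
    gaborSystem g k =ᵐ[volume] gaborFun g k.1 k.2 :=
  (memLp_gaborFun g k.1 k.2).coeFn_toLp

theorem gaborSystem_coeFn' {g : Lp ℂ 2 (volume : Measure ℝ)} {f : ℝ → ℂ} (h : g =ᵐ[volume] f)
    (k : ℤ × ℤ) : gaborSystem g k =ᵐ[volume] fun x => unitExp (k.1 * x) * f (x - k.2) :=
  (gaborSystem_coeFn g k).trans <| (gaborFun_congr_ae h k.1 k.2).trans <|
    Filter.Eventually.of_forall fun x => gaborFun_eq f k.1 k.2 x

theorem norm_gaborSystem (g : Lp ℂ 2 (volume : Measure ℝ)) (k : ℤ × ℤ) :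
    ‖gaborSystem g k‖ = ‖g‖ := by
  rw [Lp.norm_def, Lp.norm_def]
  congr 1
  rw [eLpNorm_congr_ae (gaborSystem_coeFn g k)]
  have h1 : eLpNorm (gaborFun g k.1 k.2) 2 volume = eLpNorm (fun x => g (x - k.2)) 2 volume := by
    refine eLpNorm_congr_norm_ae (Filter.Eventually.of_forall fun x => ?_)
    rw [gaborFun_eq, norm_mul, norm_unitExp, one_mul]
  rw [h1]
  exact eLpNorm_comp_measurePreserving (Lp.aestronglyMeasurable g)
    (measurePreserving_sub_right volume (k.2 : ℝ))

/-- The time-frequency shift `f ↦ e^{2πimx} f(x - n)` as a linear isometry of `L²(ℝ)`. -/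
def gaborShift (k : ℤ × ℤ) :
    Lp ℂ 2 (volume : Measure ℝ) →ₗᵢ[ℂ] Lp ℂ 2 (volume : Measure ℝ) where
  toFun g := gaborSystem g k
  map_add' f g := by
    refine Lp.ext ?_
    filter_upwards [gaborSystem_coeFn' (Lp.coeFn_add f g) k, gaborSystem_coeFn f k,
      gaborSystem_coeFn g k, Lp.coeFn_add (gaborSystem f k) (gaborSystem g k)] with x h1 h2 h3 h4
    rw [h1, h4, Pi.add_apply, Pi.add_apply, h2, h3, gaborFun_eq, gaborFun_eq, mul_add]
  map_smul' c f := by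
    refine Lp.ext ?_
    filter_upwards [gaborSystem_coeFn' (Lp.coeFn_smul c f) k, gaborSystem_coeFn f k,
      Lp.coeFn_smul c (gaborSystem f k)] with x h1 h2 h4
    rw [RingHom.id_apply, h1, h4]
    simp only [Pi.smul_apply, h2, gaborFun_eq, smul_eq_mul]
    ring
  norm_map' g := norm_gaborSystem g k

theorem gaborShift_apply (k : ℤ × ℤ) (g : Lp ℂ 2 (volume : Measure ℝ)) :
    gaborShift k g = gaborSystem g k := rfl

theorem gaborShift_coeFn {g : Lp ℂ 2 (volume : Measure ℝ)} {f : ℝ → ℂ} (h : g =ᵐ[volume] f)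
    (k : ℤ × ℤ) : gaborShift k g =ᵐ[volume] fun x => unitExp (k.1 * x) * f (x - k.2) :=
  gaborSystem_coeFn' h k

/-- On the integer lattice the phase e^{2πimn} of the Heisenberg relation is 1, so the shifts form a
commutative group. This is what lets the Zak transform diagonalize them. -/
theorem gaborShift_gaborShift (k l : ℤ × ℤ) (g : Lp ℂ 2 (volume : Measure ℝ)) :
    gaborShift k (gaborShift l g) = gaborShift (k + l) g := by
  refine Lp.ext ?_
  filter_upwards [gaborShift_coeFn (gaborShift_coeFn (Filter.EventuallyEq.refl _ (g : ℝ → ℂ)) l) k,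
    gaborShift_coeFn (Filter.EventuallyEq.refl _ (g : ℝ → ℂ)) (k + l)] with x h1 h2
  rw [h1, h2, ← mul_assoc]
  congr 1
  · have : (l.1 : ℝ) * (x - k.2) = l.1 * x - (l.1 * k.2 : ℤ) := by push_cast; ring
    rw [this, unitExp_sub_int, ← unitExp_add]
    congr 1; push_cast [Prod.fst_add]; ring
  · congr 1; push_cast [Prod.snd_add]; ring

/-! ### The Gabor basis of the unit box -/

/-- The indicator function of the unit interval. -/
def unitBox : Lp ℂ 2 (volume : Measure ℝ) :=
  indicatorConstLp 2 (measurableSet_Ioc (a := (0 : ℝ)) (b := 1)) (by simp) 1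

theorem unitBox_coeFn : unitBox =ᵐ[volume] (Set.Ioc (0 : ℝ) 1).indicator fun _ => (1 : ℂ) :=
  indicatorConstLp_coeFn

theorem inner_gaborShift_unitBox (k : ℤ × ℤ) (f : Lp ℂ 2 (volume : Measure ℝ)) :
    inner ℂ (gaborShift k unitBox) f =
      ∫ x in Set.Ioc (k.2 : ℝ) (k.2 + 1), unitExp (-(k.1 * x)) * f x := by
  rw [L2.inner_def, ← integral_indicator measurableSet_Ioc]
  refine integral_congr_ae ?_
  filter_upwards [gaborShift_coeFn unitBox_coeFn k] with x hx
  rw [hx, RCLike.inner_apply, map_mul, conj_unitExp, mul_comm]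
  simp only [Set.indicator_apply, Set.mem_Ioc]
  by_cases h : (k.2 : ℝ) < x ∧ x ≤ k.2 + 1
  · rw [if_pos h, if_pos ⟨by linarith [h.1], by linarith [h.2]⟩]; simp
  · rw [if_neg h, if_neg fun h' => h ⟨by linarith [h'.1], by linarith [h'.2]⟩]; simp

theorem setIntegral_Ioc_comp_sub (f : ℝ → ℂ) (a : ℝ) :
    ∫ x in Set.Ioc a (a + 1), f (x - a) = ∫ x in Set.Ioc (0 : ℝ) 1, f x := by
  rw [← intervalIntegral.integral_of_le (by linarith), ← intervalIntegral.integral_of_le zero_le_one,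
    intervalIntegral.integral_comp_sub_right (fun x => f x) a]
  simp

theorem orthonormal_gaborShift_unitBox : Orthonormal ℂ fun k => gaborShift k unitBox := by
  rw [orthonormal_iff_ite]
  intro k l
  rw [inner_gaborShift_unitBox]
  have h1 : ∫ x in Set.Ioc (k.2 : ℝ) (k.2 + 1), unitExp (-(k.1 * x)) * gaborShift l unitBox x =
      ∫ x in Set.Ioc (k.2 : ℝ) (k.2 + 1), unitExp (((l.1 - k.1 : ℤ) : ℝ) * (x - k.2)) *
        if k.2 = l.2 then 1 else 0 := by
    refine setIntegral_congr_ae measurableSet_Ioc ?_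
    filter_upwards [gaborShift_coeFn unitBox_coeFn l] with x hx hxk
    have h2 : ((l.1 - k.1 : ℤ) : ℝ) * (x - k.2) =
        (-(k.1 * x) + l.1 * x) - (((l.1 - k.1) * k.2 : ℤ) : ℝ) := by push_cast; ring
    rw [hx, h2, unitExp_sub_int, unitExp_add, mul_assoc]
    congr 2
    rw [Set.indicator_apply]
    refine if_congr ?_ rfl rfl
    simp only [Set.mem_Ioc] at hxk ⊢
    constructor
    · intro h3
      have h4 : (k.2 : ℝ) < l.2 + 1 := by linarith
      have h5 : (l.2 : ℝ) < k.2 + 1 := by linarith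
      norm_cast at h4 h5
      omega
    · intro h3
      rw [← h3]
      constructor <;> linarith
  rw [h1, integral_mul_const, setIntegral_Ioc_comp_sub (fun x => unitExp ((l.1 - k.1 : ℤ) * x)),
    integral_unitExp_int_mul]
  rcases k with ⟨a, b⟩
  rcases l with ⟨c, d⟩
  by_cases h3 : a = c
  · by_cases h4 : b = d <;> simp [h3, h4]
  · have : c - a ≠ 0 := by omega
    simp [h3, this]

/-- The orthonormal basis of `L²(ℝ)` consisting of the time-frequency shifts of the unit box. -/
def boxBasis : HilbertBasis (ℤ × ℤ) ℂ (Lp ℂ 2 (volume : Measure ℝ)) :=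
  HilbertBasis.mkOfOrthogonalEqBot orthonormal_gaborShift_unitBox <| by
    rw [Submodule.eq_bot_iff]
    intro f hf
    rw [Lp.eq_zero_iff_ae_eq_zero]
    have h1 : ∀ n : ℤ, ∀ᵐ x ∂(volume.restrict (Set.Ioc (n : ℝ) (n + 1))), f x = 0 := by
      intro n
      refine ae_eq_zero_of_fourier_Ioc n ((Lp.memLp f).restrict _) fun m => ?_
      rw [← inner_gaborShift_unitBox (m, n)]
      exact (Submodule.mem_orthogonal _ _).1 hf _ (Submodule.subset_span ⟨(m, n), rfl⟩)
    have h2 : ∀ᵐ x ∂(volume.restrict (⋃ n : ℤ, Set.Ioc (n : ℝ) (n + 1))), f x = 0 :=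
      (ae_restrict_iUnion_iff _ _).2 h1
    rw [iUnion_Ioc_intCast, Measure.restrict_univ] at h2
    exact h2

@[simp] theorem boxBasis_apply (k : ℤ × ℤ) : boxBasis k = gaborShift k unitBox := by
  rw [boxBasis, HilbertBasis.coe_mkOfOrthogonalEqBot]

/-! ### The Zak transform -/

/-- The Zak transform, as a unitary operator from `L²(ℝ)` onto `L²` of the unit square. -/
def zak : Lp ℂ 2 (volume : Measure ℝ) ≃ₗᵢ[ℂ] Lp ℂ 2 unitSq :=
  boxBasis.repr.trans sqBasis.repr.symm

theorem inner_sqCharLp_zak (k : ℤ × ℤ) (f : Lp ℂ 2 (volume : Measure ℝ)) :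
    inner ℂ (sqCharLp k) (zak f) = inner ℂ (gaborShift k unitBox) f := by
  rw [← sqBasis_apply, ← boxBasis_apply, ← HilbertBasis.repr_apply_apply,
    ← HilbertBasis.repr_apply_apply]
  simp [zak]

/-- The Zak transform is defined by matching two orthonormal bases, so it is computed by comparing
coefficients instead of summing its usual series. -/
theorem zak_eq_of_forall {f : Lp ℂ 2 (volume : Measure ℝ)} {F : Lp ℂ 2 unitSq}
    (h : ∀ k, inner ℂ (gaborShift k unitBox) f = inner ℂ (sqCharLp k) F) : zak f = F := by
  refine sqBasis.repr.injective (lp.ext (funext fun k => ?_))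
  rw [HilbertBasis.repr_apply_apply, HilbertBasis.repr_apply_apply, sqBasis_apply,
    inner_sqCharLp_zak, h]

/-- The Zak transform intertwines time-frequency shifts with multiplication by characters. -/
theorem zak_gaborShift (k : ℤ × ℤ) (f : Lp ℂ 2 (volume : Measure ℝ)) :
    zak (gaborShift k f) =ᵐ[unitSq] fun z => sqChar k z * zak f z := by
  have hm := memLp_sqChar_mul k (Lp.memLp (zak f))
  have : zak (gaborShift k f) = hm.toLp _ := by
    refine zak_eq_of_forall fun l => ?_
    have h1 : gaborShift l unitBox = gaborShift k (gaborShift (l - k) unitBox) := by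
      rw [gaborShift_gaborShift, add_sub_cancel]
    rw [h1, LinearIsometry.inner_map_map, ← inner_sqCharLp_zak, inner_sqCharLp, inner_sqCharLp]
    refine integral_congr_ae ?_
    filter_upwards [hm.coeFn_toLp] with z hz
    rw [hz, ← mul_assoc, ← sqChar_add, show -(l - k) = -l + k by abel]
  rw [this]
  exact hm.coeFn_toLp

theorem memLp_comp_fst {f : ℝ → ℂ} (hf : MemLp f 2 (volume.restrict (Set.Ioc (0 : ℝ) 1))) :
    MemLp (fun z : ℝ × ℝ => f z.1) 2 unitSq := hf.comp_fst _

theorem zak_toLp_of_support_unit {f : ℝ → ℂ} (hf : MemLp f 2 volume)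
    (hs : ∀ x, x ∉ Set.Ioc (0 : ℝ) 1 → f x = 0) :
    zak (hf.toLp f) =ᵐ[unitSq] fun z => f z.1 := by
  have hm := memLp_comp_fst (hf.restrict (Set.Ioc (0 : ℝ) 1))
  have : zak (hf.toLp f) = hm.toLp _ := by
    refine zak_eq_of_forall fun k => ?_
    rw [inner_gaborShift_unitBox, inner_sqCharLp]
    have h1 : ∫ z, sqChar (-k) z * hm.toLp _ z ∂unitSq =
        ∫ z, (unitExp (-(k.1 * z.1)) * f z.1) * unitExp ((-k.2 : ℤ) * z.2) ∂unitSq := by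
      refine integral_congr_ae ?_
      filter_upwards [hm.coeFn_toLp] with z hz
      rw [hz, sqChar_eq_mul]
      simp only [Prod.fst_neg, Prod.snd_neg, Int.cast_neg, neg_mul]
      ring
    rw [h1, unitSq, integral_prod_mul (fun x : ℝ => unitExp (-(k.1 * x)) * f x)
      (fun x : ℝ => unitExp ((-k.2 : ℤ) * x)), integral_unitExp_int_mul]
    have h2 : ∫ x in Set.Ioc (k.2 : ℝ) (k.2 + 1), unitExp (-(k.1 * x)) * hf.toLp f x =
        ∫ x in Set.Ioc (k.2 : ℝ) (k.2 + 1), unitExp (-(k.1 * x)) * f x := by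
      refine integral_congr_ae (ae_restrict_of_ae ?_)
      filter_upwards [hf.coeFn_toLp] with x hx
      rw [hx]
    rw [h2]
    by_cases hk : k.2 = 0
    · simp [hk]
    · rw [if_neg (by simpa using hk), mul_zero]
      refine setIntegral_eq_zero_of_forall_eq_zero fun x hx => ?_
      rw [hs x, mul_zero]
      intro h0
      have h4 : (k.2 : ℝ) < 1 := lt_of_lt_of_le hx.1 h0.2
      have h5 : (0 : ℝ) < k.2 + 1 := lt_of_lt_of_le h0.1 hx.2
      norm_cast at h4 h5
      omega
  rw [this]
  exact hm.coeFn_toLp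

/-- The part of `f` on (-1, 0] is the translate by -1 of a function on (0, 1], which accounts for
the single character e^{-2πiξ}. -/
theorem zak_toLp_of_support {f : ℝ → ℂ} (hf : MemLp f 2 volume)
    (hs : ∀ x, x ∉ Set.Ioc (-1 : ℝ) 1 → f x = 0) :
    zak (hf.toLp f) =ᵐ[unitSq] fun z => f z.1 + f (z.1 - 1) * unitExp (-z.2) := by
  set I := Set.Ioc (0 : ℝ) 1 with hI
  have h1 : MemLp (I.indicator f) 2 volume := hf.indicator measurableSet_Ioc
  have h2' : MemLp (fun x => f (x - 1)) 2 volume :=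
    hf.comp_measurePreserving (measurePreserving_sub_right volume (1 : ℝ))
  have h2 : MemLp (I.indicator fun x => f (x - 1)) 2 volume := h2'.indicator measurableSet_Ioc
  have hsum : hf.toLp f = h1.toLp _ + gaborShift (0, -1) (h2.toLp _) := by
    refine Lp.ext ?_
    filter_upwards [hf.coeFn_toLp, h1.coeFn_toLp, gaborShift_coeFn h2.coeFn_toLp (0, -1),
      Lp.coeFn_add (h1.toLp _) (gaborShift (0, -1) (h2.toLp _))] with x e1 e2 e3 e4
    rw [e1, e4, Pi.add_apply, e2, e3]
    simp only [Set.indicator_apply, hI, Set.mem_Ioc, Int.cast_zero, zero_mul, unitExp_zero, one_mul,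
      Int.cast_neg, Int.cast_one, sub_neg_eq_add, add_sub_cancel_right]
    by_cases c1 : 0 < x ∧ x ≤ 1
    · rw [if_pos c1, if_neg (fun h => by linarith [h.2, c1.1]), add_zero]
    · rw [if_neg c1, zero_add]
      by_cases c2 : 0 < x + 1 ∧ x + 1 ≤ 1
      · rw [if_pos c2]
      · rw [if_neg c2, hs]
        rintro ⟨h3, h4⟩
        rcases lt_or_ge 0 x with h5 | h5
        · exact c1 ⟨h5, h4⟩
        · exact c2 ⟨by linarith, by linarith⟩
  rw [hsum, map_add]
  have hz1 := zak_toLp_of_support_unit h1 fun x hx => Set.indicator_of_notMem hx _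
  have hz2 := zak_toLp_of_support_unit h2 fun x hx => Set.indicator_of_notMem hx _
  have hQ : ∀ᵐ z ∂unitSq, z.1 ∈ I :=
    Measure.quasiMeasurePreserving_fst.ae (ae_restrict_mem measurableSet_Ioc)
  filter_upwards [Lp.coeFn_add (zak (h1.toLp _)) (zak (gaborShift (0, -1) (h2.toLp _))), hz1,
    zak_gaborShift (0, -1) (h2.toLp _), hz2, hQ] with z e1 e2 e3 e4 hz
  rw [e1, Pi.add_apply, e2, e3, e4, Set.indicator_of_mem hz, Set.indicator_of_mem hz]
  simp [sqChar, mul_comm]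

/-! ### The Fourier transform on `L²(ℝ)` -/

theorem fourier_eq_integral_unitExp (f : ℝ → ℂ) (ξ : ℝ) :
    𝓕 f ξ = ∫ x, unitExp (-(x * ξ)) * f x := by
  rw [Real.fourier_real_eq_integral_exp_smul]
  refine integral_congr_ae (Filter.Eventually.of_forall fun x => ?_)
  simp only [smul_eq_mul, unitExp_eq]
  congr 3; push_cast; ring

theorem continuous_fourier_of_integrable {f : ℝ → ℂ} (hf : Integrable f) :
    Continuous (𝓕 f) :=
  VectorFourier.fourierIntegral_continuous Real.continuous_fourierChar
    (by exact continuous_inner) hf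

open scoped SchwartzMap ContDiff in
/-- On `L¹ ∩ L²`, the Fourier transform on `L²` is given by the Fourier integral. -/
theorem fourier_toLp_ae_eq {f : ℝ → ℂ} (h1 : Integrable f) (h2 : MemLp f 2 volume) :
    (𝓕 (h2.toLp f) : Lp ℂ 2 (volume : Measure ℝ)) =ᵐ[volume] 𝓕 f := by
  -- Both sides are tested against compactly supported smooth functions: the L² transform is handled
  -- as a tempered distribution, the Fourier integral by Fubini.
  refine ae_eq_of_integral_contDiff_smul_eq
    ((Lp.memLp _).locallyIntegrable one_le_two)
    (continuous_fourier_of_integrable h1).locallyIntegrable fun g hg hgs => ?_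
  have hc : HasCompactSupport fun x => (g x : ℂ) := hgs.comp_left (g := fun x : ℝ => (x : ℂ)) rfl
  have hd : ContDiff ℝ ∞ fun x => (g x : ℂ) := Complex.ofRealCLM.contDiff.comp hg
  set G : 𝓢(ℝ, ℂ) := hc.toSchwartzMap hd with hG
  have hGx : ∀ x, G x = (g x : ℂ) := fun x => rfl
  have h3 := DFunLike.congr_fun (Lp.fourier_toTemperedDistribution_eq (h2.toLp f)) G
  rw [TemperedDistribution.fourier_apply, Lp.toTemperedDistribution_apply,
    Lp.toTemperedDistribution_apply] at h3
  have h4 : ∫ x, g x • (𝓕 (h2.toLp f) : Lp ℂ 2 (volume : Measure ℝ)) x =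
      ∫ x, G x • (𝓕 (h2.toLp f) : Lp ℂ 2 (volume : Measure ℝ)) x := by
    simp only [hGx, Complex.real_smul, smul_eq_mul]
  have h5 : ∫ x, g x • 𝓕 f x = ∫ x, G x • 𝓕 f x := by
    simp only [hGx, Complex.real_smul, smul_eq_mul]
  rw [h4, h5, ← h3]
  have h6 : ∫ x, (𝓕 G) x • h2.toLp f x = ∫ x, (𝓕 G) x • f x := by
    refine integral_congr_ae ?_
    filter_upwards [h2.coeFn_toLp] with x hx
    rw [hx]
  rw [h6]
  have h7 := VectorFourier.integral_fourierIntegral_smul_eq_flip (L := innerₗ ℝ) (μ := volume)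
      (ν := volume) Real.continuous_fourierChar continuous_inner G.integrable h1
  rw [flip_innerₗ] at h7
  exact h7

theorem fourier_gaborFun (f : ℝ → ℂ) (m n : ℤ) (ξ : ℝ) :
    𝓕 (gaborFun f m n) ξ = unitExp (((-n : ℤ) : ℝ) * ξ) * 𝓕 f (ξ - m) := by
  rw [fourier_eq_integral_unitExp, fourier_eq_integral_unitExp, ← integral_const_mul]
  refine Eq.trans ?_ (integral_sub_right_eq_self
    (fun x => unitExp (((-n : ℤ) : ℝ) * ξ) * (unitExp (-(x * (ξ - m))) * f x)) (n : ℝ))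
  refine integral_congr_ae (Filter.Eventually.of_forall fun x => ?_)
  simp only [gaborFun_eq, ← mul_assoc, ← unitExp_add]
  congr 1
  have : -(x * ξ) + m * x = ((-n : ℤ) : ℝ) * ξ + -((x - n) * (ξ - m)) + (m * n : ℤ) := by
    push_cast; ring
  rw [this, unitExp_add_int]

/-- The Fourier transform intertwines time-frequency shifts. -/
theorem fourier_gaborShift (m n : ℤ) (f : Lp ℂ 2 (volume : Measure ℝ)) :
    𝓕 (gaborShift (m, n) f) = gaborShift (-n, m) (𝓕 f) := by
  refine DenseRange.induction_on
    (p := fun f : Lp ℂ 2 (volume : Measure ℝ) => 𝓕 (gaborShift (m, n) f) = gaborShift (-n, m) (𝓕 f))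
    (SchwartzMap.denseRange_toLpCLM (E := ℝ) (F := ℂ) (p := 2) (μ := volume)
      ENNReal.ofNat_ne_top) f ?_ ?_
  · refine isClosed_eq ?_ ?_
    · exact (Lp.fourierTransformₗᵢ ℝ ℂ).continuous.comp (gaborShift (m, n)).continuous
    · exact (gaborShift (-n, m)).continuous.comp (Lp.fourierTransformₗᵢ ℝ ℂ).continuous
  intro s
  have hs : (SchwartzMap.toLpCLM ℝ ℂ 2 volume s : Lp ℂ 2 (volume : Measure ℝ)) = s.toLp 2 := rfl
  rw [hs]
  have h2 : MemLp (gaborFun s m n) 2 volume := by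
    refine MemLp.ae_eq (gaborFun_congr_ae (s.coeFn_toLp 2 volume) m n) ?_
    exact memLp_gaborFun (s.toLp 2 volume) m n
  have h1 : Integrable (gaborFun s m n) := by
    have h3 : Integrable fun x => s (x - n) := s.integrable.comp_sub_right (n : ℝ)
    refine h3.mono h2.1 (Filter.Eventually.of_forall fun x => ?_)
    rw [gaborFun_eq, norm_mul, norm_unitExp, one_mul]
  have h4 : gaborShift (m, n) (s.toLp 2 volume) = h2.toLp _ := by
    refine Lp.ext ?_
    refine (gaborSystem_coeFn _ (m, n)).trans ?_
    exact (gaborFun_congr_ae (s.coeFn_toLp 2 volume) m n).trans h2.coeFn_toLp.symm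
  refine Lp.ext ?_
  rw [h4, SchwartzMap.toLp_fourier_eq]
  filter_upwards [fourier_toLp_ae_eq h1 h2,
    gaborShift_coeFn ((𝓕 s).coeFn_toLp 2 volume) (-n, m)] with ξ e1 e2
  rw [e1, e2, fourier_gaborFun, SchwartzMap.fourier_coe]

/-! ### The cosine window and the function s = sin²πx·sin²πξ. -/

/-! ### Functions supported on `(-1, 1]` -/

/-- The restriction of a function to `(-1, 1]`, extended by zero. -/
def cutoff (v : ℝ → ℂ) : ℝ → ℂ := (Set.Ioc (-1 : ℝ) 1).indicator v

theorem cutoff_of_notMem {v : ℝ → ℂ} {x : ℝ} (hx : x ∉ Set.Ioc (-1 : ℝ) 1) : cutoff v x = 0 :=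
  Set.indicator_of_notMem hx _

theorem integrable_cutoff {v : ℝ → ℂ} (hv : Continuous v) : Integrable (cutoff v) :=
  (integrable_indicator_iff measurableSet_Ioc).2
    ((hv.integrableOn_Icc (a := -1) (b := 1)).mono_set Set.Ioc_subset_Icc_self)

theorem exists_norm_cutoff_le {v : ℝ → ℂ} (hv : Continuous v) : ∃ C, 0 ≤ C ∧ ∀ x, ‖cutoff v x‖ ≤ C := by
  obtain ⟨C, hC⟩ := (isCompact_Icc (a := (-1 : ℝ)) (b := 1)).exists_bound_of_continuousOn
    hv.continuousOn
  refine ⟨max C 0, le_max_right _ _, fun x => ?_⟩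
  by_cases hx : x ∈ Set.Ioc (-1 : ℝ) 1
  · rw [cutoff, Set.indicator_of_mem hx]
    exact (hC x (Set.Ioc_subset_Icc_self hx)).trans (le_max_left _ _)
  · rw [cutoff_of_notMem hx]; simp

theorem memLp_cutoff {v : ℝ → ℂ} (hv : Continuous v) : MemLp (cutoff v) 2 volume := by
  obtain ⟨C, -, hC⟩ := exists_norm_cutoff_le hv
  refine (memLp_indicator_iff_restrict measurableSet_Ioc).2
    (MemLp.of_bound hv.aestronglyMeasurable C ((ae_restrict_iff' measurableSet_Ioc).2
      (Filter.Eventually.of_forall fun x hx => ?_)))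
  have := hC x
  rwa [cutoff, Set.indicator_of_mem hx] at this

/-- The restriction of a continuous function to `(-1, 1]` as an element of `L²(ℝ)`. -/
def cutoffLp (v : ℝ → ℂ) (hv : Continuous v) : Lp ℂ 2 (volume : Measure ℝ) :=
  (memLp_cutoff hv).toLp _

theorem fourier_cutoff (v : ℝ → ℂ) (ξ : ℝ) :
    𝓕 (cutoff v) ξ = ∫ x in (-1 : ℝ)..1, unitExp (-(x * ξ)) * v x := by
  rw [fourier_eq_integral_unitExp, intervalIntegral.integral_of_le (by norm_num),
    ← integral_indicator measurableSet_Ioc]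
  refine integral_congr_ae (Filter.Eventually.of_forall fun x => ?_)
  simp only [cutoff, Set.indicator_apply]
  split_ifs <;> simp

theorem fourier_cutoff_deriv {v v' : ℝ → ℂ} (hv : ∀ x, HasDerivAt v (v' x) x)
    (hv' : Continuous v') (ξ : ℝ) :
    2 * Real.pi * Complex.I * ξ * 𝓕 (cutoff v) ξ =
      𝓕 (cutoff v') ξ - (unitExp (-ξ) * v 1 - unitExp ξ * v (-1)) := by
  have hu : ∀ x : ℝ, HasDerivAt (fun x : ℝ => unitExp (-(x * ξ)))
      (unitExp (-(x * ξ)) * (-(2 * Real.pi * Complex.I * ξ))) x := by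
    intro x
    have h1 : HasDerivAt (fun x : ℝ => (2 * Real.pi * Complex.I * ((-(x * ξ) : ℝ) : ℂ)))
        (-(2 * Real.pi * Complex.I * ξ)) x := by
      have h0 : HasDerivAt (fun x : ℝ => -(x * ξ)) (-(1 * ξ)) x :=
        ((hasDerivAt_id x).mul_const ξ).neg
      have := (h0.ofReal_comp).const_mul (2 * Real.pi * Complex.I)
      exact this.congr_deriv (by push_cast; ring)
    exact h1.cexp
  have hcv : Continuous v := continuous_iff_continuousAt.2 fun x => (hv x).continuousAt
  have h := intervalIntegral.integral_mul_deriv_eq_deriv_mul (a := -1) (b := 1)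
    (u := fun x : ℝ => unitExp (-(x * ξ))) (v := v)
    (fun x _ => hu x) (fun x _ => hv x)
    (Continuous.intervalIntegrable (by fun_prop) _ _) (hv'.intervalIntegrable _ _)
  rw [fourier_cutoff, fourier_cutoff, h, ← intervalIntegral.integral_const_mul]
  have h2 : ∫ x in (-1 : ℝ)..1, unitExp (-(x * ξ)) * (-(2 * Real.pi * Complex.I * ξ)) * v x =
      - ∫ x in (-1 : ℝ)..1, 2 * Real.pi * Complex.I * ξ * (unitExp (-(x * ξ)) * v x) := by
    rw [← intervalIntegral.integral_neg]
    congr 1; ext x; ring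
  rw [h2]
  simp

/-! ### The function `sin² πx · sin² πξ` on the unit square -/

/-- The function `sin² πx · sin² πξ`. -/
def sqSin (z : ℝ × ℝ) : ℝ := Real.sin (Real.pi * z.1) ^ 2 * Real.sin (Real.pi * z.2) ^ 2

@[fun_prop] theorem continuous_sqSin : Continuous sqSin := by unfold sqSin; fun_prop

theorem sqSin_nonneg (z : ℝ × ℝ) : 0 ≤ sqSin z := by unfold sqSin; positivity

theorem sqSin_le_one (z : ℝ × ℝ) : sqSin z ≤ 1 :=
  mul_le_one₀ (Real.sin_sq_le_one _) (sq_nonneg _) (Real.sin_sq_le_one _)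

theorem integrable_of_continuous_of_bounded {f : ℝ × ℝ → ℝ} (hf : Continuous f) {C : ℝ}
    (h : ∀ z, |f z| ≤ C) : Integrable f unitSq :=
  Integrable.of_bound hf.aestronglyMeasurable C (Filter.Eventually.of_forall h)

theorem integrable_sqSin_pow (j : ℕ) : Integrable (fun z => sqSin z ^ j) unitSq :=
  integrable_of_continuous_of_bounded (C := 1) (by fun_prop) fun z => by
    rw [abs_of_nonneg (pow_nonneg (sqSin_nonneg z) j)]
    exact pow_le_one₀ (sqSin_nonneg z) (sqSin_le_one z)

theorem sq_prod_wallis_le (j : ℕ) :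
    (∏ i ∈ Finset.range j, ((2 * i + 1 : ℝ) / (2 * i + 2))) ^ 2 ≤ 1 / (j + 1) := by
  induction j with
  | zero => simp
  | succ j ih =>
    rw [Finset.prod_range_succ, mul_pow]
    have h1 : ((2 * j + 1 : ℝ) / (2 * j + 2)) ^ 2 ≤ (j + 1) / (j + 2) := by
      rw [div_pow, div_le_div_iff₀ (by positivity) (by positivity)]
      nlinarith [(Nat.cast_nonneg j : (0 : ℝ) ≤ j)]
    calc _ ≤ 1 / (j + 1 : ℝ) * ((j + 1) / (j + 2)) :=
          mul_le_mul ih h1 (by positivity) (by positivity)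
      _ = 1 / ((j + 1 : ℕ) + 1 : ℝ) := by push_cast; field_simp; ring

theorem integral_sin_pow_Ioc (j : ℕ) :
    ∫ x in Set.Ioc (0 : ℝ) 1, (Real.sin (Real.pi * x) ^ 2) ^ j =
      ∏ i ∈ Finset.range j, ((2 * i + 1 : ℝ) / (2 * i + 2)) := by
  rw [← intervalIntegral.integral_of_le zero_le_one]
  have h := intervalIntegral.integral_comp_mul_left (a := 0) (b := 1)
    (fun x => (Real.sin x ^ 2) ^ j) Real.pi_ne_zero
  rw [h]
  simp only [mul_zero, mul_one, ← pow_mul, integral_sin_pow_even, smul_eq_mul]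
  rw [← mul_assoc, inv_mul_cancel₀ Real.pi_ne_zero, one_mul]

/-- Each variable contributes a Wallis integral of size (j+1)^{-1/2}. Geometrically, s^j is of order
one only on a disc of radius about j^{-1/2} around (1/2, 1/2). -/
theorem integral_sqSin_pow_le (j : ℕ) : ∫ z, sqSin z ^ j ∂unitSq ≤ 1 / (j + 1) := by
  have : ∫ z, sqSin z ^ j ∂unitSq =
      (∏ i ∈ Finset.range j, ((2 * i + 1 : ℝ) / (2 * i + 2))) ^ 2 := by
    simp only [sqSin, mul_pow _ _ j]
    rw [unitSq, integral_prod_mul (fun x : ℝ => (Real.sin (Real.pi * x) ^ 2) ^ j)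
      (fun x : ℝ => (Real.sin (Real.pi * x) ^ 2) ^ j), integral_sin_pow_Ioc, sq]
  rw [this]
  exact sq_prod_wallis_le j

theorem pow_mul_one_sub_le {s : ℝ} (h0 : 0 ≤ s) (h1 : s ≤ 1) (m : ℕ) :
    s ^ m * (1 - s) ≤ 1 / (m + 1) := by
  rw [le_div_iff₀ (by positivity)]
  have h2 : (m + 1 : ℝ) * s ^ m ≤ ∑ i ∈ Finset.range (m + 1), s ^ i := by
    have : ∑ i ∈ Finset.range (m + 1), s ^ m ≤ ∑ i ∈ Finset.range (m + 1), s ^ i :=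
      Finset.sum_le_sum fun i hi =>
        pow_le_pow_of_le_one h0 h1 (Nat.lt_succ_iff.1 (Finset.mem_range.1 hi))
    simpa using this
  have h3 : (∑ i ∈ Finset.range (m + 1), s ^ i) * (1 - s) = 1 - s ^ (m + 1) := by
    have := geom_sum_mul s (m + 1); linarith
  have h4 : 0 ≤ s ^ (m + 1) := pow_nonneg h0 _
  nlinarith [mul_le_mul_of_nonneg_right h2 (sub_nonneg.2 h1)]

theorem pow_mul_one_sub_le_pow {s : ℝ} (h0 : 0 ≤ s) (h1 : s ≤ 1) (j : ℕ) :
    s ^ (2 * j) * (1 - s) ≤ 1 / (j + 1) * s ^ j := by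
  calc s ^ (2 * j) * (1 - s) = (s ^ j * (1 - s)) * s ^ j := by rw [two_mul, pow_add]; ring
    _ ≤ _ := mul_le_mul_of_nonneg_right (pow_mul_one_sub_le h0 h1 j) (pow_nonneg h0 _)

theorem pow_mul_one_sub_cube_le_pow {s : ℝ} (h0 : 0 ≤ s) (h1 : s ≤ 1) (j : ℕ) :
    s ^ (2 * j) * (1 - s) ^ 3 ≤ 27 / (j + 1) ^ 3 * s ^ j := by
  -- Three blocks of length ⌊j/3⌋ are taken out of the power of s, one to absorb each factor 1 - s.
  have hm : 3 * (j / 3) ≤ j := Nat.mul_div_le j 3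
  have hm2 : j + 1 ≤ 3 * (j / 3 + 1) := by omega
  set m := j / 3 with hm_def
  have e : s ^ (2 * j) * (1 - s) ^ 3 = (s ^ m * (1 - s)) ^ 3 * (s ^ (j - 3 * m) * s ^ j) := by
    rw [mul_pow, ← pow_mul, ← pow_add]
    have : 2 * j = m * 3 + (j - 3 * m + j) := by omega
    rw [this, pow_add]; ring
  have h2 : s ^ m * (1 - s) ≤ 3 / (j + 1) := by
    refine (pow_mul_one_sub_le h0 h1 m).trans ?_
    rw [div_le_div_iff₀ (by positivity) (by positivity)]
    have : ((j + 1 : ℕ) : ℝ) ≤ (3 * (m + 1) : ℕ) := by exact_mod_cast hm2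
    push_cast at this; linarith
  have h3 : 0 ≤ s ^ m * (1 - s) := mul_nonneg (pow_nonneg h0 _) (by linarith)
  rw [e]
  calc _ ≤ (3 / (j + 1 : ℝ)) ^ 3 * (1 * s ^ j) := by
        refine mul_le_mul (pow_le_pow_left₀ h3 h2 3) ?_ (by positivity) (by positivity)
        exact mul_le_mul_of_nonneg_right (pow_le_one₀ h0 h1) (pow_nonneg h0 _)
    _ = _ := by rw [div_pow, one_mul]; norm_num

/-! ### The window `(1 + cos πx) / 2` on `[-1, 1]` -/

/-- The function `(1 + cos πx) / 2`. -/
def windowFun (x : ℝ) : ℂ := ((1 + Real.cos (Real.pi * x)) / 2 : ℝ)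

/-- The derivative of `(1 + cos πx) / 2`. -/
def windowDeriv (x : ℝ) : ℂ := (-(Real.pi / 2) * Real.sin (Real.pi * x) : ℝ)

/-- The second derivative of `(1 + cos πx) / 2`. -/
def windowDerivTwo (x : ℝ) : ℂ := (-(Real.pi ^ 2 / 2) * Real.cos (Real.pi * x) : ℝ)

/-- The third derivative of `(1 + cos πx) / 2`. -/
def windowDerivThree (x : ℝ) : ℂ := (Real.pi ^ 3 / 2 * Real.sin (Real.pi * x) : ℝ)

@[fun_prop] theorem continuous_windowFun : Continuous windowFun := by unfold windowFun; fun_prop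
@[fun_prop] theorem continuous_windowDeriv : Continuous windowDeriv := by
  unfold windowDeriv; fun_prop
@[fun_prop] theorem continuous_windowDerivTwo : Continuous windowDerivTwo := by
  unfold windowDerivTwo; fun_prop
@[fun_prop] theorem continuous_windowDerivThree : Continuous windowDerivThree := by
  unfold windowDerivThree; fun_prop

theorem hasDerivAt_sin_pi (x : ℝ) :
    HasDerivAt (fun x => Real.sin (Real.pi * x)) (Real.cos (Real.pi * x) * Real.pi) x := by
  simpa using ((hasDerivAt_id x).const_mul Real.pi).sin

theorem hasDerivAt_cos_pi (x : ℝ) :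
    HasDerivAt (fun x => Real.cos (Real.pi * x)) (-Real.sin (Real.pi * x) * Real.pi) x := by
  simpa using ((hasDerivAt_id x).const_mul Real.pi).cos

theorem hasDerivAt_windowFun (x : ℝ) : HasDerivAt windowFun (windowDeriv x) x :=
  HasDerivAt.ofReal_comp (f := fun x => (1 + Real.cos (Real.pi * x)) / 2) <|
    (((hasDerivAt_cos_pi x).const_add 1).div_const 2).congr_deriv (by ring)

theorem hasDerivAt_windowDeriv (x : ℝ) : HasDerivAt windowDeriv (windowDerivTwo x) x :=
  HasDerivAt.ofReal_comp (f := fun x => -(Real.pi / 2) * Real.sin (Real.pi * x)) <|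
    ((hasDerivAt_sin_pi x).const_mul _).congr_deriv (by ring)

theorem hasDerivAt_windowDerivTwo (x : ℝ) : HasDerivAt windowDerivTwo (windowDerivThree x) x :=
  HasDerivAt.ofReal_comp (f := fun x => -(Real.pi ^ 2 / 2) * Real.cos (Real.pi * x)) <|
    ((hasDerivAt_cos_pi x).const_mul _).congr_deriv (by ring)

/-- The window and its first derivative vanish at ±1, so two integrations by parts leave no boundary
terms. The second derivative does not vanish there, which limits the decay of the transform to cubic
order. -/
theorem fourier_cutoff_windowFun (ξ : ℝ) :
    2 * Real.pi * Complex.I * ξ * 𝓕 (cutoff windowFun) ξ = 𝓕 (cutoff windowDeriv) ξ := by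
  rw [fourier_cutoff_deriv hasDerivAt_windowFun continuous_windowDeriv]
  simp [windowFun]

theorem fourier_cutoff_windowDeriv (ξ : ℝ) :
    2 * Real.pi * Complex.I * ξ * 𝓕 (cutoff windowDeriv) ξ = 𝓕 (cutoff windowDerivTwo) ξ := by
  rw [fourier_cutoff_deriv hasDerivAt_windowDeriv continuous_windowDerivTwo]
  simp [windowDeriv]

theorem ae_unitSq_fst_mem : ∀ᵐ z ∂unitSq, z.1 ∈ Set.Ioc (0 : ℝ) 1 :=
  Measure.quasiMeasurePreserving_fst.ae (ae_restrict_mem measurableSet_Ioc)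

theorem zak_cutoffLp {v : ℝ → ℂ} (hv : Continuous v) :
    zak (cutoffLp v hv) =ᵐ[unitSq] fun z => v z.1 + v (z.1 - 1) * unitExp (-z.2) := by
  filter_upwards [zak_toLp_of_support (memLp_cutoff hv) fun x hx => cutoff_of_notMem hx,
    ae_unitSq_fst_mem] with z hz h1
  rw [cutoffLp, hz, cutoff, Set.indicator_of_mem, Set.indicator_of_mem]
  · exact ⟨by linarith [h1.1], by linarith [h1.2]⟩
  · exact ⟨by linarith [h1.1], h1.2⟩

theorem exists_norm_zak_cutoffLp_le {v : ℝ → ℂ} (hv : Continuous v) :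
    ∃ C, 0 ≤ C ∧ ∀ᵐ z ∂unitSq, ‖zak (cutoffLp v hv) z‖ ≤ C := by
  obtain ⟨C, hC0, hC⟩ := exists_norm_cutoff_le hv
  refine ⟨C + C, by positivity, ?_⟩
  filter_upwards [zak_toLp_of_support (memLp_cutoff hv) fun x hx => cutoff_of_notMem hx] with z hz
  rw [cutoffLp, hz]
  refine (norm_add_le _ _).trans (add_le_add (hC _) ?_)
  rw [norm_mul, norm_unitExp, mul_one]
  exact hC _

/-- The Zak transform of the window. -/
def zakWindow (z : ℝ × ℝ) : ℂ := windowFun z.1 + windowFun (z.1 - 1) * unitExp (-z.2)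

@[fun_prop] theorem continuous_zakWindow : Continuous zakWindow := by
  unfold zakWindow; fun_prop

/-- This identity is the reason for the cosine window: the powers of s used as multipliers and the
zero of the Zak transform are expressed by the same function, so every estimate reduces to one
variable in [0, 1]. -/
theorem norm_sq_zakWindow (z : ℝ × ℝ) : ‖zakWindow z‖ ^ 2 = 1 - sqSin z := by
  have h1 : Real.cos (Real.pi * (z.1 - 1)) = -Real.cos (Real.pi * z.1) := by
    rw [mul_sub, mul_one, Real.cos_sub_pi]
  have h2 : zakWindow z = ((1 + Real.cos (Real.pi * z.1)) / 2 +
      (1 - Real.cos (Real.pi * z.1)) / 2 * Real.cos (2 * Real.pi * z.2) : ℝ) +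
      (-((1 - Real.cos (Real.pi * z.1)) / 2 * Real.sin (2 * Real.pi * z.2)) : ℝ) * Complex.I := by
    rw [zakWindow, windowFun, windowFun, h1, unitExp_eq_cos_add, mul_neg, Real.cos_neg,
      Real.sin_neg]
    push_cast; ring
  rw [h2, ← Complex.normSq_eq_norm_sq, Complex.normSq_add_mul_I, sqSin]
  have h3 : Real.cos (2 * Real.pi * z.2) = 1 - 2 * Real.sin (Real.pi * z.2) ^ 2 := by
    rw [mul_assoc, Real.cos_two_mul, Real.sin_sq]; ring
  have h4 := Real.sin_sq_add_cos_sq (2 * Real.pi * z.2)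
  have h5 := Real.sin_sq_add_cos_sq (Real.pi * z.1)
  have h6 : Real.sin (2 * Real.pi * z.2) ^ 2 = 1 - (1 - 2 * Real.sin (Real.pi * z.2) ^ 2) ^ 2 := by
    rw [← h3]; linarith
  have h7 : Real.sin (Real.pi * z.1) ^ 2 = 1 - Real.cos (Real.pi * z.1) ^ 2 := by linarith
  rw [neg_sq, mul_pow _ (Real.sin _), h6, h3, h7]
  ring

/-- The window `(1 + cos πx) / 2` on `(-1, 1]`. -/
def window : Lp ℂ 2 (volume : Measure ℝ) := cutoffLp windowFun continuous_windowFun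

theorem zak_window : zak window =ᵐ[unitSq] zakWindow := zak_cutoffLp continuous_windowFun

/-! ### Norms in `L²` -/

theorem norm_sq_eq_integral {α : Type*} [MeasurableSpace α] {μ : Measure α} (f : Lp ℂ 2 μ) :
    ‖f‖ ^ 2 = ∫ x, ‖f x‖ ^ 2 ∂μ := by
  have h := inner_self_eq_norm_sq_to_K (𝕜 := ℂ) f
  rw [L2.inner_def] at h
  have h2 : ∫ x, inner ℂ (f x) (f x) ∂μ = ((∫ x, ‖f x‖ ^ 2 ∂μ : ℝ) : ℂ) := by
    rw [← integral_complex_ofReal]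
    refine integral_congr_ae (Filter.Eventually.of_forall fun x => ?_)
    simp [inner_self_eq_norm_sq_to_K]
  rw [h2] at h
  have h3 : ((∫ x, ‖f x‖ ^ 2 ∂μ : ℝ) : ℂ) = ((‖f‖ ^ 2 : ℝ) : ℂ) := by rw [h]; simp
  exact (Complex.ofReal_injective h3).symm

theorem integrable_norm_sq {α : Type*} [MeasurableSpace α] {μ : Measure α} (f : Lp ℂ 2 μ) :
    Integrable (fun x => ‖f x‖ ^ 2) μ := (memLp_two_iff_integrable_sq_norm (Lp.memLp f).1).1 (Lp.memLp f)

theorem norm_sq_le_integral {α : Type*} [MeasurableSpace α] {μ : Measure α} (f : Lp ℂ 2 μ)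
    {h : α → ℝ} (hi : Integrable h μ) (hle : ∀ᵐ x ∂μ, ‖f x‖ ^ 2 ≤ h x) :
    ‖f‖ ^ 2 ≤ ∫ x, h x ∂μ := by
  rw [norm_sq_eq_integral]
  exact integral_mono_ae (integrable_norm_sq f) hi hle

/-! ### Moment estimates for the functions with Zak transform s^n·Zφ. -/

/-! ### Second differences and their commutators with multiplication by `x` -/

/-- Time-frequency shifts as continuous linear operators. -/
def shiftCLM (k : ℤ × ℤ) :
    Lp ℂ 2 (volume : Measure ℝ) →L[ℂ] Lp ℂ 2 (volume : Measure ℝ) :=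
  (gaborShift k).toContinuousLinearMap

theorem shiftCLM_apply (k : ℤ × ℤ) (f : Lp ℂ 2 (volume : Measure ℝ)) :
    shiftCLM k f = gaborShift k f := rfl

theorem shiftCLM_mul (k l : ℤ × ℤ) : shiftCLM k * shiftCLM l = shiftCLM (k + l) :=
  ContinuousLinearMap.ext fun f => gaborShift_gaborShift k l f

theorem shiftCLM_commute (k l : ℤ × ℤ) : Commute (shiftCLM k) (shiftCLM l) := by
  rw [Commute, SemiconjBy, shiftCLM_mul, shiftCLM_mul, add_comm]

/-- Multiplication by `sin² πx`. -/
def sinSqMod : Lp ℂ 2 (volume : Measure ℝ) →L[ℂ] Lp ℂ 2 (volume : Measure ℝ) :=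
  (1 / 4 : ℂ) • ((2 : ℂ) • 1 - shiftCLM (1, 0) - shiftCLM (-1, 0))

/-- The normalized second difference operator, which is multiplication by `sin² πξ` on the
Fourier side. -/
def sinSqTrans : Lp ℂ 2 (volume : Measure ℝ) →L[ℂ] Lp ℂ 2 (volume : Measure ℝ) :=
  (1 / 4 : ℂ) • ((2 : ℂ) • 1 - shiftCLM (0, 1) - shiftCLM (0, -1))

/-- The commutator of multiplication by `x` and `sinSqTrans`. -/
def transComm : Lp ℂ 2 (volume : Measure ℝ) →L[ℂ] Lp ℂ 2 (volume : Measure ℝ) :=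
  (1 / 4 : ℂ) • (shiftCLM (0, -1) - shiftCLM (0, 1))

/-- The commutator of multiplication by `x` and `transComm`. -/
def transCommTwo : Lp ℂ 2 (volume : Measure ℝ) →L[ℂ] Lp ℂ 2 (volume : Measure ℝ) :=
  (-1 / 4 : ℂ) • (shiftCLM (0, -1) + shiftCLM (0, 1))

theorem commute_shiftCLM_sinSqTrans (k : ℤ × ℤ) : Commute (shiftCLM k) sinSqTrans :=
  ((((Commute.one_right _).smul_right _).sub_right (shiftCLM_commute _ _)).sub_right
    (shiftCLM_commute _ _)).smul_right _

theorem commute_sinSqMod_sinSqTrans : Commute sinSqMod sinSqTrans :=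
  ((((Commute.one_left _).smul_left _).sub_left (commute_shiftCLM_sinSqTrans _)).sub_left
    (commute_shiftCLM_sinSqTrans _)).smul_left _

theorem commute_transComm_sinSqTrans : Commute transComm sinSqTrans :=
  ((commute_shiftCLM_sinSqTrans _).sub_left (commute_shiftCLM_sinSqTrans _)).smul_left _

/-- `MulX a b` says that `b(x) = x a(x)` almost everywhere. -/
def MulX (a b : Lp ℂ 2 (volume : Measure ℝ)) : Prop := ∀ᵐ x, b x = x * a x

theorem MulX.add {a b a' b' : Lp ℂ 2 (volume : Measure ℝ)} (h : MulX a b) (h' : MulX a' b') :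
    MulX (a + a') (b + b') := by
  filter_upwards [h, h', Lp.coeFn_add a a', Lp.coeFn_add b b'] with x e1 e2 e3 e4
  rw [e3, e4, Pi.add_apply, Pi.add_apply, e1, e2]; ring

theorem MulX.smul {a b : Lp ℂ 2 (volume : Measure ℝ)} (h : MulX a b) (c : ℂ) :
    MulX (c • a) (c • b) := by
  filter_upwards [h, Lp.coeFn_smul c a, Lp.coeFn_smul c b] with x e1 e3 e4
  rw [e3, e4, Pi.smul_apply, Pi.smul_apply, e1, smul_eq_mul, smul_eq_mul]; ring

theorem MulX.sub {a b a' b' : Lp ℂ 2 (volume : Measure ℝ)} (h : MulX a b) (h' : MulX a' b') :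
    MulX (a - a') (b - b') := by
  have := h.add (h'.smul (-1))
  simpa [sub_eq_add_neg] using this

theorem MulX.congr {a b a' b' : Lp ℂ 2 (volume : Measure ℝ)} (h : MulX a b) (ha : a = a')
    (hb : b = b') : MulX a' b' := ha ▸ hb ▸ h

/-- The commutation relation between multiplication by x and a shift: translation by n replaces x by
x + n, while a pure modulation contributes nothing. -/
theorem MulX.shift {a b : Lp ℂ 2 (volume : Measure ℝ)} (h : MulX a b) (k : ℤ × ℤ) :
    MulX (shiftCLM k a) (shiftCLM k b + (k.2 : ℂ) • shiftCLM k a) := by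
  filter_upwards [gaborShift_coeFn (Filter.EventuallyEq.refl _ (a : ℝ → ℂ)) k,
    gaborShift_coeFn (Filter.EventuallyEq.refl _ (b : ℝ → ℂ)) k, ae_comp_sub_int h k.2,
    Lp.coeFn_add (shiftCLM k b) ((k.2 : ℂ) • shiftCLM k a),
    Lp.coeFn_smul (k.2 : ℂ) (shiftCLM k a)] with x e1 e2 e3 e4 e5
  rw [e4, Pi.add_apply, e5, Pi.smul_apply, shiftCLM_apply, shiftCLM_apply, e1, e2, e3, smul_eq_mul]
  push_cast; ring

theorem MulX.sinSqMod {a b : Lp ℂ 2 (volume : Measure ℝ)} (h : MulX a b) :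
    MulX (sinSqMod a) (sinSqMod b) := by
  refine ((((h.smul 2).sub (h.shift (1, 0))).sub (h.shift (-1, 0))).smul (1 / 4)).congr ?_ ?_ <;>
  simp [_root_.sinSqMod]

theorem MulX.sinSqMod_pow {a b : Lp ℂ 2 (volume : Measure ℝ)} (h : MulX a b) (n : ℕ) :
    MulX ((_root_.sinSqMod ^ n) a) ((_root_.sinSqMod ^ n) b) := by
  induction n with
  | zero => simpa using h
  | succ n ih => simpa only [pow_succ'] using! ih.sinSqMod

theorem MulX.sinSqTrans {a b : Lp ℂ 2 (volume : Measure ℝ)} (h : MulX a b) :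
    MulX (sinSqTrans a) (sinSqTrans b + transComm a) := by
  refine ((((h.smul 2).sub (h.shift (0, 1))).sub (h.shift (0, -1))).smul (1 / 4)).congr ?_ ?_
  · simp [_root_.sinSqTrans]
  · simp only [_root_.sinSqTrans, transComm, smul_apply,
      sub_apply, one_apply_eq_self]
    rw [← smul_add]
    congr 1
    simp only [Int.cast_one, Int.cast_neg, one_smul, neg_smul]
    abel

theorem MulX.transComm {a b : Lp ℂ 2 (volume : Measure ℝ)} (h : MulX a b) :
    MulX (transComm a) (transComm b + transCommTwo a) := by
  refine (((h.shift (0, -1)).sub (h.shift (0, 1))).smul (1 / 4)).congr ?_ ?_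
  · simp [_root_.transComm]
  · simp only [_root_.transComm, transCommTwo, smul_apply,
      sub_apply, add_apply]
    rw [neg_div, neg_smul, ← sub_eq_add_neg, ← smul_sub]
    congr 1
    simp only [Int.cast_one, Int.cast_neg, one_smul, neg_smul]
    abel

/-- Leibniz rule: each of the n factors contributes one commutator, which commutes with the other
factors. At n = 0 the truncated exponent n - 1 is harmless because its coefficient is zero. -/
theorem MulX.sinSqTrans_pow {a b : Lp ℂ 2 (volume : Measure ℝ)} (h : MulX a b) (n : ℕ) :
    MulX ((_root_.sinSqTrans ^ n) a)
      ((_root_.sinSqTrans ^ n) b + (n : ℂ) • (_root_.sinSqTrans ^ (n - 1)) (_root_.transComm a)) := by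
  induction n with
  | zero => simpa using h
  | succ n ih =>
    refine ih.sinSqTrans.congr ?_ ?_
    · rw [pow_succ']; rfl
    · have hc : _root_.transComm ((_root_.sinSqTrans ^ n) a) =
          (_root_.sinSqTrans ^ n) (_root_.transComm a) :=
        DFunLike.congr_fun (commute_transComm_sinSqTrans.pow_right n) a
      rw [hc, map_add, map_smul, add_assoc, Nat.add_sub_cancel]
      congr 1
      · rw [pow_succ']; rfl
      · rcases n with _ | n
        · simp
        · have : _root_.sinSqTrans ((_root_.sinSqTrans ^ (n + 1 - 1)) (_root_.transComm a)) =
              (_root_.sinSqTrans ^ (n + 1)) (_root_.transComm a) := by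
            rw [Nat.add_sub_cancel, pow_succ']; rfl
          rw [this]
          push_cast
          module

/-- The operator with Zak multiplier `sin² πx · sin² πξ`. -/
def sinSqOp : Lp ℂ 2 (volume : Measure ℝ) →L[ℂ] Lp ℂ 2 (volume : Measure ℝ) :=
  sinSqMod * sinSqTrans

theorem sinSqOp_pow_apply (n : ℕ) (f : Lp ℂ 2 (volume : Measure ℝ)) :
    (sinSqOp ^ n) f = (sinSqMod ^ n) ((sinSqTrans ^ n) f) := by
  rw [sinSqOp, commute_sinSqMod_sinSqTrans.mul_pow]; rfl

/-- The function `x² (sinSqOp ^ (n+1) f₀)`, expressed through `f₁ = x f₀` and `f₂ = x² f₀`. -/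
def sinSqOpMoment (n : ℕ) (f₀ f₁ f₂ : Lp ℂ 2 (volume : Measure ℝ)) :
    Lp ℂ 2 (volume : Measure ℝ) :=
  (sinSqMod ^ (n + 1)) ((sinSqTrans ^ (n + 1)) f₂ + ((n : ℂ) + 1) • (sinSqTrans ^ n) (transComm f₁)
    + ((n : ℂ) + 1) • ((sinSqTrans ^ n) (transComm f₁ + transCommTwo f₀) +
        (n : ℂ) • (sinSqTrans ^ (n - 1)) (transComm (transComm f₀))))

theorem sinSqOpMoment_ae_eq {f₀ f₁ f₂ : Lp ℂ 2 (volume : Measure ℝ)} (h₁ : MulX f₀ f₁)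
    (h₂ : MulX f₁ f₂) (n : ℕ) :
    ∀ᵐ x, sinSqOpMoment n f₀ f₁ f₂ x = x ^ 2 * (sinSqOp ^ (n + 1)) f₀ x := by
  have e1 := (h₁.sinSqTrans_pow (n + 1)).sinSqMod_pow (n + 1)
  have e2 := ((h₂.sinSqTrans_pow (n + 1)).add
    ((h₁.transComm.sinSqTrans_pow n).smul ((n + 1 : ℕ) : ℂ))).sinSqMod_pow (n + 1)
  rw [← sinSqOp_pow_apply] at e1
  filter_upwards [e1, e2] with x e3 e4
  simp only [Nat.add_sub_cancel] at e3 e4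
  rw [sq, mul_assoc, ← e3, ← e4, sinSqOpMoment]
  push_cast
  rfl

theorem sq_add_four_le (p q r t : ℝ) :
    (p + q + r + t) ^ 2 ≤ 4 * (p ^ 2 + q ^ 2 + r ^ 2 + t ^ 2) := by
  linarith [sq_nonneg (p - q), sq_nonneg (p - r), sq_nonneg (p - t), sq_nonneg (q - r),
    sq_nonneg (q - t), sq_nonneg (r - t)]

/-! ### Zak-type models -/

/-- A linear isometry of `L²(ℝ)` into `L²` of the unit square which turns `sinSqMod` and
`sinSqTrans` into multiplication operators. -/
structure ZakModel where
  /-- The isometry. -/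
  toFun : Lp ℂ 2 (volume : Measure ℝ) →ₗᵢ[ℂ] Lp ℂ 2 unitSq
  /-- The multiplier of `sinSqMod`. -/
  mod : ℝ × ℝ → ℝ
  /-- The multiplier of `sinSqTrans`. -/
  trans : ℝ × ℝ → ℝ
  /-- The multiplier of `transComm`. -/
  comm : ℝ × ℝ → ℂ
  /-- The multiplier of `transCommTwo`. -/
  commTwo : ℝ × ℝ → ℂ
  mod_nonneg : ∀ z, 0 ≤ mod z
  mod_le_one : ∀ z, mod z ≤ 1
  trans_nonneg : ∀ z, 0 ≤ trans z
  trans_le_one : ∀ z, trans z ≤ 1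
  mod_mul_trans : ∀ z, mod z * trans z = sqSin z
  norm_sq_comm : ∀ z, ‖comm z‖ ^ 2 = trans z * (1 - trans z)
  norm_commTwo : ∀ z, ‖commTwo z‖ ≤ 1
  map_sinSqMod : ∀ f, toFun (sinSqMod f) =ᵐ[unitSq] fun z => (mod z : ℂ) * toFun f z
  map_sinSqTrans : ∀ f, toFun (sinSqTrans f) =ᵐ[unitSq] fun z => (trans z : ℂ) * toFun f z
  map_transComm : ∀ f, toFun (transComm f) =ᵐ[unitSq] fun z => comm z * toFun f z
  map_transCommTwo : ∀ f, toFun (transCommTwo f) =ᵐ[unitSq] fun z => commTwo z * toFun f z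

theorem unitExp_add_unitExp_neg (x : ℝ) :
    unitExp x + unitExp (-x) = ((2 - 4 * Real.sin (Real.pi * x) ^ 2 : ℝ) : ℂ) := by
  have h3 : Real.cos (2 * Real.pi * x) = 1 - 2 * Real.sin (Real.pi * x) ^ 2 := by
    rw [mul_assoc, Real.cos_two_mul, Real.sin_sq]; ring
  rw [unitExp_eq_cos_add, unitExp_eq_cos_add, mul_neg, Real.cos_neg, Real.sin_neg, h3]
  push_cast; ring

theorem unitExp_sub_unitExp_neg (x : ℝ) :
    unitExp x - unitExp (-x) = ((2 * Real.sin (2 * Real.pi * x) : ℝ) : ℂ) * Complex.I := by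
  rw [unitExp_eq_cos_add, unitExp_eq_cos_add, mul_neg, Real.cos_neg, Real.sin_neg]
  push_cast; ring

/-- A linear isometry which turns the generating time-frequency shifts into multiplication by
exponentials of the coordinates yields a Zak-type model. -/
def ZakModel.ofShifts (Y : Lp ℂ 2 (volume : Measure ℝ) →ₗᵢ[ℂ] Lp ℂ 2 unitSq)
    (α β : ℝ × ℝ → ℝ)
    (hα : ∀ (σ : ℤ) f, Y (gaborShift (σ, 0) f) =ᵐ[unitSq] fun z => unitExp (σ * α z) * Y f z)
    (hβ : ∀ (σ : ℤ) f, Y (gaborShift (0, σ) f) =ᵐ[unitSq] fun z => unitExp (σ * β z) * Y f z)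
    (hs : ∀ z, Real.sin (Real.pi * α z) ^ 2 * Real.sin (Real.pi * β z) ^ 2 = sqSin z) :
    ZakModel where
  toFun := Y
  mod z := Real.sin (Real.pi * α z) ^ 2
  trans z := Real.sin (Real.pi * β z) ^ 2
  comm z := (1 / 4 : ℂ) * (unitExp (-β z) - unitExp (β z))
  commTwo z := (-1 / 4 : ℂ) * (unitExp (-β z) + unitExp (β z))
  mod_nonneg z := sq_nonneg _
  mod_le_one z := Real.sin_sq_le_one _
  trans_nonneg z := sq_nonneg _
  trans_le_one z := Real.sin_sq_le_one _
  mod_mul_trans := hs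
  norm_sq_comm z := by
    rw [← neg_sub, unitExp_sub_unitExp_neg, mul_assoc, Real.sin_two_mul, ← Real.cos_sq']
    simp only [norm_mul, norm_neg, Complex.norm_real, Complex.norm_I, mul_one, norm_div, norm_one,
      Real.norm_eq_abs, mul_pow, sq_abs]
    norm_num
    ring
  norm_commTwo z := by
    rw [norm_mul]
    refine (mul_le_mul_of_nonneg_left (norm_add_le _ _) (norm_nonneg _)).trans ?_
    rw [norm_unitExp, norm_unitExp]; norm_num
  map_sinSqMod f := by
    have e : Y (sinSqMod f) = (1 / 4 : ℂ) • ((2 : ℂ) • Y f - Y (gaborShift (1, 0) f)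
        - Y (gaborShift (-1, 0) f)) := by
      simp [sinSqMod, shiftCLM_apply]
    rw [e]
    filter_upwards [hα 1 f, hα (-1) f, Lp.coeFn_smul (1 / 4 : ℂ) ((2 : ℂ) • Y f -
      Y (gaborShift (1, 0) f) - Y (gaborShift (-1, 0) f)),
      Lp.coeFn_sub ((2 : ℂ) • Y f - Y (gaborShift (1, 0) f)) (Y (gaborShift (-1, 0) f)),
      Lp.coeFn_sub ((2 : ℂ) • Y f) (Y (gaborShift (1, 0) f)), Lp.coeFn_smul (2 : ℂ) (Y f)]
      with z e1 e2 e3 e4 e5 e6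
    rw [e3, Pi.smul_apply, e4, Pi.sub_apply, e5, Pi.sub_apply, e6, Pi.smul_apply, e1, e2]
    have h := unitExp_add_unitExp_neg (α z)
    push_cast at h ⊢
    simp only [one_mul, neg_mul, smul_eq_mul]
    linear_combination (-(1 / 4 : ℂ) * Y f z) * h
  map_sinSqTrans f := by
    have e : Y (sinSqTrans f) = (1 / 4 : ℂ) • ((2 : ℂ) • Y f - Y (gaborShift (0, 1) f)
        - Y (gaborShift (0, -1) f)) := by
      simp [sinSqTrans, shiftCLM_apply]
    rw [e]
    filter_upwards [hβ 1 f, hβ (-1) f, Lp.coeFn_smul (1 / 4 : ℂ) ((2 : ℂ) • Y f -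
      Y (gaborShift (0, 1) f) - Y (gaborShift (0, -1) f)),
      Lp.coeFn_sub ((2 : ℂ) • Y f - Y (gaborShift (0, 1) f)) (Y (gaborShift (0, -1) f)),
      Lp.coeFn_sub ((2 : ℂ) • Y f) (Y (gaborShift (0, 1) f)), Lp.coeFn_smul (2 : ℂ) (Y f)]
      with z e1 e2 e3 e4 e5 e6
    rw [e3, Pi.smul_apply, e4, Pi.sub_apply, e5, Pi.sub_apply, e6, Pi.smul_apply, e1, e2]
    have h := unitExp_add_unitExp_neg (β z)
    push_cast at h ⊢
    simp only [one_mul, neg_mul, smul_eq_mul]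
    linear_combination (-(1 / 4 : ℂ) * Y f z) * h
  map_transComm f := by
    have e : Y (transComm f) = (1 / 4 : ℂ) • (Y (gaborShift (0, -1) f) -
        Y (gaborShift (0, 1) f)) := by
      simp [transComm, shiftCLM_apply]
    rw [e]
    filter_upwards [hβ 1 f, hβ (-1) f, Lp.coeFn_smul (1 / 4 : ℂ) (Y (gaborShift (0, -1) f) -
      Y (gaborShift (0, 1) f)), Lp.coeFn_sub (Y (gaborShift (0, -1) f)) (Y (gaborShift (0, 1) f))]
      with z e1 e2 e3 e4
    rw [e3, Pi.smul_apply, e4, Pi.sub_apply, e1, e2, smul_eq_mul]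
    push_cast
    simp only [one_mul, neg_mul]
    ring
  map_transCommTwo f := by
    have e : Y (transCommTwo f) = (-1 / 4 : ℂ) • (Y (gaborShift (0, -1) f) +
        Y (gaborShift (0, 1) f)) := by
      simp [transCommTwo, shiftCLM_apply]
    rw [e]
    filter_upwards [hβ 1 f, hβ (-1) f, Lp.coeFn_smul (-1 / 4 : ℂ) (Y (gaborShift (0, -1) f) +
      Y (gaborShift (0, 1) f)), Lp.coeFn_add (Y (gaborShift (0, -1) f)) (Y (gaborShift (0, 1) f))]
      with z e1 e2 e3 e4
    rw [e3, Pi.smul_apply, e4, Pi.add_apply, e1, e2, smul_eq_mul]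
    push_cast
    simp only [one_mul, neg_mul]
    ring

/-- The Zak transform as a Zak-type model. -/
def zakModel : ZakModel :=
  ZakModel.ofShifts zak.toLinearIsometry (fun z => z.1) (fun z => z.2)
    (fun σ f => by simpa [sqChar] using! zak_gaborShift (σ, 0) f)
    (fun σ f => by simpa [sqChar] using! zak_gaborShift (0, σ) f) fun z => rfl

theorem fourier_symm_gaborShift (m n : ℤ) (f : Lp ℂ 2 (volume : Measure ℝ)) :
    (Lp.fourierTransformₗᵢ ℝ ℂ).symm (gaborShift (m, n) f) =
      gaborShift (n, -m) ((Lp.fourierTransformₗᵢ ℝ ℂ).symm f) := by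
  rw [LinearIsometryEquiv.symm_apply_eq]
  have h : (Lp.fourierTransformₗᵢ ℝ ℂ) (gaborShift (n, -m) ((Lp.fourierTransformₗᵢ ℝ ℂ).symm f)) =
      gaborShift (- -m, n) ((Lp.fourierTransformₗᵢ ℝ ℂ) ((Lp.fourierTransformₗᵢ ℝ ℂ).symm f)) :=
    fourier_gaborShift n (-m) _
  rw [h, LinearIsometryEquiv.apply_symm_apply, neg_neg]

/-- The Zak transform of the inverse Fourier transform as a Zak-type model. -/
def zakFourierModel : ZakModel :=
  ZakModel.ofShifts ((Lp.fourierTransformₗᵢ ℝ ℂ).symm.trans zak).toLinearIsometry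
    (fun z => -z.2) (fun z => z.1)
    (fun σ f => by
      have h := zak_gaborShift (0, -σ) ((Lp.fourierTransformₗᵢ ℝ ℂ).symm f)
      rw [← fourier_symm_gaborShift σ 0] at h
      simpa [sqChar] using! h)
    (fun σ f => by
      have h := zak_gaborShift (σ, 0) ((Lp.fourierTransformₗᵢ ℝ ℂ).symm f)
      rw [← neg_zero, ← fourier_symm_gaborShift 0 σ] at h
      simpa [sqChar] using! h)
    fun z => by simp [sqSin, mul_comm]

namespace ZakModel

variable (Y : ZakModel)

theorem map_sinSqMod_pow (n : ℕ) (f : Lp ℂ 2 (volume : Measure ℝ)) :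
    Y.toFun ((sinSqMod ^ n) f) =ᵐ[unitSq] fun z => ((Y.mod z ^ n : ℝ) : ℂ) * Y.toFun f z := by
  induction n with
  | zero => simp
  | succ n ih =>
    rw [pow_succ']
    filter_upwards [ih, Y.map_sinSqMod ((sinSqMod ^ n) f)] with z h1 h2
    refine h2.trans ?_
    rw [h1]; push_cast; ring

theorem map_sinSqTrans_pow (n : ℕ) (f : Lp ℂ 2 (volume : Measure ℝ)) :
    Y.toFun ((sinSqTrans ^ n) f) =ᵐ[unitSq] fun z => ((Y.trans z ^ n : ℝ) : ℂ) * Y.toFun f z := by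
  induction n with
  | zero => simp
  | succ n ih =>
    rw [pow_succ']
    filter_upwards [ih, Y.map_sinSqTrans ((sinSqTrans ^ n) f)] with z h1 h2
    refine h2.trans ?_
    rw [h1]; push_cast; ring

theorem map_sinSqOp_pow (n : ℕ) (f : Lp ℂ 2 (volume : Measure ℝ)) :
    Y.toFun ((sinSqOp ^ n) f) =ᵐ[unitSq] fun z => ((sqSin z ^ n : ℝ) : ℂ) * Y.toFun f z := by
  rw [sinSqOp_pow_apply]
  filter_upwards [Y.map_sinSqMod_pow n ((sinSqTrans ^ n) f), Y.map_sinSqTrans_pow n f] with z h1 h2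
  rw [h1, h2, ← Y.mod_mul_trans]; push_cast; ring

theorem trans_ge_sqSin (z : ℝ × ℝ) : sqSin z ≤ Y.trans z := by
  rw [← Y.mod_mul_trans]
  exact mul_le_of_le_one_left (Y.trans_nonneg z) (Y.mod_le_one z)

/-- One factor 1/(n+1) comes from s^{2n}(1 - s) ≤ s^n/(n+1), where 1 - s bounds |Zf|², and another
from the integral of s^n. -/
theorem norm_sinSqOp_pow_le {f : Lp ℂ 2 (volume : Measure ℝ)}
    (hf : ∀ᵐ z ∂unitSq, ‖Y.toFun f z‖ ^ 2 ≤ 1 - sqSin z) (n : ℕ) :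
    ‖(sinSqOp ^ n) f‖ ≤ 1 / (n + 1) := by
  rw [← Y.toFun.norm_map]
  have h : ‖Y.toFun ((sinSqOp ^ n) f)‖ ^ 2 ≤ ∫ z, 1 / (n + 1 : ℝ) * sqSin z ^ n ∂unitSq := by
    refine norm_sq_le_integral _ ((integrable_sqSin_pow n).const_mul _) ?_
    filter_upwards [hf, Y.map_sinSqOp_pow n f] with z h1 h2
    rw [h2, norm_mul, mul_pow, Complex.norm_real, Real.norm_of_nonneg (pow_nonneg (sqSin_nonneg z) n),
      ← pow_mul, mul_comm n 2]
    exact (mul_le_mul_of_nonneg_left h1 (pow_nonneg (sqSin_nonneg z) _)).trans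
      (pow_mul_one_sub_le_pow (sqSin_nonneg z) (sqSin_le_one z) n)
  rw [integral_const_mul] at h
  have h2 : ‖Y.toFun ((sinSqOp ^ n) f)‖ ^ 2 ≤ (1 / (n + 1 : ℝ)) ^ 2 := by
    rw [sq (1 / (n + 1 : ℝ))]
    exact h.trans (mul_le_mul_of_nonneg_left (integral_sqSin_pow_le n) (by positivity))
  exact (pow_le_pow_iff_left₀ (norm_nonneg _) (by positivity) two_ne_zero).1 h2

theorem map_sinSqOpMoment (n : ℕ) (f₀ f₁ f₂ : Lp ℂ 2 (volume : Measure ℝ)) :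
    Y.toFun (sinSqOpMoment n f₀ f₁ f₂) =ᵐ[unitSq] fun z => ((Y.mod z ^ (n + 1) : ℝ) : ℂ) *
      (((Y.trans z ^ (n + 1) : ℝ) : ℂ) * Y.toFun f₂ z +
        ((n : ℂ) + 1) * (((Y.trans z ^ n : ℝ) : ℂ) * (Y.comm z * Y.toFun f₁ z)) +
        ((n : ℂ) + 1) * (((Y.trans z ^ n : ℝ) : ℂ) *
          (Y.comm z * Y.toFun f₁ z + Y.commTwo z * Y.toFun f₀ z) +
          n * (((Y.trans z ^ (n - 1) : ℝ) : ℂ) * (Y.comm z * (Y.comm z * Y.toFun f₀ z))))) := by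
  unfold sinSqOpMoment
  refine (Y.map_sinSqMod_pow (n + 1) _).trans ?_
  simp only [map_add, map_smul]
  set A := Y.toFun ((sinSqTrans ^ (n + 1)) f₂)
  set B := Y.toFun ((sinSqTrans ^ n) (transComm f₁))
  set D := Y.toFun ((sinSqTrans ^ n) (transCommTwo f₀))
  set E := Y.toFun ((sinSqTrans ^ (n - 1)) (transComm (transComm f₀)))
  filter_upwards [Y.map_sinSqTrans_pow (n + 1) f₂, Y.map_sinSqTrans_pow n (transComm f₁),
    Y.map_sinSqTrans_pow n (transCommTwo f₀),
    Y.map_sinSqTrans_pow (n - 1) (transComm (transComm f₀)), Y.map_transComm f₁,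
    Y.map_transComm f₀, Y.map_transComm (transComm f₀), Y.map_transCommTwo f₀,
    Lp.coeFn_add (A + ((n : ℂ) + 1) • B) (((n : ℂ) + 1) • (B + D + (n : ℂ) • E)),
    Lp.coeFn_add A (((n : ℂ) + 1) • B), Lp.coeFn_smul ((n : ℂ) + 1) B,
    Lp.coeFn_smul ((n : ℂ) + 1) (B + D + (n : ℂ) • E), Lp.coeFn_add (B + D) ((n : ℂ) • E),
    Lp.coeFn_add B D, Lp.coeFn_smul (n : ℂ) E] with z e1 e2 e3 e4 e5 e6 e7 e8 g1 g2 g3 g4 g5 g6 g7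
  rw [g1, Pi.add_apply, g2, Pi.add_apply, g3, Pi.smul_apply, g4, Pi.smul_apply, g5, Pi.add_apply,
    g6, Pi.add_apply, g7, Pi.smul_apply, e1, e2, e3, e4, e5, e7, e6, e8]
  simp only [smul_eq_mul]
  ring

/-- With w = √(1 - s), both `comm` and the image of f₀ are at most w, so the terms of the moment are
of size 1, n·w and n²·w³ times s^n. In the square, each factor 1 - s gains 1/n at the cost of a part
of the power of s. What remains is a multiple of (n+1)·s^n, whose integral is bounded. -/
theorem norm_sq_sinSqOpMoment_le {f₀ f₁ f₂ : Lp ℂ 2 (volume : Measure ℝ)} {C : ℝ} (hC : 0 ≤ C)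
    (h₀ : ∀ᵐ z ∂unitSq, ‖Y.toFun f₀ z‖ ^ 2 ≤ 1 - sqSin z)
    (h₁ : ∀ᵐ z ∂unitSq, ‖Y.toFun f₁ z‖ ≤ C)
    (h₂ : ∀ᵐ z ∂unitSq, ‖Y.toFun f₂ z‖ ≤ C) (n : ℕ) :
    ∀ᵐ z ∂unitSq, ‖Y.toFun (sinSqOpMoment n f₀ f₁ f₂) z‖ ^ 2 ≤
      4 * (C ^ 2 + (4 * C ^ 2 + 1) + 27) * ((n : ℝ) + 1) * sqSin z ^ n := by
  filter_upwards [h₀, h₁, h₂, Y.map_sinSqOpMoment n f₀ f₁ f₂] with z k0 k1 k2 hz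
  rw [hz]
  set s := sqSin z with hs
  have hs0 : 0 ≤ s := sqSin_nonneg z
  have hs1 : s ≤ 1 := sqSin_le_one z
  set a := Y.mod z
  set b := Y.trans z
  have ha0 : 0 ≤ a := Y.mod_nonneg z
  have ha1 : a ≤ 1 := Y.mod_le_one z
  have hb0 : 0 ≤ b := Y.trans_nonneg z
  have hb1 : b ≤ 1 := Y.trans_le_one z
  have hsb : s ≤ b := Y.trans_ge_sqSin z
  have hab : a * b = s := Y.mod_mul_trans z
  set w := Real.sqrt (1 - s)
  have hw0 : 0 ≤ w := Real.sqrt_nonneg _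
  have hw2 : w ^ 2 = 1 - s := Real.sq_sqrt (by linarith)
  have hcw : ‖Y.comm z‖ ≤ w := by
    refine Real.le_sqrt_of_sq_le ?_
    rw [Y.norm_sq_comm]
    calc b * (1 - b) ≤ 1 * (1 - b) := mul_le_mul_of_nonneg_right hb1 (by linarith)
      _ ≤ 1 - s := by linarith
  have hf0 : ‖Y.toFun f₀ z‖ ≤ w := Real.le_sqrt_of_sq_le k0
  have hn : (0 : ℝ) ≤ n := Nat.cast_nonneg n
  -- The two commutators restore the missing power: b^{n-1}|comm|² = b^n(1 - b), and 1 - b ≤ 1 - s.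
  have hc2 : (n : ℝ) * (b ^ (n - 1) * (‖Y.comm z‖ * ‖Y.comm z‖)) ≤ n * (b ^ n * w ^ 2) := by
    rcases n with _ | n
    · simp
    · refine mul_le_mul_of_nonneg_left ?_ hn
      rw [← sq, Y.norm_sq_comm, Nat.add_sub_cancel, pow_succ, mul_assoc]
      refine mul_le_mul_of_nonneg_left ?_ (pow_nonneg hb0 _)
      rw [hw2]
      exact mul_le_mul_of_nonneg_left (by linarith) hb0
  have hbn : 0 ≤ b ^ n := pow_nonneg hb0 n
  have hbound : ‖((b ^ (n + 1) : ℝ) : ℂ) * Y.toFun f₂ z +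
        ((n : ℂ) + 1) * (((b ^ n : ℝ) : ℂ) * (Y.comm z * Y.toFun f₁ z)) +
        ((n : ℂ) + 1) * (((b ^ n : ℝ) : ℂ) *
          (Y.comm z * Y.toFun f₁ z + Y.commTwo z * Y.toFun f₀ z) +
          n * (((b ^ (n - 1) : ℝ) : ℂ) * (Y.comm z * (Y.comm z * Y.toFun f₀ z))))‖ ≤
      b ^ n * (C + 2 * (n + 1) * C * w + (n + 1) * w + (n + 1) * n * w ^ 3) := by
    have hN : ‖((n : ℂ) + 1)‖ = (n : ℝ) + 1 := by
      rw [← Nat.cast_one, ← Nat.cast_add, Complex.norm_natCast]; push_cast; ring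
    have t1 : ‖((b ^ (n + 1) : ℝ) : ℂ) * Y.toFun f₂ z‖ ≤ b ^ n * C := by
      rw [norm_mul, Complex.norm_real, Real.norm_of_nonneg (pow_nonneg hb0 _)]
      exact mul_le_mul (pow_le_pow_of_le_one hb0 hb1 (Nat.le_succ n)) k2 (norm_nonneg _) hbn
    have t2 : ‖Y.comm z * Y.toFun f₁ z‖ ≤ w * C := by
      rw [norm_mul]; exact mul_le_mul hcw k1 (norm_nonneg _) hw0
    have t3 : ‖Y.commTwo z * Y.toFun f₀ z‖ ≤ w := by
      rw [norm_mul]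
      calc _ ≤ 1 * w := mul_le_mul (Y.norm_commTwo z) hf0 (norm_nonneg _) zero_le_one
        _ = w := one_mul w
    have t4 : ‖(n : ℂ) * (((b ^ (n - 1) : ℝ) : ℂ) * (Y.comm z * (Y.comm z * Y.toFun f₀ z)))‖ ≤
        b ^ n * (n * w ^ 3) := by
      rw [norm_mul, norm_mul, norm_mul, norm_mul, Complex.norm_natCast, Complex.norm_real,
        Real.norm_of_nonneg (pow_nonneg hb0 _)]
      calc _ = (n : ℝ) * (b ^ (n - 1) * (‖Y.comm z‖ * ‖Y.comm z‖)) * ‖Y.toFun f₀ z‖ := by ring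
        _ ≤ (n * (b ^ n * w ^ 2)) * w := mul_le_mul hc2 hf0 (norm_nonneg _) (by positivity)
        _ = _ := by ring
    have t5 : ∀ u : ℂ, ‖((b ^ n : ℝ) : ℂ) * u‖ = b ^ n * ‖u‖ := fun u => by
      rw [norm_mul, Complex.norm_real, Real.norm_of_nonneg hbn]
    refine (norm_add₃_le).trans ?_
    rw [norm_mul _ (((b ^ n : ℝ) : ℂ) * _), norm_mul _ (_ + _), hN, t5]
    have t6 := (norm_add_le (((b ^ n : ℝ) : ℂ) * (Y.comm z * Y.toFun f₁ z +
      Y.commTwo z * Y.toFun f₀ z)) ((n : ℂ) * (((b ^ (n - 1) : ℝ) : ℂ) *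
        (Y.comm z * (Y.comm z * Y.toFun f₀ z)))))
    rw [t5] at t6
    have t7 : b ^ n * ‖Y.comm z * Y.toFun f₁ z + Y.commTwo z * Y.toFun f₀ z‖ ≤
        b ^ n * (w * C + w) :=
      mul_le_mul_of_nonneg_left ((norm_add_le _ _).trans (add_le_add t2 t3)) hbn
    have t8 := t6.trans (add_le_add t7 t4)
    have t9 : (0 : ℝ) ≤ n + 1 := by positivity
    have t10 := mul_le_mul_of_nonneg_left t8 t9
    have t11 := mul_le_mul_of_nonneg_left (mul_le_mul_of_nonneg_left t2 hbn) t9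
    refine (add_le_add (add_le_add t1 t11) t10).trans_eq ?_
    ring
  rw [norm_mul, Complex.norm_real, Real.norm_of_nonneg (pow_nonneg ha0 _), mul_pow]
  set T := C + 2 * (n + 1) * C * w + (n + 1) * w + (n + 1) * n * w ^ 3 with hT
  have hT0 : 0 ≤ T := by positivity
  have hTsq : T ^ 2 ≤ 4 * (C ^ 2 + (4 * C ^ 2 + 1) * (n + 1) ^ 2 * (1 - s) +
      (n + 1) ^ 2 * n ^ 2 * (1 - s) ^ 3) := by
    rw [← hw2]
    refine (sq_add_four_le _ _ _ _).trans_eq ?_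
    ring
  -- Since ab = s, the square carries s^{2n}: one factor s^n absorbs the powers of 1 - s, and the
  -- other is kept for integration.
  calc (a ^ (n + 1)) ^ 2 * _ ^ 2 ≤ (a ^ n) ^ 2 * (b ^ n * T) ^ 2 := by
        refine mul_le_mul (pow_le_pow_left₀ (pow_nonneg ha0 _)
          (pow_le_pow_of_le_one ha0 ha1 (Nat.le_succ n)) 2)
          (pow_le_pow_left₀ (norm_nonneg _) hbound 2) (by positivity) (by positivity)
    _ = s ^ (2 * n) * T ^ 2 := by rw [← hab]; ring
    _ ≤ s ^ (2 * n) * (4 * (C ^ 2 + (4 * C ^ 2 + 1) * (n + 1) ^ 2 * (1 - s) +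
          (n + 1) ^ 2 * n ^ 2 * (1 - s) ^ 3)) :=
        mul_le_mul_of_nonneg_left hTsq (pow_nonneg hs0 _)
    _ = 4 * (C ^ 2 * s ^ (2 * n) + (4 * C ^ 2 + 1) * (n + 1) ^ 2 * (s ^ (2 * n) * (1 - s)) +
          (n + 1) ^ 2 * n ^ 2 * (s ^ (2 * n) * (1 - s) ^ 3)) := by ring
    _ ≤ 4 * (C ^ 2 * ((n + 1) * s ^ n) + (4 * C ^ 2 + 1) * (n + 1) ^ 2 * (1 / (n + 1) * s ^ n) +
          (n + 1) ^ 2 * (n + 1) ^ 2 * (27 / (n + 1) ^ 3 * s ^ n)) := by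
        have i1 : s ^ (2 * n) ≤ (n + 1) * s ^ n := by
          calc s ^ (2 * n) ≤ s ^ n := pow_le_pow_of_le_one hs0 hs1 (by omega)
            _ ≤ (n + 1) * s ^ n := le_mul_of_one_le_left (pow_nonneg hs0 _) (by linarith)
        have i2 := pow_mul_one_sub_le_pow hs0 hs1 n
        have i3 := pow_mul_one_sub_cube_le_pow hs0 hs1 n
        have i4 : (n : ℝ) ^ 2 ≤ (n + 1) ^ 2 := by nlinarith
        have i5 : 0 ≤ s ^ (2 * n) * (1 - s) ^ 3 :=
          mul_nonneg (pow_nonneg hs0 _) (pow_nonneg (by linarith) _)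
        gcongr
    _ = _ := by field_simp

theorem norm_sinSqOpMoment_le {f₀ f₁ f₂ : Lp ℂ 2 (volume : Measure ℝ)} {C : ℝ} (hC : 0 ≤ C)
    (h₀ : ∀ᵐ z ∂unitSq, ‖Y.toFun f₀ z‖ ^ 2 ≤ 1 - sqSin z)
    (h₁ : ∀ᵐ z ∂unitSq, ‖Y.toFun f₁ z‖ ≤ C)
    (h₂ : ∀ᵐ z ∂unitSq, ‖Y.toFun f₂ z‖ ≤ C) (n : ℕ) :
    ‖sinSqOpMoment n f₀ f₁ f₂‖ ^ 2 ≤ 4 * (C ^ 2 + (4 * C ^ 2 + 1) + 27) := by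
  rw [← Y.toFun.norm_map]
  refine (norm_sq_le_integral _ ((integrable_sqSin_pow n).const_mul _)
    (Y.norm_sq_sinSqOpMoment_le hC h₀ h₁ h₂ n)).trans ?_
  rw [integral_const_mul]
  refine (mul_le_mul_of_nonneg_left (integral_sqSin_pow_le n) (by positivity)).trans_eq ?_
  field_simp

end ZakModel

/-! ### Decay of the iterates of `sinSqOp` -/

/-- Uniform decay of a sequence in `L²(ℝ)`: `‖F n‖ ≤ 1 / (n + 1)` and `‖x² F n‖ ≤ K`. -/
def HasMomentDecay (F : ℕ → Lp ℂ 2 (volume : Measure ℝ)) (K : ℝ) : Prop :=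
  ∀ n, ‖F n‖ ≤ 1 / (n + 1) ∧
    ∃ G : Lp ℂ 2 (volume : Measure ℝ), (∀ᵐ x, G x = x ^ 2 * F n x) ∧ ‖G‖ ≤ K

theorem ZakModel.exists_hasMomentDecay (Y : ZakModel) {f₀ f₁ f₂ : Lp ℂ 2 (volume : Measure ℝ)}
    {C₁ C₂ : ℝ} (hm₁ : MulX f₀ f₁) (hm₂ : MulX f₁ f₂)
    (h₀ : ∀ᵐ z ∂unitSq, ‖Y.toFun f₀ z‖ ^ 2 ≤ 1 - sqSin z)
    (h₁ : ∀ᵐ z ∂unitSq, ‖Y.toFun f₁ z‖ ≤ C₁)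
    (h₂ : ∀ᵐ z ∂unitSq, ‖Y.toFun f₂ z‖ ≤ C₂) :
    ∃ K, HasMomentDecay (fun n => (sinSqOp ^ n) f₀) K := by
  set C := max (max C₁ C₂) 0
  have hC : 0 ≤ C := le_max_right _ _
  have h₁' : ∀ᵐ z ∂unitSq, ‖Y.toFun f₁ z‖ ≤ C := by
    filter_upwards [h₁] with z hz using hz.trans ((le_max_left _ _).trans (le_max_left _ _))
  have h₂' : ∀ᵐ z ∂unitSq, ‖Y.toFun f₂ z‖ ≤ C := by
    filter_upwards [h₂] with z hz using hz.trans ((le_max_right _ _).trans (le_max_left _ _))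
  set L := Real.sqrt (4 * (C ^ 2 + (4 * C ^ 2 + 1) + 27))
  refine ⟨max L ‖f₂‖, fun n => ⟨Y.norm_sinSqOp_pow_le h₀ n, ?_⟩⟩
  -- `sinSqOpMoment` describes the power n + 1, so the power 0 is treated directly.
  rcases n with _ | n
  · refine ⟨f₂, ?_, le_max_right _ _⟩
    filter_upwards [hm₁, hm₂] with x e1 e2
    rw [e2, e1, pow_zero, one_apply_eq_self]; ring
  · refine ⟨sinSqOpMoment n f₀ f₁ f₂, sinSqOpMoment_ae_eq hm₁ hm₂ n, le_max_of_le_left ?_⟩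
    exact Real.le_sqrt_of_sq_le (Y.norm_sinSqOpMoment_le hC h₀ h₁' h₂' n)

theorem mulX_cutoffLp {v : ℝ → ℂ} (hv : Continuous v) {w : ℝ → ℂ} (hw : Continuous w)
    (h : ∀ x, w x = x * v x) : MulX (cutoffLp v hv) (cutoffLp w hw) := by
  filter_upwards [(memLp_cutoff hv).coeFn_toLp, (memLp_cutoff hw).coeFn_toLp] with x e1 e2
  rw [cutoffLp, cutoffLp, e1, e2]
  simp only [cutoff, Set.indicator_apply]
  split_ifs <;> simp [h]

theorem norm_sq_zak_window_le : ∀ᵐ z ∂unitSq, ‖zak window z‖ ^ 2 ≤ 1 - sqSin z := by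
  filter_upwards [zak_window] with z hz
  rw [hz, norm_sq_zakWindow]

theorem exists_hasMomentDecay_window : ∃ K, HasMomentDecay (fun n => (sinSqOp ^ n) window) K := by
  have c1 : Continuous fun x : ℝ => (x : ℂ) * windowFun x := by fun_prop
  have c2 : Continuous fun x : ℝ => (x : ℂ) * (x * windowFun x) := by fun_prop
  obtain ⟨C₁, -, h₁⟩ := exists_norm_zak_cutoffLp_le c1
  obtain ⟨C₂, -, h₂⟩ := exists_norm_zak_cutoffLp_le c2
  exact zakModel.exists_hasMomentDecay (mulX_cutoffLp continuous_windowFun c1 fun x => rfl)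
    (mulX_cutoffLp c1 c2 fun x => rfl) norm_sq_zak_window_le h₁ h₂

theorem fourier_cutoffLp_ae_eq {v : ℝ → ℂ} (hv : Continuous v) :
    (𝓕 (cutoffLp v hv) : Lp ℂ 2 (volume : Measure ℝ)) =ᵐ[volume] 𝓕 (cutoff v) :=
  fourier_toLp_ae_eq (integrable_cutoff hv) (memLp_cutoff hv)

theorem mulX_fourier_cutoffLp {v w : ℝ → ℂ} (hv : Continuous v) (hw : Continuous w)
    (h : ∀ ξ : ℝ, 2 * Real.pi * Complex.I * ξ * 𝓕 (cutoff v) ξ = 𝓕 (cutoff w) ξ) :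
    MulX (𝓕 (cutoffLp v hv)) ((2 * Real.pi * Complex.I : ℂ)⁻¹ • 𝓕 (cutoffLp w hw)) := by
  filter_upwards [fourier_cutoffLp_ae_eq hv, fourier_cutoffLp_ae_eq hw,
    Lp.coeFn_smul ((2 * Real.pi * Complex.I : ℂ)⁻¹) (𝓕 (cutoffLp w hw))] with x e1 e2 e3
  rw [e3, Pi.smul_apply, e1, e2, ← h, smul_eq_mul]
  have : (2 * Real.pi * Complex.I : ℂ) ≠ 0 := by simp [Real.pi_ne_zero, Complex.I_ne_zero]
  field_simp

theorem norm_smul_le_of_ae {f : Lp ℂ 2 unitSq} {C : ℝ} (hf : ∀ᵐ z ∂unitSq, ‖f z‖ ≤ C) (c : ℂ) :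
    ∀ᵐ z ∂unitSq, ‖(c • f) z‖ ≤ ‖c‖ * C := by
  filter_upwards [hf, Lp.coeFn_smul c f] with z e1 e2
  rw [e2, Pi.smul_apply, norm_smul]
  exact mul_le_mul_of_nonneg_left e1 (norm_nonneg c)

theorem zakFourierModel_fourier (f : Lp ℂ 2 (volume : Measure ℝ)) :
    zakFourierModel.toFun (𝓕 f) = zak f := by
  have : (Lp.fourierTransformₗᵢ ℝ ℂ).symm (𝓕 f) = f :=
    (Lp.fourierTransformₗᵢ ℝ ℂ).symm_apply_apply f
  change zak ((Lp.fourierTransformₗᵢ ℝ ℂ).symm (𝓕 f)) = _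
  rw [this]

/-- On the Fourier side multiplication by the variable is differentiation, so f₁ and f₂ are
multiples of the transforms of the first two derivatives of the window. In `zakFourierModel` their
images are multiples of the Zak transforms of these derivatives, hence bounded. -/
theorem exists_hasMomentDecay_fourier_window :
    ∃ K, HasMomentDecay (fun n => (sinSqOp ^ n) (𝓕 window)) K := by
  set c := (2 * Real.pi * Complex.I : ℂ)⁻¹
  obtain ⟨C₁, -, h₁⟩ := exists_norm_zak_cutoffLp_le continuous_windowDeriv
  obtain ⟨C₂, -, h₂⟩ := exists_norm_zak_cutoffLp_le continuous_windowDerivTwo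
  have m1 := mulX_fourier_cutoffLp continuous_windowFun continuous_windowDeriv
    fourier_cutoff_windowFun
  have m2 := (mulX_fourier_cutoffLp continuous_windowDeriv continuous_windowDerivTwo
    fourier_cutoff_windowDeriv).smul c
  refine zakFourierModel.exists_hasMomentDecay (C₁ := ‖c‖ * C₁) (C₂ := ‖c‖ * (‖c‖ * C₂)) m1 m2
    ?_ ?_ ?_
  · rw [zakFourierModel_fourier]; exact norm_sq_zak_window_le
  · rw [map_smul, zakFourierModel_fourier]; exact norm_smul_le_of_ae h₁ c
  · rw [map_smul, map_smul, zakFourierModel_fourier]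
    exact norm_smul_le_of_ae (norm_smul_le_of_ae h₂ c) c

theorem fourier_sinSqMod (f : Lp ℂ 2 (volume : Measure ℝ)) :
    𝓕 (sinSqMod f) = sinSqTrans (𝓕 f) := by
  have h : ∀ g : Lp ℂ 2 (volume : Measure ℝ), 𝓕 g = Lp.fourierTransformₗᵢ ℝ ℂ g := fun g => rfl
  have h1 := fourier_gaborShift 1 0 f
  have h2 := fourier_gaborShift (-1) 0 f
  simp only [h, neg_zero] at h1 h2
  simp only [h, sinSqMod, sinSqTrans, smul_apply, sub_apply, one_apply_eq_self, shiftCLM_apply,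
    map_smul, map_sub, h1, h2]

theorem fourier_sinSqTrans (f : Lp ℂ 2 (volume : Measure ℝ)) :
    𝓕 (sinSqTrans f) = sinSqMod (𝓕 f) := by
  have h : ∀ g : Lp ℂ 2 (volume : Measure ℝ), 𝓕 g = Lp.fourierTransformₗᵢ ℝ ℂ g := fun g => rfl
  have h1 := fourier_gaborShift 0 1 f
  have h2 := fourier_gaborShift 0 (-1) f
  simp only [h, neg_neg] at h1 h2
  simp only [h, sinSqMod, sinSqTrans, smul_apply, sub_apply, one_apply_eq_self, shiftCLM_apply,
    map_smul, map_sub, h1, h2]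
  congr 1
  abel

theorem fourier_sinSqOp_pow (n : ℕ) (f : Lp ℂ 2 (volume : Measure ℝ)) :
    𝓕 ((sinSqOp ^ n) f) = (sinSqOp ^ n) (𝓕 f) := by
  induction n with
  | zero => simp
  | succ n ih =>
    have h : ∀ g, (sinSqOp ^ (n + 1)) g = sinSqMod (sinSqTrans ((sinSqOp ^ n) g)) := fun g => by
      rw [pow_succ']; rfl
    have hc : ∀ g, sinSqTrans (sinSqMod g) = sinSqMod (sinSqTrans g) := fun g =>
      (DFunLike.congr_fun commute_sinSqMod_sinSqTrans g).symm
    rw [h, h, fourier_sinSqMod, fourier_sinSqTrans, ih, hc]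

/-! ### Weighted norms of series -/

/-- Interpolates the weight |x|^t between the two available bounds, on F and on x²F; this is why t ≤
4 is needed. -/
theorem rpow_le_add_mul_pow_four {t : ℝ} (h0 : 0 ≤ t) (h4 : t ≤ 4) {R : ℝ} (hR : 0 < R) {y : ℝ}
    (hy : 0 ≤ y) : y ^ t ≤ R ^ t + R ^ (t - 4) * y ^ 4 := by
  rcases le_or_gt y R with h | h
  · exact (Real.rpow_le_rpow hy h h0).trans (le_add_of_nonneg_right (by positivity))
  · have hy' : 0 < y := hR.trans h
    have h1 : y ^ t = y ^ (t - 4) * y ^ 4 := by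
      rw [← Real.rpow_natCast y 4, ← Real.rpow_add hy']; congr 1; norm_num
    have h2 : y ^ (t - 4) ≤ R ^ (t - 4) :=
      Real.rpow_le_rpow_of_nonpos hR h.le (by linarith)
    rw [h1]
    exact (mul_le_mul_of_nonneg_right h2 (by positivity)).trans
      (le_add_of_nonneg_left (by positivity))

theorem HasMomentDecay.weightedIntegral_le {F : ℕ → Lp ℂ 2 (volume : Measure ℝ)} {K : ℝ}
    (hF : HasMomentDecay F K) {t : ℝ} (h0 : 0 ≤ t) (h4 : t ≤ 4) (n : ℕ) :
    weightedIntegral t (F n) ≤ ENNReal.ofReal ((1 + K ^ 2) * ((n : ℝ) + 1) ^ (t / 2 - 2)) := by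
  obtain ⟨h1, G, hG, hGK⟩ := hF n
  have hn : (0 : ℝ) < n + 1 := by positivity
  -- F_n lives at scale √(n+1); with this radius both terms of the interpolation have size
  -- (n+1)^{t/2-2}.
  set R := Real.sqrt ((n : ℝ) + 1) with hR
  have hR0 : 0 < R := Real.sqrt_pos.2 hn
  have hle : weightedIntegral t (F n) ≤
      ∫⁻ x, ENNReal.ofReal (R ^ t * ‖F n x‖ ^ 2 + R ^ (t - 4) * ‖G x‖ ^ 2) := by
    refine lintegral_mono_ae ?_
    filter_upwards [hG] with x hx
    refine ENNReal.ofReal_le_ofReal ?_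
    rw [hx, norm_mul, norm_pow, Complex.norm_real, Real.norm_eq_abs]
    refine (mul_le_mul_of_nonneg_right (rpow_le_add_mul_pow_four h0 h4 hR0 (abs_nonneg x))
      (sq_nonneg _)).trans_eq ?_
    ring
  refine hle.trans ?_
  have i1 := (integrable_norm_sq (F n)).const_mul (R ^ t)
  have i2 := (integrable_norm_sq G).const_mul (R ^ (t - 4))
  have i3 : Integrable (fun x => R ^ t * ‖F n x‖ ^ 2 + R ^ (t - 4) * ‖G x‖ ^ 2) := i1.add i2
  rw [← ofReal_integral_eq_lintegral_ofReal i3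
    (Filter.Eventually.of_forall fun x => by positivity)]
  refine ENNReal.ofReal_le_ofReal ?_
  rw [integral_add i1 i2, integral_const_mul, integral_const_mul, ← norm_sq_eq_integral,
    ← norm_sq_eq_integral]
  have e1 : R ^ (t - 4) = ((n : ℝ) + 1) ^ (t / 2 - 2) := by
    rw [hR, Real.sqrt_eq_rpow, ← Real.rpow_mul hn.le]; congr 1; ring
  have e2 : R ^ t * (1 / ((n : ℝ) + 1)) ^ 2 = ((n : ℝ) + 1) ^ (t / 2 - 2) := by
    rw [hR, Real.sqrt_eq_rpow, ← Real.rpow_mul hn.le, div_pow, one_pow, mul_one_div,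
      ← Real.rpow_natCast, ← Real.rpow_sub hn]
    congr 1; push_cast; ring
  have b1 : ‖F n‖ ^ 2 ≤ (1 / ((n : ℝ) + 1)) ^ 2 := pow_le_pow_left₀ (norm_nonneg _) h1 2
  have b2 : ‖G‖ ^ 2 ≤ K ^ 2 := pow_le_pow_left₀ (norm_nonneg _) hGK 2
  calc _ ≤ R ^ t * (1 / ((n : ℝ) + 1)) ^ 2 + R ^ (t - 4) * K ^ 2 := by gcongr
    _ = _ := by rw [e1, e2]; ring

/-- Lets a series converging in L² be evaluated pointwise: convergence in norm gives convergence in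
measure, hence almost everywhere along a subsequence of partial sums. -/
theorem exists_subseq_ae_tendsto_of_hasSum {α : Type*} [MeasurableSpace α] {μ : Measure α}
    {u : ℕ → Lp ℂ 2 μ} {g : Lp ℂ 2 μ} (h : HasSum u g) :
    ∃ ns : ℕ → ℕ, StrictMono ns ∧ ∀ᵐ x ∂μ, Filter.Tendsto
      (fun i => ∑ n ∈ Finset.range (ns i), u n x) Filter.atTop (nhds (g x)) := by
  have h1 := h.tendsto_sum_nat
  obtain ⟨ns, hns, hae⟩ := (tendstoInMeasure_of_tendsto_Lp h1).exists_seq_tendsto_ae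
  refine ⟨ns, hns, ?_⟩
  have h2 : ∀ᵐ x ∂μ, ∀ N, (∑ n ∈ Finset.range N, u n : Lp ℂ 2 μ) x =
      ∑ n ∈ Finset.range N, u n x := by
    refine ae_all_iff.2 fun N => ?_
    induction N with
    | zero =>
      filter_upwards [Lp.coeFn_zero ℂ 2 μ] with x hx
      simpa using hx
    | succ N ih =>
      rw [Finset.sum_range_succ]
      filter_upwards [ih, Lp.coeFn_add (∑ n ∈ Finset.range N, u n) (u N)] with x e1 e2
      rw [e2, Pi.add_apply, e1, Finset.sum_range_succ]
  filter_upwards [hae, h2] with x e1 e2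
  simpa only [e2] using e1

theorem weightedIntegral_lt_top_of_hasSum {F : ℕ → Lp ℂ 2 (volume : Measure ℝ)} {K : ℝ}
    (hF : HasMomentDecay F K) {t β : ℝ} (h0 : 0 ≤ t) (h4 : t ≤ 4) (hβ : 2 * β + t / 2 < 2)
    {g : Lp ℂ 2 (volume : Measure ℝ)}
    (hg : HasSum (fun n : ℕ => ((((n : ℝ) + 1) ^ (β - 1) : ℝ) : ℂ) • F n) g) :
    weightedIntegral t g < ∞ := by
  obtain ⟨ns, -, hns⟩ := exists_subseq_ae_tendsto_of_hasSum hg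
  -- The coefficient squares (n+1)^{2β-2} are split as w_n·b_n for Cauchy-Schwarz. This δ divides
  -- the slack in `hβ` equally, so that Σ w_n and Σ b_n(n+1)^{t/2-2} are both the series of
  -- (n+1)^{-1-δ}.
  set δ := (2 - (2 * β + t / 2)) / 2 with hδ
  have hδ0 : 0 < δ := by rw [hδ]; linarith
  set w : ℕ → ℝ := fun n => ((n : ℝ) + 1) ^ (-1 - δ) with hw
  have hw0 : ∀ n, 0 < w n := fun n => by positivity
  have hsw : Summable w := by
    have := (summable_nat_add_iff 1).2 (Real.summable_nat_rpow (p := -1 - δ).2 (by linarith))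
    simpa [hw] using this
  set W := ∑' n, w n
  set b : ℕ → ℝ := fun n => ((n : ℝ) + 1) ^ (2 * β - 1 + δ) with hb
  have hb0 : ∀ n, 0 ≤ b n := fun n => by positivity
  have hbw : ∀ n : ℕ, (((n : ℝ) + 1) ^ (β - 1)) ^ 2 = w n * b n := by
    intro n
    have hn : (0 : ℝ) < n + 1 := by positivity
    rw [hw, hb, ← Real.rpow_natCast, ← Real.rpow_mul hn.le]
    simp only
    rw [← Real.rpow_add hn]
    congr 1; push_cast; ring
  have hsm : ∀ n : ℕ, ∀ᵐ x, (((((n : ℝ) + 1) ^ (β - 1) : ℝ) : ℂ) • F n) x =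
      ((((n : ℝ) + 1) ^ (β - 1) : ℝ) : ℂ) * F n x := fun n => by
    filter_upwards [Lp.coeFn_smul ((((n : ℝ) + 1) ^ (β - 1) : ℝ) : ℂ) (F n)] with x hx
    rw [hx]; rfl
  have hpt : ∀ᵐ x, ENNReal.ofReal (|x| ^ t * ‖g x‖ ^ 2) ≤
      ∑' n, ENNReal.ofReal (W * b n) * ENNReal.ofReal (|x| ^ t * ‖F n x‖ ^ 2) := by
    filter_upwards [hns, ae_all_iff.2 hsm] with x h1 h2
    have h3 : Filter.Tendsto (fun i => ENNReal.ofReal (|x| ^ t *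
        ‖∑ n ∈ Finset.range (ns i), (((((n : ℝ) + 1) ^ (β - 1) : ℝ) : ℂ) • F n) x‖ ^ 2))
        Filter.atTop (nhds (ENNReal.ofReal (|x| ^ t * ‖g x‖ ^ 2))) :=
      ENNReal.tendsto_ofReal ((h1.norm.pow 2).const_mul _)
    refine le_of_tendsto' h3 fun i => ?_
    have h4 : ‖∑ n ∈ Finset.range (ns i), (((((n : ℝ) + 1) ^ (β - 1) : ℝ) : ℂ) • F n) x‖ ^ 2 ≤
        W * ∑ n ∈ Finset.range (ns i), b n * ‖F n x‖ ^ 2 := by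
      have h5 : ‖∑ n ∈ Finset.range (ns i), (((((n : ℝ) + 1) ^ (β - 1) : ℝ) : ℂ) • F n) x‖ ≤
          ∑ n ∈ Finset.range (ns i), ((n : ℝ) + 1) ^ (β - 1) * ‖F n x‖ := by
        refine (norm_sum_le _ _).trans_eq (Finset.sum_congr rfl fun n _ => ?_)
        rw [h2, norm_mul, Complex.norm_real, Real.norm_of_nonneg (by positivity)]
      refine (pow_le_pow_left₀ (norm_nonneg _) h5 2).trans ?_
      refine (Finset.sum_sq_le_sum_mul_sum_of_sq_le_mul _ (f := w)
        (g := fun n => b n * ‖F n x‖ ^ 2) (fun n _ => (hw0 n).le)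
        (fun n _ => mul_nonneg (hb0 n) (sq_nonneg _)) fun n _ => ?_).trans ?_
      · rw [mul_pow, hbw]; exact le_of_eq (by ring)
      · refine mul_le_mul_of_nonneg_right (hsw.sum_le_tsum _ fun n _ => (hw0 n).le) ?_
        exact Finset.sum_nonneg fun n _ => mul_nonneg (hb0 n) (sq_nonneg _)
    have hW0 : 0 ≤ W := tsum_nonneg fun n => (hw0 n).le
    calc _ ≤ ENNReal.ofReal (|x| ^ t * (W * ∑ n ∈ Finset.range (ns i), b n * ‖F n x‖ ^ 2)) := by
          gcongr
      _ = ENNReal.ofReal (∑ n ∈ Finset.range (ns i), (W * b n) * (|x| ^ t * ‖F n x‖ ^ 2)) := by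
          congr 1
          rw [Finset.mul_sum, Finset.mul_sum]
          exact Finset.sum_congr rfl fun n _ => by ring
      _ = ∑ n ∈ Finset.range (ns i), ENNReal.ofReal (W * b n) *
            ENNReal.ofReal (|x| ^ t * ‖F n x‖ ^ 2) := by
          rw [ENNReal.ofReal_sum_of_nonneg fun n _ => by have := hb0 n; positivity]
          refine Finset.sum_congr rfl fun n _ => ?_
          rw [ENNReal.ofReal_mul (mul_nonneg hW0 (hb0 n))]
      _ ≤ _ := ENNReal.sum_le_tsum _
  have hW0 : 0 ≤ W := tsum_nonneg fun n => (hw0 n).le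
  refine lt_of_le_of_lt (lintegral_mono_ae hpt) ?_
  rw [lintegral_tsum fun n => ?_]
  · have hle : ∑' n, ∫⁻ x, ENNReal.ofReal (W * b n) * ENNReal.ofReal (|x| ^ t * ‖F n x‖ ^ 2) ≤
        ∑' n : ℕ, ENNReal.ofReal (W * (1 + K ^ 2) * ((n : ℝ) + 1) ^ (-1 - δ)) := by
      refine ENNReal.tsum_le_tsum fun n => ?_
      rw [lintegral_const_mul' _ _ ENNReal.ofReal_ne_top]
      refine (mul_le_mul_right (hF.weightedIntegral_le h0 h4 n) _).trans_eq ?_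
      rw [← ENNReal.ofReal_mul (mul_nonneg hW0 (hb0 n))]
      congr 1
      have hn : (0 : ℝ) < n + 1 := by positivity
      have : b n * ((n : ℝ) + 1) ^ (t / 2 - 2) = ((n : ℝ) + 1) ^ (-1 - δ) := by
        rw [hb]
        simp only
        rw [← Real.rpow_add hn]
        congr 1; rw [hδ]; ring
      rw [← this]; ring
    refine lt_of_le_of_lt hle ?_
    rw [← ENNReal.ofReal_tsum_of_nonneg (fun n => by positivity) (hsw.mul_left _)]
    exact ENNReal.ofReal_lt_top
  · refine AEMeasurable.const_mul (AEMeasurable.ennreal_ofReal ?_) _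
    have h1 : Measurable fun x : ℝ => |x| ^ t := by fun_prop
    exact h1.aemeasurable.mul ((Lp.aestronglyMeasurable (F n)).norm.aemeasurable.pow_const 2)

/-! ### From a lower bound on |Zg| to exact (C_q)-systems. -/

/-! ### A dual criterion for `(C_q)`-systems -/

theorem exists_finsupp_of_finset {ι H : Type*} [NormedAddCommGroup H] [InnerProductSpace ℂ H]
    (f : ι → H) {q : ℝ} (hq : 0 < q) (S : Finset ι) (a : ι → ℂ) :
    ∃ b : ι →₀ ℂ, ∑ i ∈ b.support, b i • f i = ∑ i ∈ S, a i • f i ∧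
      ∑ i ∈ b.support, ‖b i‖ ^ q = ∑ i ∈ S, ‖a i‖ ^ q := by
  classical
  set b : ι →₀ ℂ := Finsupp.onFinset S (fun i => if i ∈ S then a i else 0)
    (fun i hi => by by_contra h; simp [h] at hi) with hb
  have hbS : b.support ⊆ S := Finsupp.support_onFinset_subset
  have hba : ∀ i ∈ S, b i = a i := fun i hi => by simp [hb, hi]
  refine ⟨b, ?_, ?_⟩
  · rw [Finset.sum_subset hbS fun i _ hi => by rw [Finsupp.notMem_support_iff.1 hi, zero_smul]]
    exact Finset.sum_congr rfl fun i hi => by rw [hba i hi]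
  · rw [Finset.sum_subset hbS fun i _ hi => by
      rw [Finsupp.notMem_support_iff.1 hi, norm_zero, Real.zero_rpow hq.ne']]
    exact Finset.sum_congr rfl fun i hi => by rw [hba i hi]

theorem convex_setOf_finset_sum {ι H : Type*} [NormedAddCommGroup H] [InnerProductSpace ℂ H]
    (f : ι → H) {q : ℝ} (hq : 1 ≤ q) (R : ℝ) :
    Convex ℝ {x : H | ∃ (S : Finset ι) (a : ι → ℂ), ∑ i ∈ S, a i • f i = x ∧
      ∑ i ∈ S, ‖a i‖ ^ q ≤ R} := by
  classical
  have hq0 : q ≠ 0 := by linarith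
  rintro x ⟨S, a, rfl, ha⟩ y ⟨T, b, rfl, hb⟩ s t hs ht hst
  refine ⟨S ∪ T, fun i => (s : ℂ) * (if i ∈ S then a i else 0) + (t : ℂ) *
    (if i ∈ T then b i else 0), ?_, ?_⟩
  · simp only [add_smul, Finset.sum_add_distrib, mul_smul, ← Finset.smul_sum, ite_smul, zero_smul]
    rw [Finset.sum_ite_mem, Finset.sum_ite_mem, Finset.inter_eq_right.2 Finset.subset_union_left,
      Finset.inter_eq_right.2 Finset.subset_union_right, Complex.coe_smul, Complex.coe_smul]
  · have h1 : ∀ i, ‖(s : ℂ) * (if i ∈ S then a i else 0) + (t : ℂ) * (if i ∈ T then b i else 0)‖ ^ q ≤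
        s * (if i ∈ S then ‖a i‖ ^ q else 0) + t * (if i ∈ T then ‖b i‖ ^ q else 0) := by
      intro i
      have h2 := (convexOn_rpow hq).2 (norm_nonneg (if i ∈ S then a i else 0))
        (norm_nonneg (if i ∈ T then b i else 0)) hs ht hst
      have h3 : ‖(s : ℂ) * (if i ∈ S then a i else 0) + (t : ℂ) * (if i ∈ T then b i else 0)‖ ≤
          s • ‖(if i ∈ S then a i else 0)‖ + t • ‖(if i ∈ T then b i else 0)‖ := by
        refine (norm_add_le _ _).trans_eq ?_
        rw [norm_mul, norm_mul, Complex.norm_real, Complex.norm_real, Real.norm_of_nonneg hs,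
          Real.norm_of_nonneg ht]; rfl
      refine (Real.rpow_le_rpow (norm_nonneg _) h3 (by linarith)).trans (h2.trans_eq ?_)
      simp only [smul_eq_mul]
      congr 2 <;> split_ifs <;> simp [hq0]
    refine (Finset.sum_le_sum fun i _ => h1 i).trans ?_
    rw [Finset.sum_add_distrib, ← Finset.mul_sum, ← Finset.mul_sum, Finset.sum_ite_mem,
      Finset.sum_ite_mem, Finset.inter_eq_right.2 Finset.subset_union_left,
      Finset.inter_eq_right.2 Finset.subset_union_right]
    calc _ ≤ s * R + t * R := by gcongr
      _ = R := by rw [← add_mul, hst, one_mul]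

/-- If the `ℓ^p` norm of the coefficients `⟪f i, u⟫` controls `‖u‖`, then `f` is a `(C_q)`-system
for the conjugate exponent `q`. -/
theorem isCqSystem_of_dual {ι H : Type*} [NormedAddCommGroup H] [InnerProductSpace ℂ H]
    [CompleteSpace H] {p q : ℝ} (hpq : p.HolderConjugate q) (f : ι → H) {C : ℝ} (hC : 0 < C)
    (hf : ∀ (u : H) (M : ℝ), 0 ≤ M → (∀ S : Finset ι, ∑ i ∈ S, ‖inner ℂ (f i) u‖ ^ p ≤ M ^ p) →
      ‖u‖ ≤ C * M) : IsCqSystem q f := by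
  have hq0 : 0 < q := hpq.symm.pos
  have hp0 : 0 < p := hpq.pos
  refine ⟨C, hC, fun h ε hε => ?_⟩
  rcases eq_or_ne h 0 with rfl | hh
  · refine ⟨0, by simpa using hε, ?_⟩
    simp [Real.zero_rpow (inv_ne_zero hq0.ne')]
  have hh0 : 0 < ‖h‖ := norm_pos_iff.2 hh
  set K := {x : H | ∃ (S : Finset ι) (a : ι → ℂ), ∑ i ∈ S, a i • f i = x ∧
      ∑ i ∈ S, ‖a i‖ ^ q ≤ (C * ‖h‖) ^ q} with hK
  have hconv : Convex ℝ K := convex_setOf_finset_sum f hpq.symm.lt.le _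
  by_cases hmem : h ∈ closure K
  · obtain ⟨x, ⟨S, a, rfl, ha⟩, hx⟩ := Metric.mem_closure_iff.1 hmem ε hε
    obtain ⟨b, hb1, hb2⟩ := exists_finsupp_of_finset f hq0 S a
    refine ⟨b, by rw [hb1, ← dist_eq_norm]; exact hx, ?_⟩
    rw [hb2]
    calc _ ≤ ((C * ‖h‖) ^ q) ^ (1 / q) := by
          refine Real.rpow_le_rpow ?_ ha (by positivity)
          exact Finset.sum_nonneg fun i _ => by positivity
      _ = C * ‖h‖ := by rw [one_div, Real.rpow_rpow_inv (by positivity) hq0.ne']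
  -- If h is not approximable, a functional separates it from the closed convex set of admissible
  -- combinations. Its Riesz vector u has small ℓ^p coefficients, so the hypothesis makes ‖u‖ too
  -- small to separate.
  exfalso
  obtain ⟨φ, c, h1, h2⟩ := RCLike.geometric_hahn_banach_closed_point (𝕜 := ℂ) hconv.closure
    isClosed_closure hmem
  set u := (InnerProductSpace.toDual ℂ H).symm φ with hu
  have hφ : ∀ x, φ x = inner ℂ u x := fun x => by
    rw [hu, InnerProductSpace.toDual_symm_apply]
  have hc0 : 0 < c := by
    have := h1 0 (subset_closure ⟨∅, 0, by simp, by simp; positivity⟩)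
    simpa using this
  have hM : ∀ S : Finset ι, ∑ i ∈ S, ‖inner ℂ (f i) u‖ ^ p ≤ (c / (C * ‖h‖)) ^ p := by
    intro S
    set b : ι → ℂ := fun i => inner ℂ (f i) u with hb
    set B := ∑ i ∈ S, ‖b i‖ ^ p with hB
    have hB0 : 0 ≤ B := Finset.sum_nonneg fun i _ => by positivity
    rcases hB0.eq_or_lt with hBz | hBp
    · change B ≤ _
      rw [← hBz]; positivity
    set l := C * ‖h‖ * B ^ (-1 / q) with hl
    have hl0 : 0 ≤ l := by positivity
    -- The extremal coefficients in Hölder's inequality, scaled to the boundary of the admissible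
    -- ℓ^q ball; evaluating the functional on them recovers the ℓ^p norm of `b`.
    set a : ι → ℂ := fun i => ((l * ‖b i‖ ^ (p - 2) : ℝ) : ℂ) * b i with ha
    have hpp : ∀ y : ℝ, 0 ≤ y → y ^ (p - 2) * y = y ^ (p - 1) := by
      intro y hy
      rcases hy.eq_or_lt with rfl | hy
      · rw [mul_zero, Real.zero_rpow]; linarith [hpq.lt]
      · rw [← Real.rpow_add_one hy.ne']; congr 1; ring
    have hpp2 : ∀ y : ℝ, 0 ≤ y → y ^ (p - 1) * y = y ^ p := by
      intro y hy
      rcases hy.eq_or_lt with rfl | hy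
      · rw [mul_zero, Real.zero_rpow hp0.ne']
      · rw [← Real.rpow_add_one hy.ne']; congr 1; ring
    have hna : ∀ i, ‖a i‖ = l * ‖b i‖ ^ (p - 1) := fun i => by
      rw [ha, norm_mul, Complex.norm_real, Real.norm_of_nonneg (by positivity), mul_assoc,
        hpp _ (norm_nonneg _)]
    have hsum : ∑ i ∈ S, ‖a i‖ ^ q ≤ (C * ‖h‖) ^ q := by
      have : ∀ i, ‖a i‖ ^ q = l ^ q * ‖b i‖ ^ p := fun i => by
        rw [hna, Real.mul_rpow hl0 (by positivity), ← Real.rpow_mul (norm_nonneg _),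
          hpq.sub_one_mul_conj]
      simp_rw [this]
      rw [← Finset.mul_sum, ← hB, hl, Real.mul_rpow (by positivity) (by positivity),
        ← Real.rpow_mul hB0, div_mul_cancel₀ _ hq0.ne', Real.rpow_neg_one, mul_assoc,
        inv_mul_cancel₀ hBp.ne', mul_one]
    have h3 := h1 _ (subset_closure ⟨S, a, rfl, hsum⟩)
    have h4 : φ (∑ i ∈ S, a i • f i) = ((l * B : ℝ) : ℂ) := by
      rw [map_sum, hB, Finset.mul_sum, Complex.ofReal_sum]
      refine Finset.sum_congr rfl fun i _ => ?_
      rw [map_smul, hφ, ← inner_conj_symm, smul_eq_mul, ha]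
      change ((l * ‖b i‖ ^ (p - 2) : ℝ) : ℂ) * b i * (starRingEnd ℂ) (b i) = _
      rw [mul_assoc, Complex.mul_conj, Complex.normSq_eq_norm_sq, ← Complex.ofReal_mul, sq,
        mul_assoc, ← mul_assoc (‖b i‖ ^ (p - 2)), hpp _ (norm_nonneg _), hpp2 _ (norm_nonneg _)]
    rw [h4] at h3
    have h5 : l * B = C * ‖h‖ * B ^ (1 / p) := by
      rw [hl, mul_assoc]
      congr 1
      rw [← Real.rpow_add_one hBp.ne']
      congr 1
      have := hpq.inv_add_inv_eq_one
      rw [neg_div, one_div, one_div]; linarith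
    have h6 : C * ‖h‖ * B ^ (1 / p) < c := by
      rw [← h5]; exact h3
    have h7 : B ^ (1 / p) ≤ c / (C * ‖h‖) := by
      rw [le_div_iff₀ (by positivity), mul_comm]; exact h6.le
    calc B = (B ^ (1 / p)) ^ p := by rw [one_div, Real.rpow_inv_rpow hB0 hp0.ne']
      _ ≤ _ := Real.rpow_le_rpow (by positivity) h7 hp0.le
  have h8 := hf u _ (by positivity) hM
  have h9 : RCLike.re (φ h) ≤ c := by
    calc RCLike.re (φ h) ≤ ‖φ h‖ := RCLike.re_le_norm _
      _ ≤ ‖u‖ * ‖h‖ := by rw [hφ]; exact norm_inner_le_norm _ _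
      _ ≤ C * (c / (C * ‖h‖)) * ‖h‖ := by gcongr
      _ = c := by field_simp
  linarith

/-! ### The power series `∑ (j + 1)^(β - 1) s^j` -/

/-- The power series `∑ (j + 1)^(β - 1) s^j`. -/
def powerSum (β s : ℝ) : ℝ := ∑' j : ℕ, ((j : ℝ) + 1) ^ (β - 1) * s ^ j

theorem summable_powerSum {β s : ℝ} (hβ : β ≤ 1) (h0 : 0 ≤ s) (h1 : s < 1) :
    Summable fun j : ℕ => ((j : ℝ) + 1) ^ (β - 1) * s ^ j := by
  refine (summable_geometric_of_lt_one h0 h1).of_nonneg_of_le (fun j => by positivity) fun j => ?_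
  refine mul_le_of_le_one_left (by positivity) ?_
  exact Real.rpow_le_one_of_one_le_of_nonpos (by linarith [(Nat.cast_nonneg j : (0 : ℝ) ≤ j)])
    (by linarith)

/-- With n = ⌊1/(1 - s)⌋, the first n/2 or so terms are each at least n^{β-1}/2, so the sum is at
least n^β/4. The remaining factor 2 comes from 1/(1 - s) ≤ 2n. -/
theorem one_sub_rpow_neg_le_powerSum {β s : ℝ} (hβ0 : 0 ≤ β) (hβ : β ≤ 1) (h0 : 0 ≤ s)
    (h1 : s < 1) : (1 - s) ^ (-β) ≤ 8 * powerSum β s := by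
  have hs : 0 < 1 - s := by linarith
  set n := ⌊1 / (1 - s)⌋₊ with hn
  have hn1 : (n : ℝ) ≤ 1 / (1 - s) := Nat.floor_le (by positivity)
  have hn2 : 1 / (1 - s) < n + 1 := Nat.lt_floor_add_one _
  have hn3 : 1 ≤ n := Nat.le_floor (by rw [Nat.cast_one, le_div_iff₀ hs]; linarith)
  have hn3' : (1 : ℝ) ≤ n := by exact_mod_cast hn3
  set m := (n + 1) / 2 with hm
  have hm1 : (n : ℝ) / 2 ≤ m := by
    rw [div_le_iff₀ two_pos]
    have : n ≤ m * 2 := by omega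
    exact_mod_cast this
  have hterm : ∀ j ∈ Finset.range m,
      (n : ℝ) ^ (β - 1) * (1 / 2) ≤ ((j : ℝ) + 1) ^ (β - 1) * s ^ j := by
    intro j hj
    have hj' : 2 * j + 1 ≤ n := by have := Finset.mem_range.1 hj; omega
    have hj'' : 2 * (j : ℝ) + 1 ≤ n := by exact_mod_cast hj'
    refine mul_le_mul ?_ ?_ (by norm_num) (by positivity)
    · refine Real.rpow_le_rpow_of_nonpos (by positivity) ?_ (by linarith)
      linarith [(Nat.cast_nonneg j : (0 : ℝ) ≤ j)]
    · have h2 := one_add_mul_le_pow (a := -(1 - s)) (by linarith) j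
      have h3 : (j : ℝ) * (1 - s) ≤ 1 / 2 := by
        rw [le_div_iff₀ hs] at hn1
        nlinarith
      calc (1 / 2 : ℝ) ≤ 1 + j * -(1 - s) := by linarith
        _ ≤ (1 + -(1 - s)) ^ j := h2
        _ = s ^ j := by congr 1; ring
  have hsum : (m : ℝ) * ((n : ℝ) ^ (β - 1) * (1 / 2)) ≤ powerSum β s := by
    calc _ = ∑ j ∈ Finset.range m, (n : ℝ) ^ (β - 1) * (1 / 2) := by simp
      _ ≤ ∑ j ∈ Finset.range m, ((j : ℝ) + 1) ^ (β - 1) * s ^ j := Finset.sum_le_sum hterm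
      _ ≤ _ := (summable_powerSum hβ h0 h1).sum_le_tsum _ fun j _ => by positivity
  have hnb : (n : ℝ) ^ β = n * (n : ℝ) ^ (β - 1) := by
    rw [mul_comm, ← Real.rpow_add_one (by positivity)]; congr 1; ring
  have h4 : (1 - s) ^ (-β) ≤ 2 * (n : ℝ) ^ β := by
    calc (1 - s) ^ (-β) = (1 / (1 - s)) ^ β := by
          rw [Real.rpow_neg hs.le, one_div, Real.inv_rpow hs.le]
      _ ≤ (2 * n : ℝ) ^ β := Real.rpow_le_rpow (by positivity) (by linarith) hβ0
      _ = 2 ^ β * (n : ℝ) ^ β := Real.mul_rpow (by norm_num) (by positivity)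
      _ ≤ 2 * (n : ℝ) ^ β := by
          refine mul_le_mul_of_nonneg_right ?_ (by positivity)
          calc (2 : ℝ) ^ β ≤ 2 ^ (1 : ℝ) := Real.rpow_le_rpow_of_exponent_le (by norm_num) hβ
            _ = 2 := Real.rpow_one 2
  have h5 : (n : ℝ) / 2 * ((n : ℝ) ^ (β - 1) * (1 / 2)) ≤ m * ((n : ℝ) ^ (β - 1) * (1 / 2)) :=
    mul_le_mul_of_nonneg_right hm1 (by positivity)
  rw [hnb] at h4
  linarith

/-- Cauchy-Schwarz against the geometric series, with no need for the sharp exponent. It yields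
exactly that `powerSum β s` times √(1 - s) is bounded, so the Zak transform constructed below is
bounded. -/
theorem exists_powerSum_sq_le {β : ℝ} (hβ : β < 1 / 2) :
    ∃ C, 0 < C ∧ ∀ s, 0 ≤ s → s < 1 → powerSum β s ^ 2 ≤ C / (1 - s) := by
  have hsq : Summable fun j : ℕ => ((j : ℝ) + 1) ^ (2 * β - 2) := by
    have := (summable_nat_add_iff 1).2 (Real.summable_nat_rpow (p := 2 * β - 2).2 (by linarith))
    simpa using this
  refine ⟨∑' j : ℕ, ((j : ℝ) + 1) ^ (2 * β - 2), ?_, fun s h0 h1 => ?_⟩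
  · exact hsq.tsum_pos (fun j => by positivity) 0 (by positivity)
  have hS := (summable_powerSum (β := β) (by linarith) h0 h1).hasSum.tendsto_sum_nat
  refine le_of_tendsto' (hS.pow 2) fun N => ?_
  refine (Finset.sum_sq_le_sum_mul_sum_of_sq_le_mul _
    (f := fun j : ℕ => ((j : ℝ) + 1) ^ (2 * β - 2)) (g := fun j : ℕ => s ^ j)
    (fun j _ => by positivity) (fun j _ => by positivity) fun j _ => ?_).trans ?_
  · have hj : (0 : ℝ) < j + 1 := by positivity
    rw [mul_pow, ← Real.rpow_natCast, ← Real.rpow_mul hj.le]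
    have e : (β - 1) * ((2 : ℕ) : ℝ) = 2 * β - 2 := by push_cast; ring
    rw [e]
    refine mul_le_mul_of_nonneg_left ?_ (by positivity)
    rw [sq]
    exact mul_le_of_le_one_left (by positivity) (pow_le_one₀ h0 h1.le)
  · rw [div_eq_mul_inv, ← tsum_geometric_of_lt_one h0 h1]
    refine mul_le_mul (hsq.sum_le_tsum _ fun j _ => by positivity)
      ((summable_geometric_of_lt_one h0 h1).sum_le_tsum _ fun j _ => by positivity)
      (Finset.sum_nonneg fun j _ => by positivity) (tsum_nonneg fun j => by positivity)

/-! ### Trigonometric expansion of powers of `sqSin` -/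

/-- `f` is a trigonometric polynomial whose coefficients have absolute sum at most one. -/
def IsWienerContraction (f : ℝ × ℝ → ℂ) : Prop :=
  ∃ (K : Finset (ℤ × ℤ)) (κ : ℤ × ℤ → ℂ), (∀ k, k ∉ K → κ k = 0) ∧ ∑ k ∈ K, ‖κ k‖ ≤ 1 ∧
    ∀ z, f z = ∑ k ∈ K, κ k * sqChar k z

theorem isWienerContraction_one : IsWienerContraction fun _ => 1 := by
  refine ⟨{0}, fun k => if k = 0 then 1 else 0, fun k hk => ?_, by simp, fun z => by simp⟩
  exact if_neg (by simpa using hk)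

theorem IsWienerContraction.shift {f : ℝ × ℝ → ℂ} (hf : IsWienerContraction f) (l : ℤ × ℤ) :
    IsWienerContraction fun z => sqChar l z * f z := by
  obtain ⟨K, κ, h0, h1, h2⟩ := hf
  refine ⟨K.map (addLeftEmbedding l), fun k => κ (k - l), fun k hk => h0 _ fun h => hk ?_, ?_,
    fun z => ?_⟩
  · exact Finset.mem_map.2 ⟨k - l, h, by simp⟩
  · simpa using h1
  · change sqChar l z * f z = _
    rw [h2, Finset.mul_sum, Finset.sum_map]
    refine Finset.sum_congr rfl fun k _ => ?_
    simp only [addLeftEmbedding_apply, add_sub_cancel_left, sqChar_add]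
    ring

theorem IsWienerContraction.combo {f g : ℝ × ℝ → ℂ} (hf : IsWienerContraction f)
    (hg : IsWienerContraction g) {a b : ℂ} (hab : ‖a‖ + ‖b‖ ≤ 1) :
    IsWienerContraction fun z => a * f z + b * g z := by
  classical
  obtain ⟨K, κ, h0, h1, h2⟩ := hf
  obtain ⟨K', κ', h0', h1', h2'⟩ := hg
  have e1 : ∀ φ : ℂ → (ℤ × ℤ) → ℂ, (∀ k, φ 0 k = 0) →
      ∑ k ∈ K ∪ K', φ (κ k) k = ∑ k ∈ K, φ (κ k) k := fun φ hφ =>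
    (Finset.sum_subset Finset.subset_union_left fun k _ hk => by rw [h0 k hk, hφ]).symm
  have e2 : ∀ φ : ℂ → (ℤ × ℤ) → ℂ, (∀ k, φ 0 k = 0) →
      ∑ k ∈ K ∪ K', φ (κ' k) k = ∑ k ∈ K', φ (κ' k) k := fun φ hφ =>
    (Finset.sum_subset Finset.subset_union_right fun k _ hk => by rw [h0' k hk, hφ]).symm
  refine ⟨K ∪ K', fun k => a * κ k + b * κ' k, fun k hk => ?_, ?_, fun z => ?_⟩
  · rw [Finset.mem_union, not_or] at hk
    simp only [h0 k hk.1, h0' k hk.2, mul_zero, add_zero]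
  · have n1 : ∑ k ∈ K ∪ K', ‖κ k‖ = ∑ k ∈ K, ‖κ k‖ :=
      (Finset.sum_subset Finset.subset_union_left fun k _ hk => by rw [h0 k hk, norm_zero]).symm
    have n2 : ∑ k ∈ K ∪ K', ‖κ' k‖ = ∑ k ∈ K', ‖κ' k‖ :=
      (Finset.sum_subset Finset.subset_union_right fun k _ hk => by rw [h0' k hk, norm_zero]).symm
    calc ∑ k ∈ K ∪ K', ‖a * κ k + b * κ' k‖ ≤
          ∑ k ∈ K ∪ K', (‖a‖ * ‖κ k‖ + ‖b‖ * ‖κ' k‖) :=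
          Finset.sum_le_sum fun k _ => by
            rw [← norm_mul, ← norm_mul]; exact norm_add_le _ _
      _ = ‖a‖ * ∑ k ∈ K, ‖κ k‖ + ‖b‖ * ∑ k ∈ K', ‖κ' k‖ := by
          rw [Finset.sum_add_distrib, ← Finset.mul_sum, ← Finset.mul_sum, n1, n2]
      _ ≤ ‖a‖ * 1 + ‖b‖ * 1 := by gcongr
      _ ≤ 1 := by linarith
  · change a * f z + b * g z = _
    rw [h2, h2', ← e1 (fun c k => c * sqChar k z) (by simp),
      ← e2 (fun c k => c * sqChar k z) (by simp), Finset.mul_sum, Finset.mul_sum,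
      ← Finset.sum_add_distrib]
    exact Finset.sum_congr rfl fun k _ => by ring

/-- The expansion sin²πθ = 1/2 - e^{2πiθ}/4 - e^{-2πiθ}/4 has coefficients of absolute sum one. -/
theorem IsWienerContraction.sin_sq_mul {f : ℝ × ℝ → ℂ} (hf : IsWienerContraction f) (l : ℤ × ℤ)
    {θ : ℝ × ℝ → ℝ} (hθ : ∀ z, sqChar l z = unitExp (θ z)) :
    IsWienerContraction fun z => ((Real.sin (Real.pi * θ z) ^ 2 : ℝ) : ℂ) * f z := by
  have h1 := (hf.shift l).combo (hf.shift (-l)) (a := -1 / 2) (b := -1 / 2) (by norm_num)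
  have h2 := hf.combo h1 (a := 1 / 2) (b := 1 / 2) (by norm_num)
  convert h2 using 2 with z
  have h3 : sqChar (-l) z = unitExp (-θ z) := by rw [← conj_sqChar, hθ, conj_unitExp]
  have h4 := unitExp_add_unitExp_neg (θ z)
  rw [hθ, h3]
  push_cast at h4 ⊢
  linear_combination (1 / 4 * f z) * h4

theorem isWienerContraction_sqSin_pow (j : ℕ) :
    IsWienerContraction fun z => ((sqSin z ^ j : ℝ) : ℂ) := by
  induction j with
  | zero => simpa using isWienerContraction_one
  | succ j ih =>
    have h1 := ih.sin_sq_mul (0, 1) (θ := fun z => z.2) fun z => by simp [sqChar]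
    have h2 := h1.sin_sq_mul (1, 0) (θ := fun z => z.1) fun z => by simp [sqChar]
    convert h2 using 2 with z
    rw [pow_succ, sqSin]; push_cast; ring

/-- The absolute sum is controlled algebraically; the uniform bound holds because a coefficient is
at most the integral of the nonnegative function s^j. -/
theorem exists_sqSin_pow_eq_sum (j : ℕ) :
    ∃ (K : Finset (ℤ × ℤ)) (κ : ℤ × ℤ → ℂ), ∑ k ∈ K, ‖κ k‖ ≤ 1 ∧
      (∀ k ∈ K, ‖κ k‖ ≤ 1 / (j + 1)) ∧
      ∀ z, ((sqSin z ^ j : ℝ) : ℂ) = ∑ k ∈ K, κ k * sqChar k z := by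
  obtain ⟨K, κ, h0, h1, h2⟩ := isWienerContraction_sqSin_pow j
  replace h2 : ∀ z, ((sqSin z ^ j : ℝ) : ℂ) = ∑ k ∈ K, κ k * sqChar k z := h2
  refine ⟨K, κ, h1, fun k hk => ?_, h2⟩
  have hint : ∀ l, Integrable (sqChar l) unitSq := fun l => (memLp_sqChar l).integrable one_le_two
  have e : κ k = ∫ z, ((sqSin z ^ j : ℝ) : ℂ) * sqChar (-k) z ∂unitSq := by
    have e1 : ∀ z, ((sqSin z ^ j : ℝ) : ℂ) * sqChar (-k) z =
        ∑ l ∈ K, κ l * sqChar (l - k) z := fun z => by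
      rw [h2, Finset.sum_mul]
      exact Finset.sum_congr rfl fun l _ => by rw [mul_assoc, ← sqChar_add, sub_eq_add_neg]
    simp_rw [e1]
    rw [integral_finsetSum _ fun l _ => (hint _).const_mul _]
    simp_rw [integral_const_mul, integral_sqChar, sub_eq_zero]
    simp [hk]
  rw [e]
  refine (norm_integral_le_integral_norm _).trans (le_trans (le_of_eq ?_) (integral_sqSin_pow_le j))
  congr 1; ext z
  rw [norm_mul, norm_sqChar, mul_one, Complex.norm_real,
    Real.norm_of_nonneg (pow_nonneg (sqSin_nonneg z) j)]

/-! ### A convolution inequality -/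

/-- A Young-type inequality interpolating between the ℓ¹ and ℓ^∞ bounds on κ. With c = a^p and θ = 1
- 2/q, each term is a product of three factors with exponents θ, 1/q, 1/q. Weighted AM-GM separates
them into double sums of c·c', κ·c and κ·c', each of which is at most one. -/
theorem sum_mul_tsum_le_of_tsum_eq_one {G : Type*} [AddCommGroup G] {p q : ℝ}
    (hpq : p.HolderConjugate q) (hq : 2 ≤ q) {a : G → ℝ} (ha0 : ∀ l, 0 ≤ a l)
    (ha : HasSum (fun l => a l ^ p) 1) (K : Finset G) {κ : G → ℝ} (hκ0 : ∀ k ∈ K, 0 ≤ κ k)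
    (hκ1 : ∑ k ∈ K, κ k ≤ 1) {η : ℝ} (hη0 : 0 ≤ η) (hη : ∀ k ∈ K, κ k ≤ η)
    (hs : ∀ k ∈ K, Summable fun l => a l * a (l - k)) :
    ∑ k ∈ K, κ k * ∑' l, a l * a (l - k) ≤ η ^ (1 - 2 / q) := by
  classical
  have hq0 : 0 < q := by linarith
  have hp0 : 0 < p := hpq.pos
  set θ := 1 - 2 / q with hθ
  have hθ0 : 0 ≤ θ := by rw [hθ, sub_nonneg, div_le_one hq0]; exact hq
  set c : G → ℝ := fun l => a l ^ p with hc
  have hc0 : ∀ l, 0 ≤ c l := fun l => Real.rpow_nonneg (ha0 l) p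
  have hc1 : ∀ l, c l ≤ 1 := fun l => le_hasSum ha l fun i _ => hc0 i
  have hshift : ∀ k, HasSum (fun l => c (l - k)) 1 := fun k => by
    have := (Equiv.subRight k).hasSum_iff (f := c) (a := 1)
    exact this.2 ha
  have hprod : ∀ k, Summable fun l => c l * c (l - k) := fun k =>
    ha.summable.of_nonneg_of_le (fun l => mul_nonneg (hc0 _) (hc0 _)) fun l =>
      mul_le_of_le_one_right (hc0 l) (hc1 _)
  have hterm : ∀ k ∈ K, ∀ l, κ k * (a l * a (l - k)) ≤
      η ^ θ * (θ * (c l * c (l - k)) + (1 / q) * (κ k * c l) + (1 / q) * (κ k * c (l - k))) := by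
    intro k hk l
    have hκ := hκ0 k hk
    have h1 := Real.geom_mean_le_arith_mean3_weighted hθ0 (one_div_nonneg.2 hq0.le)
      (one_div_nonneg.2 hq0.le) (mul_nonneg (hc0 l) (hc0 (l - k))) (mul_nonneg hκ (hc0 l))
      (mul_nonneg hκ (hc0 (l - k))) (by rw [hθ]; ring)
    refine le_trans ?_ (mul_le_mul_of_nonneg_left h1 (Real.rpow_nonneg hη0 θ))
    have hinv := hpq.inv_add_inv_eq_one
    -- Valid because θ + 1/q = 1 - 1/q = 1/p.
    have hac : ∀ l, a l = c l ^ θ * c l ^ (1 / q) := fun l => by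
      rw [hc, ← Real.rpow_mul (ha0 l), ← Real.rpow_mul (ha0 l)]
      rcases (ha0 l).eq_or_lt with h | h
      · rw [← h]
        have : (0 : ℝ) ^ (p * (1 / q)) = 0 := Real.zero_rpow (by positivity)
        rw [this, mul_zero]
      · rw [← Real.rpow_add h]
        have : p * θ + p * (1 / q) = 1 := by
          have h3 : θ + 1 / q = p⁻¹ := by rw [hθ, one_div, div_eq_mul_inv]; linarith
          rw [← mul_add, h3, mul_inv_cancel₀ hp0.ne']
        rw [this, Real.rpow_one]
    have hκκ : κ k = κ k ^ θ * (κ k ^ (1 / q) * κ k ^ (1 / q)) := by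
      rcases hκ.eq_or_lt with h | h
      · rw [← h]
        have : (0 : ℝ) ^ (1 / q) = 0 := Real.zero_rpow (by positivity)
        rw [this]; simp
      · rw [← Real.rpow_add h, ← Real.rpow_add h]
        have : θ + (1 / q + 1 / q) = 1 := by rw [hθ]; ring
        rw [this, Real.rpow_one]
    rw [Real.mul_rpow (hc0 _) (hc0 _), Real.mul_rpow hκ (hc0 _), Real.mul_rpow hκ (hc0 _)]
    calc κ k * (a l * a (l - k)) = κ k ^ θ * ((c l ^ θ * c (l - k) ^ θ) *
          (κ k ^ (1 / q) * c l ^ (1 / q)) * (κ k ^ (1 / q) * c (l - k) ^ (1 / q))) := by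
          conv_lhs => rw [hκκ, hac l, hac (l - k)]
          ring
      _ ≤ _ := by
          refine mul_le_mul_of_nonneg_right (Real.rpow_le_rpow hκ (hη k hk) hθ0) ?_
          have := Real.rpow_nonneg (hc0 l) θ
          have := Real.rpow_nonneg (hc0 (l - k)) θ
          have := Real.rpow_nonneg (hc0 l) (1 / q)
          have := Real.rpow_nonneg (hc0 (l - k)) (1 / q)
          have := Real.rpow_nonneg hκ (1 / q)
          positivity
  have hone : ∀ k ∈ K, κ k * ∑' l, a l * a (l - k) ≤
      η ^ θ * (θ * ∑' l, c l * c (l - k) + (1 / q) * κ k + (1 / q) * κ k) := by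
    intro k hk
    have s1 := (((hprod k).hasSum.mul_left θ).add ((ha.mul_left (κ k)).mul_left (1 / q))).add
      (((hshift k).mul_left (κ k)).mul_left (1 / q))
    have s2 := (s1.mul_left (η ^ θ))
    have s3 := (hs k hk).hasSum.mul_left (κ k)
    have := hasSum_le (hterm k hk) s3 s2
    simpa only [mul_one] using this
  refine (Finset.sum_le_sum hone).trans ?_
  rw [← Finset.mul_sum]
  refine mul_le_of_le_one_right (Real.rpow_nonneg hη0 θ) ?_
  rw [Finset.sum_add_distrib, Finset.sum_add_distrib, ← Finset.mul_sum, ← Finset.mul_sum]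
  have hdouble : ∑ k ∈ K, ∑' l, c l * c (l - k) ≤ 1 := by
    rw [← Summable.tsum_finsetSum fun k _ => hprod k]
    refine (Summable.tsum_le_tsum (fun l => ?_) (summable_sum fun k _ => hprod k)
      ha.summable).trans_eq ha.tsum_eq
    rw [← Finset.mul_sum]
    refine mul_le_of_le_one_right (hc0 l) ?_
    have h1 : HasSum (fun k => c (l - k)) 1 := (Equiv.subLeft l).hasSum_iff.2 ha
    exact sum_le_hasSum K (fun k _ => hc0 _) h1
  have e : θ + 1 / q + 1 / q = 1 := by rw [hθ]; ring
  have hqi : 0 ≤ 1 / q := by positivity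
  nlinarith [mul_le_mul_of_nonneg_left hdouble hθ0, mul_le_mul_of_nonneg_left hκ1 hqi]

/-! ### Weighted integrals of functions with `ℓ^p` Fourier coefficients -/

theorem sqBasis_hasSum_norm_sq (F : Lp ℂ 2 unitSq) :
    HasSum (fun k => ‖inner ℂ (sqCharLp k) F‖ ^ 2) (‖F‖ ^ 2) := by
  have h := sqBasis.hasSum_inner_mul_inner F F
  rw [inner_self_eq_norm_sq_to_K] at h
  have h2 : ∀ k, inner ℂ F (sqBasis k) * inner ℂ (sqBasis k) F =
      ((‖inner ℂ (sqCharLp k) F‖ ^ 2 : ℝ) : ℂ) := fun k => by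
    rw [sqBasis_apply, ← inner_conj_symm F (sqCharLp k), mul_comm, Complex.mul_conj']
    push_cast; rfl
  simp_rw [h2] at h
  have h3 : ((‖F‖ : ℂ)) ^ 2 = ((‖F‖ ^ 2 : ℝ) : ℂ) := by push_cast; rfl
  exact Complex.hasSum_ofReal.1 (h3 ▸ h)

/-- Parseval for F and its product with a character: the Fourier coefficients of |F|² are the
autocorrelations of those of F. -/
theorem hasSum_integral_sqChar_mul_norm_sq (F : Lp ℂ 2 unitSq) (k : ℤ × ℤ) :
    HasSum (fun l => (starRingEnd ℂ) (inner ℂ (sqCharLp l) F) * inner ℂ (sqCharLp (l - k)) F)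
      (∫ z, sqChar k z * ((‖F z‖ ^ 2 : ℝ) : ℂ) ∂unitSq) := by
  set G := (memLp_sqChar_mul k (Lp.memLp F)).toLp _ with hG
  have hGc : G =ᵐ[unitSq] fun z => sqChar k z * F z := MemLp.coeFn_toLp _
  have h := sqBasis.hasSum_inner_mul_inner F G
  have hl : ∀ l, (starRingEnd ℂ) (inner ℂ (sqCharLp l) F) * inner ℂ (sqCharLp (l - k)) F =
      inner ℂ F (sqBasis l) * inner ℂ (sqBasis l) G := fun l => by
    rw [sqBasis_apply, inner_conj_symm]
    congr 1
    rw [inner_sqCharLp, inner_sqCharLp]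
    refine integral_congr_ae ?_
    filter_upwards [hGc] with z hz
    rw [hz, ← mul_assoc, ← sqChar_add, neg_sub, sub_eq_add_neg, add_comm]
  have hr : ∫ z, sqChar k z * ((‖F z‖ ^ 2 : ℝ) : ℂ) ∂unitSq = inner ℂ F G := by
    rw [L2.inner_def]
    refine integral_congr_ae ?_
    filter_upwards [hGc] with z hz
    rw [hz, RCLike.inner_apply, mul_assoc, Complex.mul_conj']
    push_cast; rfl
  simp_rw [hl, hr]
  exact h

/-- Expanding s^j in characters turns the integral into a sum of its coefficients against
autocorrelations. After normalizing the ℓ^p norm to one, the convolution inequality applies with sup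
bound 1/(j+1). -/
theorem integral_sqSin_pow_mul_norm_sq_le {p q : ℝ} (hpq : p.HolderConjugate q) (hq : 2 ≤ q)
    (F : Lp ℂ 2 unitSq) {M : ℝ} (hM : 0 ≤ M)
    (h : ∀ S : Finset (ℤ × ℤ), ∑ k ∈ S, ‖inner ℂ (sqCharLp k) F‖ ^ p ≤ M ^ p) (j : ℕ) :
    ∫ z, sqSin z ^ j * ‖F z‖ ^ 2 ∂unitSq ≤ (1 / ((j : ℝ) + 1)) ^ (1 - 2 / q) * M ^ 2 := by
  have hp0 : 0 < p := hpq.pos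
  set b : ℤ × ℤ → ℝ := fun k => ‖inner ℂ (sqCharLp k) F‖ with hb
  have hbp : ∀ k, 0 ≤ b k ^ p := fun k => Real.rpow_nonneg (norm_nonneg _) p
  have hsum : Summable fun k => b k ^ p := summable_of_sum_le hbp h
  set T := ∑' k, b k ^ p with hT
  have hTM : T ≤ M ^ p := hsum.tsum_le_of_sum_le h
  have hT0 : 0 ≤ T := tsum_nonneg hbp
  have hη : (0 : ℝ) ≤ 1 / ((j : ℝ) + 1) := by positivity
  rcases hT0.eq_or_lt with hz | hTpos
  · have hb0 : ∀ k, b k = 0 := fun k => by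
      have h1 := (hasSum_zero_iff_of_nonneg hbp).1 (by rw [hz]; exact hsum.hasSum)
      exact (Real.rpow_eq_zero (norm_nonneg _) hp0.ne').1 (congrFun h1 k)
    have hF : ‖F‖ ^ 2 = 0 := by
      have := sqBasis_hasSum_norm_sq F
      have h2 : (fun k => ‖inner ℂ (sqCharLp k) F‖ ^ 2) = fun _ => 0 := by
        ext k; have := hb0 k; simp only [hb] at this; rw [this]; simp
      rw [h2] at this
      exact this.unique hasSum_zero
    have hF0 : F = 0 := by simpa using hF
    have : ∫ z, sqSin z ^ j * ‖F z‖ ^ 2 ∂unitSq = 0 := by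
      rw [hF0]
      rw [← integral_zero (ℝ × ℝ) ℝ (μ := unitSq)]
      refine integral_congr_ae ?_
      filter_upwards [Lp.coeFn_zero ℂ 2 unitSq] with z hz
      rw [hz]; simp
    rw [this]
    exact mul_nonneg (Real.rpow_nonneg hη _) (sq_nonneg M)
  set m := T ^ (1 / p) with hm
  have hm0 : 0 < m := Real.rpow_pos_of_pos hTpos _
  have hmp : m ^ p = T := by
    rw [hm, ← Real.rpow_mul hT0, one_div, inv_mul_cancel₀ hp0.ne', Real.rpow_one]
  have hmM : m ≤ M := by
    rw [← Real.rpow_le_rpow_iff hm0.le hM hp0, hmp]; exact hTM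
  set a : ℤ × ℤ → ℝ := fun k => b k / m with ha
  have ha0 : ∀ k, 0 ≤ a k := fun k => div_nonneg (norm_nonneg _) hm0.le
  have hba : ∀ k, b k = m * a k := fun k => by rw [ha]; field_simp
  have ha1 : HasSum (fun k => a k ^ p) 1 := by
    have := hsum.hasSum.div_const T
    rw [← hT, div_self hTpos.ne'] at this
    refine this.congr_fun fun k => ?_
    rw [ha, Real.div_rpow (norm_nonneg _) hm0.le, hmp]
  obtain ⟨K, κ, h1, h2, h3⟩ := exists_sqSin_pow_eq_sum j
  have hint : ∀ k, Integrable (fun z => sqChar k z * ((‖F z‖ ^ 2 : ℝ) : ℂ)) unitSq := fun k =>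
    ((integrable_norm_sq F).ofReal).bdd_mul (continuous_sqChar k).aestronglyMeasurable
      (Filter.Eventually.of_forall fun z => (norm_sqChar k z).le)
  have hs : ∀ k, Summable fun l => b l * b (l - k) := fun k => by
    simpa only [norm_mul, RCLike.norm_conj] using
      (hasSum_integral_sqChar_mul_norm_sq F k).summable.norm
  have hsa : ∀ k, Summable fun l => a l * a (l - k) := fun k => by
    refine ((hs k).div_const (m * m)).congr fun l => ?_
    rw [ha]; field_simp
  have hk : ∀ k, ‖∫ z, sqChar k z * ((‖F z‖ ^ 2 : ℝ) : ℂ) ∂unitSq‖ ≤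
      m ^ 2 * ∑' l, a l * a (l - k) := fun k => by
    rw [← (hasSum_integral_sqChar_mul_norm_sq F k).tsum_eq]
    refine (norm_tsum_le_tsum_norm (by
      simpa only [norm_mul, RCLike.norm_conj] using hs k)).trans (le_of_eq ?_)
    rw [← tsum_mul_left]
    congr 1; ext l
    rw [norm_mul, RCLike.norm_conj]
    change b l * b (l - k) = _
    rw [hba, hba]; ring
  have e : ((∫ z, sqSin z ^ j * ‖F z‖ ^ 2 ∂unitSq : ℝ) : ℂ) =
      ∑ k ∈ K, κ k * ∫ z, sqChar k z * ((‖F z‖ ^ 2 : ℝ) : ℂ) ∂unitSq := by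
    rw [← integral_complex_ofReal]
    simp_rw [← integral_const_mul]
    rw [← integral_finsetSum _ fun k _ => (hint k).const_mul _]
    congr 1; ext z
    rw [Complex.ofReal_mul, h3, Finset.sum_mul]
    exact Finset.sum_congr rfl fun k _ => by ring
  calc ∫ z, sqSin z ^ j * ‖F z‖ ^ 2 ∂unitSq
      ≤ ‖((∫ z, sqSin z ^ j * ‖F z‖ ^ 2 ∂unitSq : ℝ) : ℂ)‖ := by
        rw [Complex.norm_real]; exact Real.le_norm_self _
    _ ≤ ∑ k ∈ K, ‖κ k‖ * (m ^ 2 * ∑' l, a l * a (l - k)) := by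
        rw [e]
        refine (norm_sum_le _ _).trans (Finset.sum_le_sum fun k _ => ?_)
        rw [norm_mul]
        exact mul_le_mul_of_nonneg_left (hk k) (norm_nonneg _)
    _ = m ^ 2 * ∑ k ∈ K, ‖κ k‖ * ∑' l, a l * a (l - k) := by
        rw [Finset.mul_sum]; exact Finset.sum_congr rfl fun k _ => by ring
    _ ≤ m ^ 2 * (1 / ((j : ℝ) + 1)) ^ (1 - 2 / q) := by
        refine mul_le_mul_of_nonneg_left ?_ (sq_nonneg m)
        exact sum_mul_tsum_le_of_tsum_eq_one hpq hq ha0 ha1 K (fun k _ => norm_nonneg _) h1 hη h2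
          fun k _ => hsa k
    _ ≤ _ := by
        rw [mul_comm]
        gcongr

/-! ### Gabor systems with controlled Zak transform -/

/-- Markov's inequality bounds the measure of {s ≥ 1} by the integral of s^j, which tends to zero.
-/
theorem ae_sqSin_lt_one : ∀ᵐ z ∂unitSq, sqSin z < 1 := by
  have h : ∀ j : ℕ, unitSq.real {z | ¬ sqSin z < 1} ≤ 1 / ((j : ℝ) + 1) := fun j => by
    have h1 := mul_meas_ge_le_integral_of_nonneg
      (Filter.Eventually.of_forall fun z => pow_nonneg (sqSin_nonneg z) j)
      (integrable_sqSin_pow j) 1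
    rw [one_mul] at h1
    refine le_trans (measureReal_mono fun z hz => ?_) (h1.trans (integral_sqSin_pow_le j))
    exact one_le_pow₀ (not_lt.1 hz)
  have h0 : unitSq.real {z | ¬ sqSin z < 1} ≤ 0 :=
    ge_of_tendsto' tendsto_one_div_add_atTop_nhds_zero_nat h
  rw [ae_iff]
  exact (measureReal_eq_zero_iff).1 (le_antisymm h0 measureReal_nonneg)

theorem summable_nat_add_one_rpow {e : ℝ} (he : e < -1) :
    Summable fun j : ℕ => ((j : ℝ) + 1) ^ e := by
  simpa using (summable_nat_add_iff 1).2 (Real.summable_nat_rpow.2 he)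

/-- The power series is integrated term by term. Lower integrals are used because finiteness of the
integral of `v` is itself a conclusion in the applications. -/
theorem lintegral_le_of_le_powerSum {v w : ℝ × ℝ → ℝ} {α γ A C : ℝ} (hα : α ≤ 1) (hαγ : α < γ)
    (hC : 0 ≤ C) (hw : Integrable w unitSq) (hw0 : ∀ z, 0 ≤ w z)
    (hj : ∀ j : ℕ, ∫ z, sqSin z ^ j * w z ∂unitSq ≤ A * ((j : ℝ) + 1) ^ (-γ))
    (hv : ∀ᵐ z ∂unitSq, v z ≤ C * powerSum α (sqSin z) * w z) :
    ∫⁻ z, ENNReal.ofReal (v z) ∂unitSq ≤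
      ENNReal.ofReal (A * (C * ∑' j : ℕ, ((j : ℝ) + 1) ^ (α - 1 - γ))) := by
  have hsj : ∀ j : ℕ, Integrable (fun z => sqSin z ^ j * w z) unitSq := fun j =>
    hw.bdd_mul (c := 1) (by fun_prop) (Filter.Eventually.of_forall fun z => by
      rw [Real.norm_of_nonneg (pow_nonneg (sqSin_nonneg z) j)]
      exact pow_le_one₀ (sqSin_nonneg z) (sqSin_le_one z))
  have hmeas : ∀ j : ℕ, AEMeasurable
      (fun z => ENNReal.ofReal (C * (((j : ℝ) + 1) ^ (α - 1) * (sqSin z ^ j * w z)))) unitSq :=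
    fun j => (((hsj j).const_mul _).const_mul _).aemeasurable.ennreal_ofReal
  have hsum := summable_nat_add_one_rpow (e := α - 1 - γ) (by linarith)
  have hA : 0 ≤ A := by
    have h0 := hj 0
    have : 0 ≤ ∫ z, sqSin z ^ 0 * w z ∂unitSq := integral_nonneg fun z => by simpa using hw0 z
    simpa using this.trans h0
  calc ∫⁻ z, ENNReal.ofReal (v z) ∂unitSq
      ≤ ∫⁻ z, ∑' j : ℕ, ENNReal.ofReal (C * (((j : ℝ) + 1) ^ (α - 1) * (sqSin z ^ j * w z)))
          ∂unitSq := by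
        refine lintegral_mono_ae ?_
        filter_upwards [hv, ae_sqSin_lt_one] with z hz hs
        have hS := summable_powerSum hα (sqSin_nonneg z) hs
        have hS' : Summable fun j : ℕ =>
            C * (((j : ℝ) + 1) ^ (α - 1) * (sqSin z ^ j * w z)) := by
          refine ((hS.mul_left C).mul_right (w z)).congr fun j => by ring
        rw [← ENNReal.ofReal_tsum_of_nonneg (fun j => ?_) hS']
        · refine ENNReal.ofReal_le_ofReal (hz.trans (le_of_eq ?_))
          rw [powerSum, ← tsum_mul_left, ← tsum_mul_right]
          congr 1; ext j; ring
        · have := hw0 z; have := sqSin_nonneg z; positivity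
    _ = ∑' j : ℕ, ENNReal.ofReal (C * (((j : ℝ) + 1) ^ (α - 1) * ∫ z, sqSin z ^ j * w z ∂unitSq))
          := by
        rw [lintegral_tsum hmeas]
        congr 1; ext j
        rw [← ofReal_integral_eq_lintegral_ofReal (((hsj j).const_mul _).const_mul _),
          integral_const_mul, integral_const_mul]
        refine Filter.Eventually.of_forall fun z => ?_
        have := hw0 z; have := sqSin_nonneg z
        simp only [Pi.zero_apply]; positivity
    _ ≤ ∑' j : ℕ, ENNReal.ofReal (A * (C * ((j : ℝ) + 1) ^ (α - 1 - γ))) := by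
        refine ENNReal.tsum_le_tsum fun j => ENNReal.ofReal_le_ofReal ?_
        calc _ ≤ C * (((j : ℝ) + 1) ^ (α - 1) * (A * ((j : ℝ) + 1) ^ (-γ))) := by
              gcongr; exact hj j
          _ = A * (C * ((j : ℝ) + 1) ^ (α - 1 - γ)) := by
              rw [sub_eq_add_neg (α - 1) γ, Real.rpow_add (by positivity)]; ring
    _ = _ := by
        rw [← ENNReal.ofReal_tsum_of_nonneg (fun j => by positivity)
          ((hsum.mul_left C).mul_left A), tsum_mul_left, tsum_mul_left]

theorem inner_gaborSystem_eq (g u : Lp ℂ 2 (volume : Measure ℝ)) (k : ℤ × ℤ) :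
    inner ℂ (gaborSystem g k) u =
      ∫ z, sqChar (-k) z * ((starRingEnd ℂ) (zak g z) * zak u z) ∂unitSq := by
  rw [← gaborShift_apply, ← zak.inner_map_map, L2.inner_def]
  refine integral_congr_ae ?_
  filter_upwards [zak_gaborShift k g] with z hz
  rw [hz, RCLike.inner_apply, map_mul, conj_sqChar]
  ring

theorem isMinimalSystem_of_biorthogonal {ι H : Type*} [NormedAddCommGroup H]
    [InnerProductSpace ℂ H] {f h : ι → H} (h1 : ∀ i, inner ℂ (h i) (f i) ≠ 0)
    (h2 : ∀ i j, j ≠ i → inner ℂ (h i) (f j) = 0) : IsMinimalSystem f := by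
  intro i hi
  have hle : (Submodule.span ℂ (f '' {j | j ≠ i})).topologicalClosure ≤
      (ℂ ∙ h i)ᗮ := by
    refine Submodule.topologicalClosure_minimal _ ?_ (Submodule.isClosed_orthogonal _)
    rw [Submodule.span_le]
    rintro _ ⟨j, hj, rfl⟩
    exact Submodule.mem_orthogonal_singleton_iff_inner_right.2 (h2 i j hj)
  exact h1 i (Submodule.mem_orthogonal_singleton_iff_inner_right.1 (hle hi))

theorem isCompleteSystem_of_forall_inner {ι H : Type*} [NormedAddCommGroup H]
    [InnerProductSpace ℂ H] [CompleteSpace H] {f : ι → H}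
    (h : ∀ u, (∀ i, inner ℂ (f i) u = 0) → u = 0) : IsCompleteSystem f := by
  rw [IsCompleteSystem, Submodule.topologicalClosure_eq_top_iff, Submodule.eq_bot_iff]
  intro u hu
  exact h u fun i => (Submodule.mem_orthogonal _ _).1 hu _ (Submodule.subset_span ⟨i, rfl⟩)

/-- Completeness holds because Zg ≠ 0 almost everywhere, and minimality because 1/Zg is square
integrable: the vector with Zak transform 1/conj(Zg) generates a biorthogonal system. For (C_q), the
coefficients of u are the Fourier coefficients of F = conj(Zg)·Zu, and |Zu|² = |F|²/|Zg|² is summed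
through the power series. -/
theorem isExactSystem_and_isCqSystem_of_zak {q : ℝ} (hq : 2 < q)
    {g : Lp ℂ 2 (volume : Measure ℝ)} {α B C : ℝ} (hα : α < 1 - 2 / q) (hC : 0 < C)
    (hB : ∀ᵐ z ∂unitSq, ‖zak g z‖ ≤ B)
    (hg : ∀ᵐ z ∂unitSq, 1 ≤ C * powerSum α (sqSin z) * ‖zak g z‖ ^ 2) :
    IsExactSystem (gaborSystem g) ∧ IsCqSystem q (gaborSystem g) := by
  have hq0 : 0 < q := by linarith
  have hα1 : α < 1 := hα.trans_le (by
    have : 0 < 2 / q := by positivity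
    linarith)
  have hne : ∀ᵐ z ∂unitSq, zak g z ≠ 0 := by
    filter_upwards [hg] with z hz h0
    rw [h0] at hz; norm_num at hz
  have hmul : ∀ u : Lp ℂ 2 (volume : Measure ℝ),
      MemLp (fun z => (starRingEnd ℂ) (zak g z) * zak u z) 2 unitSq := fun u => by
    refine (Lp.memLp (zak u)).of_le_mul (c := B) ?_ ?_
    · exact (Complex.continuous_conj.comp_aestronglyMeasurable
        (Lp.memLp (zak g)).1).mul (Lp.memLp (zak u)).1
    · filter_upwards [hB] with z hz
      rw [norm_mul, RCLike.norm_conj]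
      gcongr
  have hinvm : AEStronglyMeasurable (fun z => ((starRingEnd ℂ) (zak g z))⁻¹) unitSq :=
    ((Complex.continuous_conj.comp_aestronglyMeasurable
        (Lp.memLp (zak g)).1).aemeasurable.inv).aestronglyMeasurable
  have hinv : MemLp (fun z => ((starRingEnd ℂ) (zak g z))⁻¹) 2 unitSq := by
    rw [memLp_two_iff_integrable_sq_norm hinvm]
    refine ⟨(hinvm.norm.pow 2), ?_⟩
    rw [hasFiniteIntegral_iff_ofReal (Filter.Eventually.of_forall fun z => sq_nonneg _)]
    refine (lintegral_le_of_le_powerSum (w := fun _ => 1) (A := 1) hα1.le hα1 hC.le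
      (integrable_const _) (fun _ => zero_le_one) (fun j => ?_) ?_).trans_lt ENNReal.ofReal_lt_top
    · simp only [mul_one, one_mul]
      rw [Real.rpow_neg_one, ← one_div]
      exact integral_sqSin_pow_le j
    · filter_upwards [hg, hne] with z hz h0
      have h1 : 0 < ‖zak g z‖ ^ 2 := by positivity
      rw [norm_inv, RCLike.norm_conj, inv_pow, mul_one, inv_le_iff_one_le_mul₀ h1]
      exact hz
  refine ⟨⟨?_, ?_⟩, ?_⟩
  · refine isCompleteSystem_of_forall_inner fun u hu => ?_
    have h0 := ae_eq_zero_of_sq_fourier (hmul u) fun k => by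
      rw [← inner_gaborSystem_eq]; exact hu k
    have h1 : zak u = 0 := by
      rw [Lp.eq_zero_iff_ae_eq_zero]
      filter_upwards [h0, hne] with z hz hz'
      simpa [hz'] using hz
    simpa using h1
  · set h := zak.symm (hinv.toLp _) with hh
    have hzh : zak h =ᵐ[unitSq] fun z => ((starRingEnd ℂ) (zak g z))⁻¹ := by
      rw [hh, LinearIsometryEquiv.apply_symm_apply]; exact hinv.coeFn_toLp
    have key : ∀ i j, inner ℂ (gaborSystem h i) (gaborSystem g j) = if j = i then (1 : ℂ) else 0 := by
      intro i j
      rw [inner_gaborSystem_eq]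
      have : ∫ z, sqChar (-i) z * ((starRingEnd ℂ) (zak h z) * zak (gaborSystem g j) z) ∂unitSq =
          ∫ z, sqChar (j - i) z ∂unitSq := by
        refine integral_congr_ae ?_
        filter_upwards [hzh, hne, zak_gaborShift j g] with z h1 h2 h3
        rw [gaborShift_apply] at h3
        rw [h1, h3, map_inv₀, Complex.conj_conj, sub_eq_add_neg, sqChar_add]
        field_simp
      rw [this, integral_sqChar]
      simp [sub_eq_zero]
    exact isMinimalSystem_of_biorthogonal (h := gaborSystem h) (fun i => by rw [key]; simp)
      fun i j hij => by rw [key, if_neg hij]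
  · have hpq : (q / (q - 1)).HolderConjugate q :=
      (Real.HolderConjugate.conjExponent (by linarith : (1 : ℝ) < q)).symm
    -- The exponent adds the coefficients (j+1)^{α-1} to the decay (j+1)^{-(1-2/q)} of the integrals
    -- of s^j|F|²; it is below -1 exactly when α < 1 - 2/q.
    set D := C * ∑' j : ℕ, ((j : ℝ) + 1) ^ (α - 1 - (1 - 2 / q)) with hD
    have hD0 : 0 ≤ D := mul_nonneg hC.le (tsum_nonneg fun j => by positivity)
    refine isCqSystem_of_dual (C := Real.sqrt D + 1) hpq _ (by positivity) fun u M hM hS => ?_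
    set F := (hmul u).toLp _ with hF
    have hFc : F =ᵐ[unitSq] fun z => (starRingEnd ℂ) (zak g z) * zak u z := MemLp.coeFn_toLp _
    have hcoef : ∀ k, inner ℂ (sqCharLp k) F = inner ℂ (gaborSystem g k) u := fun k => by
      rw [inner_sqCharLp, inner_gaborSystem_eq]
      refine integral_congr_ae ?_
      filter_upwards [hFc] with z hz
      rw [hz]
    have hj := integral_sqSin_pow_mul_norm_sq_le hpq hq.le F hM
      (fun S => by simpa only [hcoef] using hS S)
    have h1 := lintegral_le_of_le_powerSum (v := fun z => ‖zak u z‖ ^ 2) (w := fun z => ‖F z‖ ^ 2)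
      (A := M ^ 2) hα1.le hα hC.le (integrable_norm_sq F) (fun z => sq_nonneg _) (fun j => by
        refine (hj j).trans (le_of_eq ?_)
        rw [mul_comm, one_div, Real.inv_rpow (by positivity), Real.rpow_neg (by positivity)]) (by
        filter_upwards [hFc, hg] with z h1 h2
        rw [h1, norm_mul, RCLike.norm_conj, mul_pow, ← mul_assoc]
        exact le_mul_of_one_le_left (sq_nonneg _) h2)
    have h2 : ‖u‖ ^ 2 ≤ M ^ 2 * D := by
      rw [← zak.norm_map u, norm_sq_eq_integral,
        integral_eq_lintegral_of_nonneg_ae (Filter.Eventually.of_forall fun z => sq_nonneg _)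
          (integrable_norm_sq _).1]
      exact ENNReal.toReal_le_of_le_ofReal (by positivity) h1
    calc ‖u‖ ≤ Real.sqrt (M ^ 2 * D) := Real.le_sqrt_of_sq_le h2
      _ = M * Real.sqrt D := by rw [Real.sqrt_mul (sq_nonneg M), Real.sqrt_sq hM]
      _ ≤ (Real.sqrt D + 1) * M := by linarith

/-! ### Sharpness: the construction for t ≥ 0, then for t < 0. -/

/-! ### Exact `(C_q)` Gabor systems with good localization -/

theorem zak_sinSqOp_pow (n : ℕ) (f : Lp ℂ 2 (volume : Measure ℝ)) :
    zak ((sinSqOp ^ n) f) =ᵐ[unitSq] fun z => ((sqSin z ^ n : ℝ) : ℂ) * zak f z :=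
  zakModel.map_sinSqOp_pow n f

theorem summable_rpow_smul_sinSqOp {β : ℝ} (hβ : β < 1) :
    Summable fun n : ℕ => ((((n : ℝ) + 1) ^ (β - 1) : ℝ) : ℂ) • (sinSqOp ^ n) window := by
  obtain ⟨K, hK⟩ := exists_hasMomentDecay_window
  refine Summable.of_norm_bounded (summable_nat_add_one_rpow (e := β - 2) (by linarith)) fun n => ?_
  rw [norm_smul, Complex.norm_real, Real.norm_of_nonneg (by positivity)]
  refine (mul_le_mul_of_nonneg_left (hK n).1 (by positivity)).trans (le_of_eq ?_)
  rw [one_div, ← Real.rpow_neg_one, ← Real.rpow_add (by positivity)]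
  congr 1; ring

theorem zak_eq_powerSum_mul {β : ℝ} (hβ : β < 1) {g : Lp ℂ 2 (volume : Measure ℝ)}
    (hg : HasSum (fun n : ℕ => ((((n : ℝ) + 1) ^ (β - 1) : ℝ) : ℂ) • (sinSqOp ^ n) window) g) :
    zak g =ᵐ[unitSq] fun z => (powerSum β (sqSin z) : ℂ) * zakWindow z := by
  have hz := hg.mapL (zak.toContinuousLinearEquiv : _ →L[ℂ] Lp ℂ 2 unitSq)
  obtain ⟨ns, hns, hae⟩ := exists_subseq_ae_tendsto_of_hasSum hz
  have hterm : ∀ᵐ z ∂unitSq, ∀ n : ℕ,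
      zak (((((n : ℝ) + 1) ^ (β - 1) : ℝ) : ℂ) • (sinSqOp ^ n) window) z =
        ((((n : ℝ) + 1) ^ (β - 1) * sqSin z ^ n : ℝ) : ℂ) * zakWindow z := by
    rw [ae_all_iff]
    intro n
    rw [map_smul]
    filter_upwards [zak_sinSqOp_pow n window, zak_window, Lp.coeFn_smul
      ((((n : ℝ) + 1) ^ (β - 1) : ℝ) : ℂ) (zak ((sinSqOp ^ n) window))] with z h1 h2 h3
    rw [h3, Pi.smul_apply, h1, h2, smul_eq_mul]
    push_cast; ring
  filter_upwards [hae, hterm, ae_sqSin_lt_one] with z h1 h2 h3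
  have hS := (summable_powerSum hβ.le (sqSin_nonneg z) h3).hasSum.tendsto_sum_nat.comp
    hns.tendsto_atTop
  have hS' := ((Complex.continuous_ofReal.tendsto _).comp hS).mul_const (zakWindow z)
  refine tendsto_nhds_unique h1 (hS'.congr fun i => ?_)
  simp only [Function.comp_apply, Complex.ofReal_sum, Finset.sum_mul]
  exact Finset.sum_congr rfl fun n _ => (h2 n).symm

/-- Two constraints meet: |Zg|² of size (1 - s)^α with α < 1 - 2/q gives (C_q), and α > t/2 - 1
makes the weighted integrals finite. They are compatible precisely when t < 4 - 4/q. -/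
theorem exists_exact_cq_gaborSystem_of_nonneg {q t : ℝ} (hq : 2 < q) (h0 : 0 ≤ t)
    (ht : t < 4 / (q / (q - 1))) :
    ∃ g : Lp ℂ 2 (volume : Measure ℝ),
      IsExactSystem (gaborSystem g) ∧ IsCqSystem q (gaborSystem g) ∧
        weightedIntegral t g < ∞ ∧ weightedIntegral t (𝓕 g) < ∞ := by
  have hq0 : 0 < q := by linarith
  have ht' : t < 4 - 2 * (2 / q) := by
    have : 4 / (q / (q - 1)) = 4 - 2 * (2 / q) := by field_simp; ring
    rwa [← this]
  have hq2 : 0 < 2 / q := by positivity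
  have hq1 : 2 / q < 1 := by rwa [div_lt_one hq0]
  obtain ⟨α, hα1, hα2⟩ : ∃ α, max 0 (t / 2 - 1) < α ∧ α < 1 - 2 / q :=
    exists_between (max_lt (by linarith) (by linarith))
  have hα0 : 0 < α := (le_max_left _ _).trans_lt hα1
  have hαt : t / 2 - 1 < α := (le_max_right _ _).trans_lt hα1
  -- Chosen so that (1 - s)^{-2β}·(1 - s) = (1 - s)^α.
  set β := (1 - α) / 2 with hβ
  have hβ0 : 0 < β := by rw [hβ]; linarith
  have hβ2 : β < 1 / 2 := by rw [hβ]; linarith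
  have hg := (summable_rpow_smul_sinSqOp (β := β) (by linarith)).hasSum
  set g := ∑' n : ℕ, ((((n : ℝ) + 1) ^ (β - 1) : ℝ) : ℂ) • (sinSqOp ^ n) window
  have hz := zak_eq_powerSum_mul (by linarith) hg
  have hnorm : ∀ᵐ z ∂unitSq, ‖zak g z‖ ^ 2 = powerSum β (sqSin z) ^ 2 * (1 - sqSin z) := by
    filter_upwards [hz] with z h
    rw [h, norm_mul, mul_pow, norm_sq_zakWindow, Complex.norm_real, Real.norm_eq_abs, sq_abs]
  obtain ⟨C, hC, hCs⟩ := exists_powerSum_sq_le hβ2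
  -- 512 = 8·8²: one application of the power series lower bound with exponent α and two with
  -- exponent β.
  obtain ⟨hex, hcq⟩ := isExactSystem_and_isCqSystem_of_zak hq (g := g) (α := α) (B := Real.sqrt C)
    (C := 512) hα2 (by norm_num) (by
      filter_upwards [hnorm, ae_sqSin_lt_one] with z h1 h2
      refine Real.le_sqrt_of_sq_le ?_
      rw [h1]
      have := hCs _ (sqSin_nonneg z) h2
      rwa [le_div_iff₀ (by linarith)] at this) (by
      filter_upwards [hnorm, ae_sqSin_lt_one] with z h1 h2
      have hs : 0 < 1 - sqSin z := by linarith
      have e1 := one_sub_rpow_neg_le_powerSum hα0.le (by linarith) (sqSin_nonneg z) h2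
      have e2 := one_sub_rpow_neg_le_powerSum hβ0.le (by linarith) (sqSin_nonneg z) h2
      have p0 : 0 < (1 - sqSin z) ^ (-β) := Real.rpow_pos_of_pos hs _
      have p1 : 0 < (1 - sqSin z) ^ (-α) := Real.rpow_pos_of_pos hs _
      have e3 : ((1 - sqSin z) ^ (-β)) ^ 2 ≤ (8 * powerSum β (sqSin z)) ^ 2 := by gcongr
      have e4 : (1 - sqSin z) ^ (-α) * ((1 - sqSin z) ^ (-β)) ^ 2 * (1 - sqSin z) = 1 := by
        rw [← Real.rpow_natCast, ← Real.rpow_mul hs.le, ← Real.rpow_add hs,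
          ← Real.rpow_add_one hs.ne']
        have : -α + -β * ((2 : ℕ) : ℝ) + 1 = 0 := by rw [hβ]; push_cast; ring
        rw [this, Real.rpow_zero]
      have e5 : (1 - sqSin z) ^ (-α) * ((1 - sqSin z) ^ (-β)) ^ 2 ≤
          8 * powerSum α (sqSin z) * (8 * powerSum β (sqSin z)) ^ 2 :=
        mul_le_mul e1 e3 (by positivity) (p1.le.trans e1)
      have e6 := mul_le_mul_of_nonneg_right e5 hs.le
      rw [e4] at e6
      rw [h1]
      linarith)
  refine ⟨g, hex, hcq, ?_, ?_⟩
  · obtain ⟨K, hK⟩ := exists_hasMomentDecay_window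
    exact weightedIntegral_lt_top_of_hasSum hK h0 (by linarith) (by rw [hβ]; linarith) hg
  · obtain ⟨K, hK⟩ := exists_hasMomentDecay_fourier_window
    refine weightedIntegral_lt_top_of_hasSum (β := β) hK h0 (by linarith) (by rw [hβ]; linarith) ?_
    have := hg.mapL ((Lp.fourierTransformₗᵢ ℝ ℂ).toContinuousLinearEquiv :
      Lp ℂ 2 (volume : Measure ℝ) →L[ℂ] Lp ℂ 2 (volume : Measure ℝ))
    refine this.congr_fun fun n => ?_
    have h2 : (Lp.fourierTransformₗᵢ ℝ ℂ) (((((n : ℝ) + 1) ^ (β - 1) : ℝ) : ℂ) •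
        (sinSqOp ^ n) window) = ((((n : ℝ) + 1) ^ (β - 1) : ℝ) : ℂ) • 𝓕 ((sinSqOp ^ n) window) :=
      map_smul _ _ _
    rw [← fourier_sinSqOp_pow]
    exact h2.symm

/-! ### Orthonormal Gabor systems with high order cancellation -/

theorem norm_unitExp_sub_one_le (x : ℝ) : ‖unitExp x - 1‖ ≤ 2 * Real.pi * |x| := by
  have h := Real.norm_exp_I_mul_ofReal_sub_one_le (x := 2 * Real.pi * x)
  rw [Real.norm_eq_abs, abs_mul, abs_of_pos Real.two_pi_pos, mul_comm Complex.I] at h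
  rwa [unitExp_eq]

theorem fourier_comp_two_mul_sub {u : ℝ → ℂ} (hu : Integrable u) (ξ : ℝ) :
    𝓕 (fun x => u (2 * x) - u (2 * x - 1)) ξ =
      1 / 2 * (𝓕 u (ξ / 2) * (1 - unitExp (-(ξ / 2)))) := by
  set F : ℝ → ℂ := fun y => unitExp (-(y * (ξ / 2))) * u y with hF
  have hFi : Integrable F := hu.bdd_mul (c := 1) (by fun_prop)
    (Filter.Eventually.of_forall fun x => (norm_unitExp _).le)
  have e : ∀ x, unitExp (-(x * ξ)) * (u (2 * x) - u (2 * x - 1)) =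
      F (2 * x) - unitExp (-(ξ / 2)) * F (2 * x - 1) := fun x => by
    rw [hF, mul_sub]
    simp only [← mul_assoc, ← unitExp_add]
    congr 3 <;> [skip; congr 1] <;> ring_nf
  have i1 : Integrable fun x => F (2 * x) := hFi.comp_mul_left' two_ne_zero
  have i2 : Integrable fun x => F (2 * x - 1) :=
    (hFi.comp_sub_right 1).comp_mul_left' two_ne_zero
  rw [fourier_eq_integral_unitExp]
  simp_rw [e]
  rw [integral_sub i1 (i2.const_mul _), integral_const_mul,
    Measure.integral_comp_mul_left F 2, Measure.integral_comp_mul_left (fun y => F (y - 1)) 2,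
    integral_sub_right_eq_self F 1, fourier_eq_integral_unitExp]
  rw [abs_of_pos (by norm_num : (0 : ℝ) < 2⁻¹), Complex.real_smul]
  push_cast
  ring

/-- Passing from u to u(2x) - u(2x - 1) keeps the modulus one on the unit interval, since the two
pieces occupy its two halves. It multiplies the transform by a factor vanishing at 0, so each step
raises the order of the zero by one. -/
theorem exists_unimodular_fourier_le (k : ℕ) :
    ∃ u : ℝ → ℂ, Measurable u ∧ (∀ x ∈ Set.Ioc (0 : ℝ) 1, ‖u x‖ = 1) ∧
      (∀ x, x ∉ Set.Ioc (0 : ℝ) 1 → u x = 0) ∧ ∃ C, 0 ≤ C ∧ ∀ ξ, ‖𝓕 u ξ‖ ≤ C * |ξ| ^ k := by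
  have hint : ∀ u : ℝ → ℂ, Measurable u → (∀ x ∈ Set.Ioc (0 : ℝ) 1, ‖u x‖ = 1) →
      (∀ x, x ∉ Set.Ioc (0 : ℝ) 1 → u x = 0) → Integrable u := fun u h1 h2 h3 => by
    have : IntegrableOn u (Set.Ioc (0 : ℝ) 1) :=
      Measure.integrableOn_of_bounded (M := 1) (by simp) h1.aestronglyMeasurable
        ((ae_restrict_iff' measurableSet_Ioc).2 (Filter.Eventually.of_forall fun x hx => (h2 x hx).le))
    exact this.integrable_of_forall_notMem_eq_zero h3
  induction k with
  | zero =>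
    refine ⟨(Set.Ioc (0 : ℝ) 1).indicator fun _ => 1, measurable_const.indicator measurableSet_Ioc,
      fun x hx => by simp [Set.indicator_of_mem hx], fun x hx => Set.indicator_of_notMem hx _,
      1, zero_le_one, fun ξ => ?_⟩
    rw [fourier_eq_integral_unitExp]
    refine (norm_integral_le_integral_norm _).trans ?_
    have : ∀ x, ‖unitExp (-(x * ξ)) * (Set.Ioc (0 : ℝ) 1).indicator (fun _ => (1 : ℂ)) x‖ =
        (Set.Ioc (0 : ℝ) 1).indicator (fun _ => (1 : ℝ)) x := fun x => by
      rw [norm_mul, norm_unitExp, norm_indicator_eq_indicator_norm]; simp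
    simp_rw [this]
    rw [integral_indicator measurableSet_Ioc]
    simp
  | succ k ih =>
    obtain ⟨u, h1, h2, h3, C, hC, h4⟩ := ih
    refine ⟨fun x => u (2 * x) - u (2 * x - 1), by fun_prop, fun x hx => ?_, fun x hx => ?_,
      C * Real.pi, by positivity, fun ξ => ?_⟩
    · rcases le_or_gt x (1 / 2) with h | h
      · simp only []
        rw [h3 (2 * x - 1) fun h' => by linarith [h'.1], sub_zero]
        exact h2 _ ⟨by linarith [hx.1], by linarith⟩
      · simp only []
        rw [h3 (2 * x) fun h' => by linarith [h'.2], zero_sub, norm_neg]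
        exact h2 _ ⟨by linarith, by linarith [hx.2]⟩
    · simp only []
      rw [h3, h3, sub_zero]
      · exact fun h' => hx ⟨by linarith [h'.1], by linarith [h'.2]⟩
      · exact fun h' => hx ⟨by linarith [h'.1], by linarith [h'.2]⟩
    · rw [fourier_comp_two_mul_sub (hint u h1 h2 h3), norm_mul, norm_mul, norm_sub_rev]
      have e1 := h4 (ξ / 2)
      have e2 := norm_unitExp_sub_one_le (-(ξ / 2))
      rw [abs_neg, abs_div, abs_of_pos (two_pos : (0 : ℝ) < 2)] at e2
      rw [abs_div, abs_of_pos (two_pos : (0 : ℝ) < 2)] at e1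
      have e3 : (|ξ| / 2) ^ k ≤ |ξ| ^ k := by
        gcongr; linarith [abs_nonneg ξ]
      calc ‖(1 / 2 : ℂ)‖ * (‖𝓕 u (ξ / 2)‖ * ‖unitExp (-(ξ / 2)) - 1‖)
          ≤ 1 / 2 * ((C * |ξ| ^ k) * (2 * Real.pi * (|ξ| / 2))) := by
            have : ‖(1 / 2 : ℂ)‖ = 1 / 2 := by norm_num
            rw [this]
            gcongr
            exact e1.trans (by gcongr)
        _ ≤ C * Real.pi * |ξ| ^ (k + 1) := by
            rw [pow_succ]
            have : 0 ≤ C * Real.pi * (|ξ| ^ k * |ξ|) := by positivity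
            nlinarith

theorem lintegral_norm_sq_lt_top (g : Lp ℂ 2 (volume : Measure ℝ)) :
    ∫⁻ x, ENNReal.ofReal (‖g x‖ ^ 2) < ∞ := by
  have := (integrable_norm_sq g).2
  rwa [hasFiniteIntegral_iff_ofReal (Filter.Eventually.of_forall fun x => sq_nonneg _)] at this

theorem weightedIntegral_lt_top_of_le {g : Lp ℂ 2 (volume : Measure ℝ)} {t C : ℝ} (ht : t ≤ 0)
    (h : ∀ᵐ x, |x| ≤ 1 → |x| ^ t * ‖g x‖ ^ 2 ≤ C) : weightedIntegral t g < ∞ := by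
  have h1 : weightedIntegral t g ≤ ∫⁻ x, ((Set.Icc (-1 : ℝ) 1).indicator (fun _ => ENNReal.ofReal C) x
      + ENNReal.ofReal (‖g x‖ ^ 2)) := by
    refine lintegral_mono_ae ?_
    filter_upwards [h] with x hx
    rcases le_or_gt |x| 1 with h' | h'
    · rw [Set.indicator_of_mem (Set.mem_Icc.2 (abs_le.1 h'))]
      exact (ENNReal.ofReal_le_ofReal (hx h')).trans le_self_add
    · refine le_trans (ENNReal.ofReal_le_ofReal ?_) le_add_self
      exact mul_le_of_le_one_left (sq_nonneg _) (Real.rpow_le_one_of_one_le_of_nonpos h'.le ht)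
  refine h1.trans_lt ?_
  rw [lintegral_add_left (measurable_const.indicator measurableSet_Icc),
    lintegral_indicator measurableSet_Icc]
  refine ENNReal.add_lt_top.2 ⟨?_, lintegral_norm_sq_lt_top g⟩
  simp only [lintegral_const, Measure.restrict_apply_univ, Real.volume_Icc]
  exact ENNReal.mul_lt_top ENNReal.ofReal_lt_top ENNReal.ofReal_lt_top

theorem one_le_powerSum {s : ℝ} (h0 : 0 ≤ s) (h1 : s < 1) : 1 ≤ powerSum 0 s := by
  have := (summable_powerSum zero_le_one h0 h1).sum_le_tsum {0} fun j _ => by positivity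
  simpa [powerSum] using this

/-- Here |Zg| = 1 almost everywhere. Translating `u` to (1, 2] makes `g` vanish on [-1, 1]; on the
Fourier side this translation is a modulation, so the zero of order k at the origin survives, and 2k
≥ -t cancels the singular weight. -/
theorem exists_exact_cq_gaborSystem_of_neg {q t : ℝ} (hq : 2 < q) (ht : t < 0) :
    ∃ g : Lp ℂ 2 (volume : Measure ℝ),
      IsExactSystem (gaborSystem g) ∧ IsCqSystem q (gaborSystem g) ∧
        weightedIntegral t g < ∞ ∧ weightedIntegral t (𝓕 g) < ∞ := by
  obtain ⟨k, hk⟩ := exists_nat_ge (-t / 2)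
  obtain ⟨u, h1, h2, h3, C, hC, h4⟩ := exists_unimodular_fourier_le k
  have hm : MemLp u 2 (volume.restrict (Set.Ioc (0 : ℝ) 1)) :=
    MemLp.of_bound h1.aestronglyMeasurable 1 ((ae_restrict_iff' measurableSet_Ioc).2
      (Filter.Eventually.of_forall fun x hx => (h2 x hx).le))
  have hind : (Set.Ioc (0 : ℝ) 1).indicator u = u :=
    Set.indicator_eq_self.2 fun x hx => by by_contra h; exact hx (h3 x h)
  have hu2 : MemLp u 2 volume := by
    rw [← hind]; exact (memLp_indicator_iff_restrict measurableSet_Ioc).2 hm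
  have hu1 : Integrable u := by
    rw [← hind]
    exact (integrable_indicator_iff measurableSet_Ioc).2 (hm.integrable one_le_two)
  set g := gaborShift (0, 1) (hu2.toLp u) with hg
  have hz : ∀ᵐ z ∂unitSq, ‖zak g z‖ = 1 := by
    filter_upwards [zak_gaborShift (0, 1) (hu2.toLp u), zak_toLp_of_support_unit hu2 h3,
      ae_unitSq_fst_mem] with z e1 e2 e3
    rw [hg, e1, e2, norm_mul, norm_sqChar, one_mul, h2 _ e3]
  obtain ⟨hex, hcq⟩ := isExactSystem_and_isCqSystem_of_zak hq (g := g) (α := 0) (B := 1) (C := 1)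
    (by rw [sub_pos, div_lt_one (by linarith)]; exact hq) one_pos
    (hz.mono fun z h => h.le) (by
      filter_upwards [hz, ae_sqSin_lt_one] with z e1 e2
      rw [e1, one_pow, mul_one, one_mul]
      exact one_le_powerSum (sqSin_nonneg z) e2)
  refine ⟨g, hex, hcq, weightedIntegral_lt_top_of_le (C := 0) ht.le ?_,
    weightedIntegral_lt_top_of_le (C := C ^ 2) ht.le ?_⟩
  · filter_upwards [gaborShift_coeFn hu2.coeFn_toLp (0, 1)] with x hx h
    rw [hg, hx, h3 _ fun h' => ?_]
    · simp
    · have := h'.1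
      have := (abs_le.1 h).2
      push_cast at *
      linarith
  · have e : 𝓕 g = gaborShift (-1, 0) (𝓕 (hu2.toLp u)) := fourier_gaborShift 0 1 _
    have h0 : ∀ᵐ x : ℝ, x ≠ 0 := by simp [ae_iff]
    rw [e]
    filter_upwards [gaborShift_coeFn (fourier_toLp_ae_eq hu1 hu2) (-1, 0), h0] with x hx hx0 h
    have hx' : 0 < |x| := abs_pos.2 hx0
    rw [hx, norm_mul, norm_unitExp, one_mul, Int.cast_zero, sub_zero]
    calc |x| ^ t * ‖𝓕 u x‖ ^ 2 ≤ |x| ^ t * (C * |x| ^ k) ^ 2 := by gcongr; exact h4 x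
      _ = C ^ 2 * |x| ^ (t + 2 * k) := by
          rw [mul_pow, ← pow_mul, Real.rpow_add hx', mul_comm k 2,
            ← Nat.cast_ofNat (R := ℝ) (n := 2), ← Nat.cast_mul, Real.rpow_natCast]
          ring
      _ ≤ C ^ 2 * 1 := by
          gcongr
          exact Real.rpow_le_one hx'.le h (by linarith)
      _ = C ^ 2 := mul_one _

/-! ### Obstruction: coefficient bounds, a topological zero, and weighted coefficient estimates. -/

/-! ### Coefficient bounds for exact `(C_q)`-systems -/

theorem IsMinimalSystem.exists_dual {ι H : Type*} [NormedAddCommGroup H] [InnerProductSpace ℂ H]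
    [CompleteSpace H] {f : ι → H} (hf : IsMinimalSystem f) (i : ι) :
    ∃ w : H, inner ℂ w (f i) ≠ 0 ∧ ∀ j, j ≠ i → inner ℂ w (f j) = 0 := by
  by_contra! hcon
  refine hf i ?_
  set W := Submodule.span ℂ (f '' {j | j ≠ i}) with hW
  have h1 : f i ∈ Wᗮᗮ := by
    rw [Submodule.mem_orthogonal]
    intro w hw
    by_contra hne
    obtain ⟨j, hj, hj'⟩ := hcon w hne
    exact hj' ((Submodule.mem_orthogonal' _ _).1 hw _ (Submodule.subset_span ⟨j, hj, rfl⟩))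
  rwa [Submodule.orthogonal_orthogonal_eq_closure] at h1

/-- Minimality makes coefficients unique in the limit: those of the approximants supplied by (C_q)
must converge to the given `p`, and their ℓ^q bounds pass to the limit on finite sets. -/
theorem IsCqSystem.exists_sum_rpow_le {ι H : Type*} [NormedAddCommGroup H]
    [InnerProductSpace ℂ H] [CompleteSpace H] {q : ℝ} (hq : 0 < q) {f : ι → H}
    (hcq : IsCqSystem q f) (hf : IsMinimalSystem f) :
    ∃ C, 0 < C ∧ ∀ (S : Finset ι) (p : ι → ℂ),
      ∑ i ∈ S, ‖p i‖ ^ q ≤ (C * ‖∑ i ∈ S, p i • f i‖) ^ q := by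
  classical
  obtain ⟨C, hC, h⟩ := hcq
  refine ⟨C, hC, fun S p => ?_⟩
  set x := ∑ i ∈ S, p i • f i with hx
  choose a ha1 ha2 using fun n : ℕ => h x (1 / ((n : ℝ) + 1)) (by positivity)
  choose w hw1 hw2 using hf.exists_dual
  have hinner : ∀ (i : ι) (T : Finset ι) (b : ι → ℂ), (i ∉ T → b i = 0) →
      inner ℂ (w i) (∑ j ∈ T, b j • f j) = b i * inner ℂ (w i) (f i) := by
    intro i T b hb
    simp_rw [inner_sum, inner_smul_right]
    refine Finset.sum_eq_single i (fun j _ hj => by rw [hw2 i j hj, mul_zero]) fun hi => ?_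
    rw [hb hi, zero_mul]
  have hlim : Filter.Tendsto (fun n => ∑ j ∈ (a n).support, a n j • f j) Filter.atTop (nhds x) := by
    rw [tendsto_iff_norm_sub_tendsto_zero]
    refine squeeze_zero (fun n => norm_nonneg _) (fun n => ?_)
      tendsto_one_div_add_atTop_nhds_zero_nat
    rw [norm_sub_rev]
    exact (ha1 n).le
  -- The functional `w i` kills every other element of the system, so it reads off the i-th
  -- coefficient continuously.
  have hcoef : ∀ i ∈ S, Filter.Tendsto (fun n => a n i) Filter.atTop (nhds (p i)) := by
    intro i hi
    have h1 : Filter.Tendsto (fun n => inner ℂ (w i) (∑ j ∈ (a n).support, a n j • f j))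
        Filter.atTop (nhds (inner ℂ (w i) x)) :=
      tendsto_const_nhds.inner hlim
    have h2 := h1.div_const (inner ℂ (w i) (f i))
    rw [hx, hinner i S p fun h => absurd hi h, mul_div_cancel_right₀ _ (hw1 i)] at h2
    refine h2.congr fun n => ?_
    rw [hinner i _ _ fun h => Finsupp.notMem_support_iff.1 h, mul_div_cancel_right₀ _ (hw1 i)]
  have hsum : Filter.Tendsto (fun n => ∑ i ∈ S, ‖a n i‖ ^ q) Filter.atTop
      (nhds (∑ i ∈ S, ‖p i‖ ^ q)) :=
    tendsto_finsetSum _ fun i hi => (hcoef i hi).norm.rpow_const (Or.inr hq.le)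
  refine le_of_tendsto' hsum fun n => ?_
  have h0 : ∀ i, 0 ≤ ‖a n i‖ ^ q := fun i => Real.rpow_nonneg (norm_nonneg _) q
  calc ∑ i ∈ S, ‖a n i‖ ^ q ≤ ∑ i ∈ S ∪ (a n).support, ‖a n i‖ ^ q :=
        Finset.sum_le_sum_of_subset_of_nonneg Finset.subset_union_left fun i _ _ => h0 i
    _ = ∑ i ∈ (a n).support, ‖a n i‖ ^ q := by
        refine (Finset.sum_subset Finset.subset_union_right fun i _ hi => ?_).symm
        rw [Finsupp.notMem_support_iff.1 hi, norm_zero, Real.zero_rpow hq.ne']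
    _ = ((∑ i ∈ (a n).support, ‖a n i‖ ^ q) ^ (1 / q)) ^ q := by
        rw [← Real.rpow_mul (Finset.sum_nonneg fun i _ => h0 i), one_div, inv_mul_cancel₀ hq.ne',
          Real.rpow_one]
    _ ≤ (C * ‖x‖) ^ q := Real.rpow_le_rpow (Real.rpow_nonneg (Finset.sum_nonneg fun i _ => h0 i) _)
        (ha2 n) hq.le

theorem ae_eq_of_hasSum {α ι : Type*} [Denumerable ι] [MeasurableSpace α] {μ : Measure α}
    {u : ι → Lp ℂ 2 μ} {g : Lp ℂ 2 μ} (h : HasSum u g) {v : ι → α → ℂ} (huv : ∀ i, u i =ᵐ[μ] v i)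
    {G : α → ℂ} (hG : ∀ᵐ x ∂μ, HasSum (fun i => v i x) (G x)) : g =ᵐ[μ] G := by
  set e := (Denumerable.eqv ι).symm
  obtain ⟨ns, hns, hae⟩ := exists_subseq_ae_tendsto_of_hasSum (e.hasSum_iff.2 h)
  have huv' : ∀ᵐ x ∂μ, ∀ n : ℕ, u (e n) x = v (e n) x := ae_all_iff.2 fun n => huv (e n)
  filter_upwards [hae, huv', hG] with x h1 h2 h3
  have h4 := (e.hasSum_iff.2 h3).tendsto_sum_nat.comp hns.tendsto_atTop
  refine tendsto_nhds_unique h1 (h4.congr fun i => ?_)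
  exact Finset.sum_congr rfl fun n _ => (h2 n).symm

/-! ### Zeros of quasiperiodic functions -/

theorem eq_of_continuousOn_of_exp_eq_one {L : ℝ → ℂ} (hL : ContinuousOn L (Set.Icc 0 1))
    (h : ∀ x ∈ Set.Icc (0 : ℝ) 1, Complex.exp (L x) = 1) : L 0 = L 1 := by
  have h1 : ∀ x ∈ Set.Icc (0 : ℝ) 1, ∃ n : ℤ, L x = n * (2 * Real.pi * Complex.I) := fun x hx =>
    Complex.exp_eq_one_iff.1 (h x hx)
  set φ : ℝ → ℝ := fun x => (L x).im / (2 * Real.pi) with hφ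
  have h2 : ContinuousOn φ (Set.uIcc 0 1) := by
    rw [Set.uIcc_of_le zero_le_one]
    exact (Complex.continuous_im.comp_continuousOn hL).div_const _
  have him : ∀ x (n : ℤ), L x = n * (2 * Real.pi * Complex.I) → φ x = n := fun x n hn => by
    have : (n : ℂ) * (2 * Real.pi * Complex.I) = ((n * (2 * Real.pi) : ℝ) : ℂ) * Complex.I := by
      push_cast; ring
    have hpi := Real.pi_pos
    rw [hφ]
    simp only [hn, this, Complex.im_ofReal_mul, Complex.I_im, mul_one]
    field_simp
  obtain ⟨a, ha⟩ := h1 0 (by simp)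
  obtain ⟨b, hb⟩ := h1 1 (by simp)
  have hab : a = b := by
    by_contra hne
    have h3 := intermediate_value_uIcc h2
    rw [him 0 a ha, him 1 b hb] at h3
    have h4 : ((min a b : ℤ) : ℝ) + 1 / 2 ∈ Set.uIcc (a : ℝ) b := by
      have h5 : (min a b : ℤ) + 1 ≤ max a b := by omega
      have h6 : ((min a b : ℤ) : ℝ) + 1 ≤ ((max a b : ℤ) : ℝ) := by exact_mod_cast h5
      push_cast at h6 ⊢
      change min (a : ℝ) b ≤ _ ∧ _ ≤ max (a : ℝ) b
      constructor <;> linarith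
    obtain ⟨x, hx, hxe⟩ := h3 h4
    rw [Set.uIcc_of_le zero_le_one] at hx
    obtain ⟨n, hn⟩ := h1 x hx
    rw [him x n hn] at hxe
    have : (2 * n : ℤ) = 2 * min a b + 1 := by
      have : (2 * n : ℝ) = 2 * ((min a b : ℤ) : ℝ) + 1 := by linarith
      exact_mod_cast this
    omega
  rw [ha, hb, hab]

/-- Without a zero there would be a continuous logarithm on the square. Periodicity in y and
quasiperiodicity in x then compute the sum of its increments around the boundary in two ways, which
differ by 2πi. -/
theorem exists_zero_of_quasiperiodic {V : ℝ × ℝ → ℂ} (hV : Continuous V)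
    (h1 : ∀ x, V (x, 1) = V (x, 0)) (h2 : ∀ y, V (1, y) = unitExp (-y) * V (0, y)) :
    ∃ z ∈ Set.Icc (0 : ℝ) 1 ×ˢ Set.Icc (0 : ℝ) 1, V z = 0 := by
  by_contra! hne
  -- Clamping to [0, 1] extends V without zeros to the whole plane, where a logarithm exists by
  -- simple connectedness.
  set c : ℝ → ℝ := fun x => max 0 (min x 1) with hc
  have hcc : Continuous c := by fun_prop
  have hcI : ∀ x, c x ∈ Set.Icc (0 : ℝ) 1 := fun x => ⟨le_max_left _ _, by simp [hc]⟩
  have hce : ∀ x ∈ Set.Icc (0 : ℝ) 1, c x = x := fun x hx => by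
    simp only [hc, min_eq_left hx.2, max_eq_right hx.1]
  have hsc : IsSimplyConnected (Set.univ : Set (ℝ × ℝ)) := by
    have := (convex_univ (𝕜 := ℝ) (E := ℝ × ℝ)).contractibleSpace Set.univ_nonempty
    exact (inferInstance : SimplyConnectedSpace (Set.univ : Set (ℝ × ℝ)))
  obtain ⟨L, hLc, hL⟩ := Complex.exists_continuousOn_eqOn_exp_comp hsc isOpen_univ
    (g := fun z => V (c z.1, c z.2)) (by fun_prop) (by
      rintro ⟨z, -, hz⟩
      exact hne _ ⟨hcI z.1, hcI z.2⟩ hz)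
  have hLc' : Continuous L := continuousOn_univ.1 hLc
  have hLe : ∀ x ∈ Set.Icc (0 : ℝ) 1, ∀ y ∈ Set.Icc (0 : ℝ) 1, Complex.exp (L (x, y)) = V (x, y) :=
    fun x hx y hy => by
      have := hL (Set.mem_univ (x, y))
      simpa only [Function.comp_apply, hce x hx, hce y hy] using this
  have i0 : (0 : ℝ) ∈ Set.Icc (0 : ℝ) 1 := by simp
  have i1 : (1 : ℝ) ∈ Set.Icc (0 : ℝ) 1 := by simp
  have e1 := eq_of_continuousOn_of_exp_eq_one (L := fun x => L (x, 1) - L (x, 0))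
    (by fun_prop) fun x hx => by
      rw [Complex.exp_sub, hLe x hx 1 i1, hLe x hx 0 i0, h1]
      exact div_self (hne _ ⟨hx, i0⟩)
  have e2 := eq_of_continuousOn_of_exp_eq_one
    (L := fun y => L (1, y) - L (0, y) + 2 * Real.pi * Complex.I * y)
    (by fun_prop) fun y hy => by
      have := hne (0, y) ⟨i0, hy⟩
      rw [Complex.exp_add, Complex.exp_sub, hLe 1 i1 y hy, hLe 0 i0 y hy, h2,
        mul_div_cancel_right₀ _ this]
      exact unitExp_neg_mul y
  simp only [Complex.ofReal_zero, Complex.ofReal_one, mul_zero, mul_one, add_zero] at e2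
  have : (2 * Real.pi * Complex.I : ℂ) = 0 := by linear_combination e1 - e2
  exact Complex.two_pi_I_ne_zero this

/-! ### Weighted Bessel inequalities -/

theorem integral_unitExp_Ioc (m n : ℤ) :
    ∫ x in Set.Ioc (n : ℝ) (n + 1), unitExp (m * x) = if m = 0 then 1 else 0 := by
  rw [← integral_unitExp_int_mul m, ← setIntegral_Ioc_comp_sub _ (n : ℝ)]
  refine integral_congr_ae (Filter.Eventually.of_forall fun x => ?_)
  have : (m : ℝ) * (x - n) = m * x - (m * n : ℤ) := by push_cast; ring
  simp only [this, unitExp_sub_int]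

theorem integral_norm_sq_trigSum (M : Finset ℤ) (b : ℤ → ℂ) (n : ℤ) :
    ∫ x in Set.Ioc (n : ℝ) (n + 1), ‖∑ m ∈ M, b m * unitExp (m * x)‖ ^ 2 = ∑ m ∈ M, ‖b m‖ ^ 2 := by
  have e : ∀ x : ℝ, ((‖∑ m ∈ M, b m * unitExp (m * x)‖ ^ 2 : ℝ) : ℂ) =
      ∑ m ∈ M, ∑ l ∈ M, b m * (starRingEnd ℂ) (b l) * unitExp ((m - l : ℤ) * x) := fun x => by
    push_cast
    rw [← Complex.mul_conj', map_sum, Finset.sum_mul_sum]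
    refine Finset.sum_congr rfl fun m _ => Finset.sum_congr rfl fun l _ => ?_
    have : ((m : ℝ) - l) * x = m * x + -(l * x) := by ring
    rw [this, unitExp_add, map_mul, conj_unitExp]
    ring
  have hint : ∀ c k, IntegrableOn (fun x : ℝ => c * unitExp ((k : ℤ) * x))
      (Set.Ioc (n : ℝ) (n + 1)) := fun c k =>
    (Continuous.integrableOn_Icc (by fun_prop)).mono_set Set.Ioc_subset_Icc_self
  have h : ((∫ x in Set.Ioc (n : ℝ) (n + 1), ‖∑ m ∈ M, b m * unitExp (m * x)‖ ^ 2 : ℝ) : ℂ) =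
      ((∑ m ∈ M, ‖b m‖ ^ 2 : ℝ) : ℂ) := by
    rw [← integral_complex_ofReal]
    simp_rw [e]
    rw [integral_finsetSum _ fun m _ => integrable_finsetSum _ fun l _ => hint _ _]
    rw [Complex.ofReal_sum]
    refine Finset.sum_congr rfl fun m hm => ?_
    rw [integral_finsetSum _ fun l _ => hint _ _]
    simp_rw [integral_const_mul, integral_unitExp_Ioc, sub_eq_zero]
    simp [hm, Complex.mul_conj']
  exact_mod_cast h

theorem summable_int_one_add_abs_rpow {σ : ℝ} (hσ : 1 < σ) :
    Summable fun r : ℤ => (1 + |(r : ℝ)|) ^ (-σ) := by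
  have h := summable_nat_add_one_rpow (e := -σ) (by linarith)
  refine Summable.of_nat_of_neg ?_ ?_ <;>
  · refine h.congr fun j => ?_
    simp [add_comm]

theorem one_add_abs_rpow_neg_le {σ x y : ℝ} (hσ : 0 ≤ σ) (h : |x - y| ≤ 1) :
    (1 + |x|) ^ (-σ) ≤ 2 ^ σ * (1 + |y|) ^ (-σ) := by
  have h1 : (1 + |y|) ≤ 2 * (1 + |x|) := by
    have := abs_sub_abs_le_abs_sub y x
    rw [abs_sub_comm] at this
    linarith [abs_nonneg x]
  have hx : 0 < 1 + |x| := by positivity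
  have hy : 0 < 1 + |y| := by positivity
  rw [Real.rpow_neg hx.le, Real.rpow_neg hy.le, ← div_eq_mul_inv, inv_eq_one_div,
    div_le_div_iff₀ (by positivity) (by positivity), one_mul,
    ← Real.mul_rpow (by norm_num) hx.le]
  exact Real.rpow_le_rpow hy.le h1 hσ

theorem exists_sum_one_add_abs_sub_rpow_le {σ : ℝ} (hσ : 1 < σ) :
    ∃ D, 0 < D ∧ ∀ (x : ℝ) (N : Finset ℤ), ∑ n ∈ N, (1 + |x - n|) ^ (-σ) ≤ D := by
  have hs := summable_int_one_add_abs_rpow hσ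
  refine ⟨2 ^ σ * ∑' r : ℤ, (1 + |(r : ℝ)|) ^ (-σ), mul_pos (by positivity)
    (hs.tsum_pos (fun r => by positivity) 0 (by positivity)), fun x N => ?_⟩
  have h1 : HasSum (fun n : ℤ => (1 + |((⌊x⌋ - n : ℤ) : ℝ)|) ^ (-σ))
      (∑' r : ℤ, (1 + |(r : ℝ)|) ^ (-σ)) := (Equiv.subLeft ⌊x⌋).hasSum_iff.2 hs.hasSum
  calc ∑ n ∈ N, (1 + |x - n|) ^ (-σ)
      ≤ ∑ n ∈ N, 2 ^ σ * (1 + |((⌊x⌋ - n : ℤ) : ℝ)|) ^ (-σ) := by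
        refine Finset.sum_le_sum fun n _ => one_add_abs_rpow_neg_le (by linarith) ?_
        have h2 := Int.floor_le x
        have h3 := Int.lt_floor_add_one x
        push_cast
        rw [abs_le]
        constructor <;> linarith
    _ = 2 ^ σ * ∑ n ∈ N, (1 + |((⌊x⌋ - n : ℤ) : ℝ)|) ^ (-σ) := by rw [Finset.mul_sum]
    _ ≤ _ := mul_le_mul_of_nonneg_left (sum_le_hasSum N (fun n _ => by positivity) h1)
        (by positivity)

theorem integrable_one_add_abs_rpow {σ : ℝ} (hσ : 1 < σ) :
    Integrable fun x : ℝ => (1 + |x|) ^ (-σ) := by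
  have := integrable_one_add_norm (E := ℝ) (μ := volume) (r := σ) (by simpa using hσ)
  simpa only [Real.norm_eq_abs] using this

/-- The trigonometric sum is periodic and orthogonal on each unit cell, so only the summability over
cells of the weight with σ > 1 is needed. -/
theorem exists_integral_norm_sq_trigSum_le {σ : ℝ} (hσ : 1 < σ) :
    ∃ K, 0 < K ∧ ∀ (M : Finset ℤ) (b : ℤ → ℂ),
      Integrable (fun x : ℝ => (1 + |x|) ^ (-σ) * ‖∑ m ∈ M, b m * unitExp (m * x)‖ ^ 2) ∧
      ∫ x : ℝ, (1 + |x|) ^ (-σ) * ‖∑ m ∈ M, b m * unitExp (m * x)‖ ^ 2 ≤ K * ∑ m ∈ M, ‖b m‖ ^ 2 := by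
  have hs := summable_int_one_add_abs_rpow hσ
  refine ⟨2 ^ σ * ∑' r : ℤ, (1 + |(r : ℝ)|) ^ (-σ), mul_pos (by positivity)
    (hs.tsum_pos (fun r => by positivity) 0 (by positivity)), fun M b => ?_⟩
  have hint : Integrable
      (fun x : ℝ => (1 + |x|) ^ (-σ) * ‖∑ m ∈ M, b m * unitExp (m * x)‖ ^ 2) := by
    refine (integrable_one_add_abs_rpow hσ).mul_bdd (c := (∑ m ∈ M, ‖b m‖) ^ 2)
      (Continuous.aestronglyMeasurable (by fun_prop)) (Filter.Eventually.of_forall fun x => ?_)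
    rw [norm_pow, norm_norm]
    gcongr
    refine (norm_sum_le _ _).trans (le_of_eq (Finset.sum_congr rfl fun m _ => ?_))
    rw [norm_mul, norm_unitExp, mul_one]
  refine ⟨hint, ?_⟩
  have h1 := hasSum_integral_iUnion (μ := (volume : Measure ℝ))
    (s := fun n : ℤ => Set.Ioc (n : ℝ) (n + 1)) (fun n => measurableSet_Ioc)
    (Set.pairwise_disjoint_Ioc_intCast ℝ) hint.integrableOn
  rw [iUnion_Ioc_intCast, setIntegral_univ] at h1
  refine hasSum_le (fun r => ?_) h1 (((hs.hasSum.mul_left (2 ^ σ)).mul_right _))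
  rw [← integral_norm_sq_trigSum M b r, ← integral_const_mul]
  refine setIntegral_mono_on hint.integrableOn ?_ measurableSet_Ioc fun x hx => ?_
  · exact (Continuous.integrableOn_Icc (by fun_prop)).mono_set Set.Ioc_subset_Icc_self
  · refine mul_le_mul_of_nonneg_right (one_add_abs_rpow_neg_le (by linarith) ?_) (sq_nonneg _)
    rw [abs_le]
    constructor <;> linarith [hx.1, hx.2]

theorem rpow_half_sq {y : ℝ} (hy : 0 < y) (s : ℝ) : (y ^ (s / 2)) ^ 2 = y ^ s := by
  rw [← Real.rpow_natCast, ← Real.rpow_mul hy.le]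
  congr 1; push_cast; ring

/-- The dual of the preceding estimate: pair F with the trigonometric sum formed from its own
Fourier coefficients, use the weighted AM-GM inequality, and absorb half of the left side. -/
theorem exists_sum_norm_sq_fourier_le {σ : ℝ} (hσ : 1 < σ) :
    ∃ K, 0 < K ∧ ∀ (F : ℝ → ℂ) (n : ℤ), Integrable F →
      Integrable (fun x : ℝ => (1 + |x - n|) ^ σ * ‖F x‖ ^ 2) → ∀ M : Finset ℤ,
      ∑ m ∈ M, ‖∫ x : ℝ, unitExp (-(m * x)) * F x‖ ^ 2 ≤
        K * ∫ x : ℝ, (1 + |x - n|) ^ σ * ‖F x‖ ^ 2 := by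
  obtain ⟨K, hK, h⟩ := exists_integral_norm_sq_trigSum_le hσ
  refine ⟨K, hK, fun F n hF hFw M => ?_⟩
  set a : ℤ → ℂ := fun m => ∫ x : ℝ, unitExp (-(m * x)) * F x with ha
  set T : ℝ → ℂ := fun x => ∑ m ∈ M, a m * unitExp (m * x) with hT
  have hTn : ∀ x, T (x - n) = T x := fun x => by
    simp only [hT]
    refine Finset.sum_congr rfl fun m _ => ?_
    have : (m : ℝ) * (x - n) = m * x - (m * n : ℤ) := by push_cast; ring
    rw [this, unitExp_sub_int]
  obtain ⟨hi, hle⟩ := h M a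
  have hi' : Integrable fun x : ℝ => (1 + |x - n|) ^ (-σ) * ‖T x‖ ^ 2 := by
    refine (hi.comp_sub_right (n : ℝ)).congr (Filter.Eventually.of_forall fun x => ?_)
    exact congrArg (fun c => (1 + |x - n|) ^ (-σ) * ‖c‖ ^ 2) (hTn x)
  have hle' : ∫ x : ℝ, (1 + |x - n|) ^ (-σ) * ‖T x‖ ^ 2 ≤ K * ∑ m ∈ M, ‖a m‖ ^ 2 := by
    refine le_trans (le_of_eq ?_) hle
    change _ = ∫ x : ℝ, (1 + |x|) ^ (-σ) * ‖T x‖ ^ 2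
    rw [← integral_sub_right_eq_self (fun x : ℝ => (1 + |x|) ^ (-σ) * ‖T x‖ ^ 2) (n : ℝ)]
    refine integral_congr_ae (Filter.Eventually.of_forall fun x => ?_)
    exact congrArg (fun c => (1 + |x - n|) ^ (-σ) * ‖c‖ ^ 2) (hTn x).symm
  have hexp : ∀ m : ℤ, Integrable fun x : ℝ => unitExp (-(m * x)) * F x := fun m =>
    hF.bdd_mul (c := 1) (by fun_prop) (Filter.Eventually.of_forall fun x => (norm_unitExp _).le)
  have hA : ((∑ m ∈ M, ‖a m‖ ^ 2 : ℝ) : ℂ) = ∫ x, (starRingEnd ℂ) (T x) * F x := by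
    have : ∀ x, (starRingEnd ℂ) (T x) * F x =
        ∑ m ∈ M, (starRingEnd ℂ) (a m) * (unitExp (-(m * x)) * F x) := fun x => by
      rw [hT, map_sum, Finset.sum_mul]
      refine Finset.sum_congr rfl fun m _ => ?_
      rw [map_mul, conj_unitExp, mul_assoc]
    simp_rw [this]
    rw [integral_finsetSum _ fun m _ => (hexp m).const_mul _]
    simp_rw [integral_const_mul]
    push_cast
    exact Finset.sum_congr rfl fun m _ => (Complex.conj_mul' _).symm
  have hA0 : 0 ≤ ∑ m ∈ M, ‖a m‖ ^ 2 := Finset.sum_nonneg fun m _ => sq_nonneg _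
  have hbound : ∑ m ∈ M, ‖a m‖ ^ 2 ≤
      ∫ x : ℝ, ((1 / (2 * K)) * ((1 + |x - n|) ^ (-σ) * ‖T x‖ ^ 2) +
        K / 2 * ((1 + |x - n|) ^ σ * ‖F x‖ ^ 2)) := by
    calc ∑ m ∈ M, ‖a m‖ ^ 2 = ‖((∑ m ∈ M, ‖a m‖ ^ 2 : ℝ) : ℂ)‖ := by
          rw [Complex.norm_real, Real.norm_of_nonneg hA0]
      _ ≤ ∫ x, ‖(starRingEnd ℂ) (T x) * F x‖ := by
          rw [hA]; exact norm_integral_le_integral_norm _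
      _ ≤ _ := by
          refine integral_mono_of_nonneg (Filter.Eventually.of_forall fun x => norm_nonneg _)
            ((hi'.const_mul _).add (hFw.const_mul _)) (Filter.Eventually.of_forall fun x => ?_)
          have hp : 0 < 1 + |x - n| := by positivity
          simp only [norm_mul, RCLike.norm_conj]
          set u := (1 + |x - n|) ^ (-(σ / 2)) * ‖T x‖ with hu
          set v := (1 + |x - n|) ^ (σ / 2) * ‖F x‖ with hv
          have e1 : ‖T x‖ * ‖F x‖ = u * v := by
            have : (1 + |x - n|) ^ (-(σ / 2)) * (1 + |x - n|) ^ (σ / 2) = 1 := by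
              rw [← Real.rpow_add hp, neg_add_cancel, Real.rpow_zero]
            linear_combination (-(‖T x‖ * ‖F x‖)) * this
          have e2 : (1 + |x - n|) ^ (-σ) * ‖T x‖ ^ 2 = u ^ 2 := by
            rw [hu, mul_pow, ← neg_div, rpow_half_sq hp]
          have e3 : (1 + |x - n|) ^ σ * ‖F x‖ ^ 2 = v ^ 2 := by
            rw [hv, mul_pow, rpow_half_sq hp]
          rw [e1, e2, e3]
          have : 1 / (2 * K) * u ^ 2 + K / 2 * v ^ 2 - u * v = (u - K * v) ^ 2 / (2 * K) := by
            field_simp; ring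
          have : 0 ≤ (u - K * v) ^ 2 / (2 * K) := by positivity
          linarith
  rw [integral_add (hi'.const_mul _) (hFw.const_mul _), integral_const_mul, integral_const_mul]
    at hbound
  have : 1 / (2 * K) * ∫ x : ℝ, (1 + |x - n|) ^ (-σ) * ‖T x‖ ^ 2 ≤
      1 / 2 * ∑ m ∈ M, ‖a m‖ ^ 2 := by
    calc _ ≤ 1 / (2 * K) * (K * ∑ m ∈ M, ‖a m‖ ^ 2) := by gcongr
      _ = _ := by field_simp
  linarith

/-! ### Weighted summability of short-time Fourier coefficients -/

/-- `φ` decays at least like `(1 + |x|)⁻³`. -/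
def HasCubicDecay (φ : ℝ → ℂ) : Prop :=
  AEStronglyMeasurable φ volume ∧ ∃ A, 0 ≤ A ∧ ∀ x, ‖φ x‖ ≤ A * (1 + |x|) ^ (-3 : ℝ)

theorem one_add_abs_rpow_le_mul {t : ℝ} (h0 : 0 ≤ t) (x y : ℝ) :
    (1 + |y|) ^ t ≤ (1 + |x|) ^ t * (1 + |x - y|) ^ t := by
  rw [← Real.mul_rpow (by positivity) (by positivity)]
  refine Real.rpow_le_rpow (by positivity) ?_ h0
  have := abs_sub_abs_le_abs_sub y x
  rw [abs_sub_comm y x] at this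
  nlinarith [abs_nonneg x, abs_nonneg (x - y)]

theorem HasCubicDecay.memLp {φ : ℝ → ℂ} (hφ : HasCubicDecay φ) : MemLp φ 2 volume := by
  obtain ⟨hm, A, hA, h⟩ := hφ
  rw [memLp_two_iff_integrable_sq_norm hm]
  refine ((integrable_one_add_abs_rpow (σ := 6) (by norm_num)).const_mul (A ^ 2)).mono'
    (hm.norm.pow 2) (Filter.Eventually.of_forall fun x => ?_)
  rw [Real.norm_of_nonneg (sq_nonneg _)]
  calc ‖φ x‖ ^ 2 ≤ (A * (1 + |x|) ^ (-3 : ℝ)) ^ 2 := by gcongr; exact h x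
    _ = A ^ 2 * (1 + |x|) ^ (-6 : ℝ) := by
      rw [mul_pow, ← rpow_half_sq (y := 1 + |x|) (by positivity) (-6)]; norm_num

/-- For each n the weighted Bessel inequality handles the sum over m. The weight (1+|n|)^t is moved
onto x at the cost of (1+|x-n|)^t, which the decay of φ pays for, leaving a kernel summable in n. -/
theorem HasCubicDecay.exists_sum_weight_le {φ : ℝ → ℂ} (hφ : HasCubicDecay φ) {t : ℝ} (h0 : 0 ≤ t)
    (h4 : t < 4) (h : Lp ℂ 2 (volume : Measure ℝ))
    (hw : Integrable fun x => (1 + |x|) ^ t * ‖h x‖ ^ 2) :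
    ∃ B, ∀ M N : Finset ℤ, ∑ n ∈ N, ∑ m ∈ M, (1 + |(n : ℝ)|) ^ t *
      ‖∫ x : ℝ, unitExp (-(m * x)) * ((starRingEnd ℂ) (φ (x - n)) * h x)‖ ^ 2 ≤ B := by
  have hφ2 := hφ.memLp
  obtain ⟨hm, A, hA, hd⟩ := hφ
  -- The solution of t + σ - 6 = -σ: the same exponent serves the Bessel inequality and the sum over
  -- n. It exceeds 1 exactly when t < 4.
  set σ := (6 - t) / 2 with hσd
  have hσ : 1 < σ := by rw [hσd]; linarith
  obtain ⟨K, hK, hKb⟩ := exists_sum_norm_sq_fourier_le hσ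
  obtain ⟨D, hD, hDb⟩ := exists_sum_one_add_abs_sub_rpow_le hσ
  refine ⟨K * A ^ 2 * D * ∫ x, (1 + |x|) ^ t * ‖h x‖ ^ 2, fun M N => ?_⟩
  have hF : ∀ n : ℤ, MemLp (fun x : ℝ => (starRingEnd ℂ) (φ (x - n))) 2 volume := fun n =>
    (hφ2.comp_measurePreserving (measurePreserving_sub_right volume (n : ℝ))).star
  have hpt : ∀ (n : ℤ) (x : ℝ), (1 + |x - n|) ^ σ * ‖(starRingEnd ℂ) (φ (x - n)) * h x‖ ^ 2 ≤
      A ^ 2 * ((1 + |x - n|) ^ (σ - 6) * ‖h x‖ ^ 2) := fun n x => by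
    have hp : 0 < 1 + |x - n| := by positivity
    rw [norm_mul, RCLike.norm_conj, mul_pow, ← mul_assoc, ← mul_assoc]
    refine mul_le_mul_of_nonneg_right ?_ (sq_nonneg _)
    calc (1 + |x - n|) ^ σ * ‖φ (x - n)‖ ^ 2
        ≤ (1 + |x - n|) ^ σ * (A * (1 + |x - n|) ^ (-3 : ℝ)) ^ 2 := by gcongr; exact hd _
      _ = A ^ 2 * (1 + |x - n|) ^ (σ - 6) := by
          have e : ((1 + |x - n|) ^ (-3 : ℝ)) ^ 2 = (1 + |x - n|) ^ (-6 : ℝ) := by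
            rw [← rpow_half_sq hp (-6)]; norm_num
          rw [mul_pow, e, sub_eq_add_neg σ 6, Real.rpow_add hp]; ring
  have hcont : ∀ (n : ℤ) (e : ℝ), Continuous fun x : ℝ => (1 + |x - n|) ^ e := fun n e =>
    Continuous.rpow_const (by fun_prop) fun x => Or.inl (by positivity)
  have hi1 : ∀ (n : ℤ) (e : ℝ), e ≤ 0 →
      Integrable fun x : ℝ => (1 + |x - n|) ^ e * ‖h x‖ ^ 2 := fun n e he =>
    (integrable_norm_sq h).bdd_mul (c := 1) (hcont n e).aestronglyMeasurable
      (Filter.Eventually.of_forall fun x => by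
        rw [Real.norm_of_nonneg (by positivity)]
        exact Real.rpow_le_one_of_one_le_of_nonpos (by linarith [abs_nonneg (x - n)]) he)
  have hi2 : ∀ n : ℤ, Integrable
      fun x : ℝ => (1 + |x - n|) ^ (-σ) * ((1 + |x|) ^ t * ‖h x‖ ^ 2) := fun n =>
    hw.bdd_mul (c := 1) (hcont n (-σ)).aestronglyMeasurable
      (Filter.Eventually.of_forall fun x => by
        rw [Real.norm_of_nonneg (by positivity)]
        exact Real.rpow_le_one_of_one_le_of_nonpos (by linarith [abs_nonneg (x - n)])
          (by linarith))
  have hone : ∀ n : ℤ, ∑ m ∈ M, (1 + |(n : ℝ)|) ^ t *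
      ‖∫ x : ℝ, unitExp (-(m * x)) * ((starRingEnd ℂ) (φ (x - n)) * h x)‖ ^ 2 ≤
      K * A ^ 2 * ∫ x : ℝ, (1 + |x - n|) ^ (-σ) * ((1 + |x|) ^ t * ‖h x‖ ^ 2) := fun n => by
    have hFw : Integrable fun x : ℝ =>
        (1 + |x - n|) ^ σ * ‖(starRingEnd ℂ) (φ (x - n)) * h x‖ ^ 2 := by
      refine ((hi1 n (σ - 6) (by rw [hσd]; linarith)).const_mul (A ^ 2)).mono'
        ((hcont n σ).aestronglyMeasurable.mul (((hF n).1.mul (Lp.memLp h).1).norm.pow 2))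
        (Filter.Eventually.of_forall fun x => ?_)
      rw [Real.norm_of_nonneg (by positivity)]
      exact hpt n x
    have h1 := hKb _ n ((hF n).integrable_mul (Lp.memLp h)) hFw M
    rw [← Finset.mul_sum]
    refine (mul_le_mul_of_nonneg_left h1 (by positivity)).trans ?_
    calc (1 + |(n : ℝ)|) ^ t * (K * ∫ x : ℝ,
          (1 + |x - n|) ^ σ * ‖(starRingEnd ℂ) (φ (x - n)) * h x‖ ^ 2)
        = K * ∫ x : ℝ, (1 + |(n : ℝ)|) ^ t *
          ((1 + |x - n|) ^ σ * ‖(starRingEnd ℂ) (φ (x - n)) * h x‖ ^ 2) := by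
          rw [integral_const_mul]; ring
      _ ≤ K * ∫ x : ℝ, A ^ 2 * ((1 + |x - n|) ^ (-σ) * ((1 + |x|) ^ t * ‖h x‖ ^ 2)) := by
          refine mul_le_mul_of_nonneg_left (integral_mono (hFw.const_mul _)
            ((hi2 n).const_mul _) fun x => ?_) hK.le
          have hp : 0 < 1 + |x - n| := by positivity
          calc (1 + |(n : ℝ)|) ^ t * ((1 + |x - n|) ^ σ * ‖(starRingEnd ℂ) (φ (x - n)) * h x‖ ^ 2)
              ≤ ((1 + |x|) ^ t * (1 + |x - n|) ^ t) *
                (A ^ 2 * ((1 + |x - n|) ^ (σ - 6) * ‖h x‖ ^ 2)) :=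
                mul_le_mul (one_add_abs_rpow_le_mul h0 x n) (hpt n x) (by positivity)
                  (by positivity)
            _ = A ^ 2 * ((1 + |x - n|) ^ (-σ) * ((1 + |x|) ^ t * ‖h x‖ ^ 2)) := by
                have : -σ = t + (σ - 6) := by rw [hσd]; ring
                rw [this, Real.rpow_add hp]; ring
      _ = _ := by rw [integral_const_mul]; ring
  calc _ ≤ ∑ n ∈ N, K * A ^ 2 *
        ∫ x : ℝ, (1 + |x - n|) ^ (-σ) * ((1 + |x|) ^ t * ‖h x‖ ^ 2) :=
        Finset.sum_le_sum fun n _ => hone n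
    _ = K * A ^ 2 * ∫ x : ℝ, ∑ n ∈ N, (1 + |x - n|) ^ (-σ) * ((1 + |x|) ^ t * ‖h x‖ ^ 2) := by
        rw [integral_finsetSum _ fun n _ => hi2 n, Finset.mul_sum]
    _ ≤ K * A ^ 2 * ∫ x : ℝ, D * ((1 + |x|) ^ t * ‖h x‖ ^ 2) := by
        refine mul_le_mul_of_nonneg_left (integral_mono
          (integrable_finsetSum _ fun n _ => hi2 n) (hw.const_mul D) fun x => ?_) (by positivity)
        simp only [← Finset.sum_mul]
        exact mul_le_mul_of_nonneg_right (hDb x N) (by positivity)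
    _ = _ := by rw [integral_const_mul]; ring

theorem one_add_abs_rpow_neg_three (x : ℝ) : (1 + |x|) ^ (-3 : ℝ) = ((1 + |x|) ^ 3)⁻¹ := by
  rw [Real.rpow_neg (by positivity), ← Real.rpow_natCast]; norm_num

theorem hasCubicDecay_of_le {φ : ℝ → ℂ} (hm : AEStronglyMeasurable φ volume) {C₀ C₁ : ℝ}
    (h0 : ∀ x, ‖φ x‖ ≤ C₀) (h1 : ∀ x, |x| ^ 3 * ‖φ x‖ ≤ C₁) : HasCubicDecay φ := by
  refine ⟨hm, 4 * (C₀ + C₁), ?_, fun x => ?_⟩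
  · have := (norm_nonneg _).trans (h0 0)
    have : 0 ≤ C₁ := le_trans (by positivity) (h1 0)
    positivity
  · rw [one_add_abs_rpow_neg_three, ← div_eq_mul_inv, le_div_iff₀ (by positivity)]
    have e : (1 + |x|) ^ 3 ≤ 4 * (1 + |x| ^ 3) := by
      nlinarith [abs_nonneg x, mul_nonneg (add_nonneg zero_le_one (abs_nonneg x))
        (sq_nonneg (|x| - 1))]
    calc ‖φ x‖ * (1 + |x|) ^ 3 ≤ ‖φ x‖ * (4 * (1 + |x| ^ 3)) := by gcongr
      _ = 4 * (‖φ x‖ + |x| ^ 3 * ‖φ x‖) := by ring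
      _ ≤ _ := by gcongr; exacts [h0 x, h1 x]

theorem HasCubicDecay.comp_sub {φ : ℝ → ℂ} (h : HasCubicDecay φ) {a : ℝ} (ha : |a| ≤ 1) :
    HasCubicDecay fun x => φ (x - a) := by
  obtain ⟨hm, A, hA, hd⟩ := h
  refine ⟨hm.comp_quasiMeasurePreserving
    (measurePreserving_sub_right volume a).quasiMeasurePreserving, A * 2 ^ (3 : ℝ), by positivity,
    fun x => (hd _).trans ?_⟩
  rw [mul_assoc]
  refine mul_le_mul_of_nonneg_left (one_add_abs_rpow_neg_le (by norm_num) ?_) hA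
  rw [abs_sub_comm]; simpa using ha

theorem hasCubicDecay_cutoff {v : ℝ → ℂ} (hv : Continuous v) : HasCubicDecay (cutoff v) := by
  obtain ⟨C, hC, h⟩ := exists_norm_cutoff_le hv
  refine hasCubicDecay_of_le (integrable_cutoff hv).1 h (C₁ := C) fun x => ?_
  by_cases hx : x ∈ Set.Ioc (-1 : ℝ) 1
  · exact (mul_le_of_le_one_left (norm_nonneg _)
      (pow_le_one₀ (abs_nonneg x) (abs_le.2 ⟨hx.1.le, hx.2⟩))).trans (h x)
  · rw [cutoff_of_notMem hx]; simpa using hC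

theorem norm_fourier_le (f : ℝ → ℂ) (ξ : ℝ) : ‖𝓕 f ξ‖ ≤ ∫ x, ‖f x‖ := by
  rw [fourier_eq_integral_unitExp]
  refine (norm_integral_le_integral_norm _).trans (le_of_eq ?_)
  simp only [norm_mul, norm_unitExp, one_mul]

/-- Three integrations by parts. The last leaves boundary terms, because the second derivative jumps
at ±1, but these are bounded. -/
theorem hasCubicDecay_fourier_cutoff_windowFun : HasCubicDecay (𝓕 (cutoff windowFun)) := by
  have hw := integrable_cutoff continuous_windowFun
  refine hasCubicDecay_of_le (continuous_fourier_of_integrable hw).aestronglyMeasurable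
    (norm_fourier_le _) (C₁ := (∫ x, ‖cutoff windowDerivThree x‖) +
      (‖windowDerivTwo 1‖ + ‖windowDerivTwo (-1)‖)) fun ξ => ?_
  have h3 : (2 * Real.pi * Complex.I * ξ) ^ 3 * 𝓕 (cutoff windowFun) ξ =
      𝓕 (cutoff windowDerivThree) ξ -
        (unitExp (-ξ) * windowDerivTwo 1 - unitExp ξ * windowDerivTwo (-1)) := by
    rw [← fourier_cutoff_deriv hasDerivAt_windowDerivTwo continuous_windowDerivThree,
      ← fourier_cutoff_windowDeriv, ← fourier_cutoff_windowFun]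
    ring
  have h4 : |ξ| ^ 3 * ‖𝓕 (cutoff windowFun) ξ‖ ≤
      ‖(2 * Real.pi * Complex.I * ξ) ^ 3 * 𝓕 (cutoff windowFun) ξ‖ := by
    rw [norm_mul, norm_pow]
    gcongr
    rw [norm_mul, norm_mul, Complex.norm_I, Complex.norm_real, Real.norm_eq_abs]
    have : ‖(2 * Real.pi : ℂ)‖ = 2 * Real.pi := by
      rw [norm_mul, Complex.norm_real, Real.norm_of_nonneg Real.pi_pos.le]; norm_num
    rw [this]
    nlinarith [Real.pi_gt_three, abs_nonneg ξ]
  refine h4.trans ?_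
  rw [h3]
  refine (norm_sub_le _ _).trans (add_le_add (norm_fourier_le _ _) ((norm_sub_le _ _).trans ?_))
  rw [norm_mul, norm_mul, norm_unitExp, norm_unitExp, one_mul, one_mul]

/-- The modulated window `e^{πix} (1 + cos πx) / 2`. -/
def modWindowFun (x : ℝ) : ℂ := unitExp (x / 2) * windowFun x

@[fun_prop] theorem continuous_modWindowFun : Continuous modWindowFun := by
  unfold modWindowFun; fun_prop

theorem fourier_cutoff_modWindowFun (ξ : ℝ) :
    𝓕 (cutoff modWindowFun) ξ = 𝓕 (cutoff windowFun) (ξ - 1 / 2) := by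
  rw [fourier_eq_integral_unitExp, fourier_eq_integral_unitExp]
  refine integral_congr_ae (Filter.Eventually.of_forall fun x => ?_)
  have h1 : cutoff modWindowFun x = unitExp (x / 2) * cutoff windowFun x := by
    by_cases hx : x ∈ Set.Ioc (-1 : ℝ) 1
    · simp only [cutoff, Set.indicator_of_mem hx, modWindowFun]
    · simp only [cutoff_of_notMem hx, mul_zero]
  simp only [h1, ← mul_assoc, ← unitExp_add]
  congr 2; ring

theorem hasCubicDecay_fourier_cutoff_modWindowFun : HasCubicDecay (𝓕 (cutoff modWindowFun)) := by
  have h := hasCubicDecay_fourier_cutoff_windowFun.comp_sub (a := 1 / 2)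
    (by rw [abs_of_pos] <;> norm_num)
  have e : 𝓕 (cutoff modWindowFun) = fun ξ => 𝓕 (cutoff windowFun) (ξ - 1 / 2) :=
    funext fourier_cutoff_modWindowFun
  rwa [e]

theorem inner_gaborShift_eq {ψ : Lp ℂ 2 (volume : Measure ℝ)} {φ : ℝ → ℂ} (h : ψ =ᵐ[volume] φ)
    (k : ℤ × ℤ) (g : Lp ℂ 2 (volume : Measure ℝ)) : inner ℂ (gaborShift k ψ) g =
      ∫ x : ℝ, unitExp (-(k.1 * x)) * ((starRingEnd ℂ) (φ (x - k.2)) * g x) := by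
  rw [L2.inner_def]
  refine integral_congr_ae ?_
  filter_upwards [gaborShift_coeFn h k] with x hx
  rw [hx, RCLike.inner_apply, map_mul, conj_unitExp]
  ring

theorem integrable_of_weightedIntegral {h : Lp ℂ 2 (volume : Measure ℝ)} {s t : ℝ} (h0 : 0 ≤ s)
    (hst : s ≤ t) (hw : weightedIntegral t h ≠ ∞) :
    Integrable fun x => (1 + |x|) ^ s * ‖h x‖ ^ 2 := by
  have ht : 0 ≤ t := h0.trans hst
  have hm := (Lp.memLp h).1
  have h1 : Integrable fun x => |x| ^ t * ‖h x‖ ^ 2 := by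
    refine ⟨(Continuous.aestronglyMeasurable ((continuous_abs).rpow_const fun x => Or.inr ht)).mul
      (hm.norm.pow 2), ?_⟩
    rw [hasFiniteIntegral_iff_ofReal (Filter.Eventually.of_forall fun x => by positivity)]
    exact hw.lt_top
  refine (((integrable_norm_sq h).add h1).const_mul (2 ^ t)).mono'
    ((Continuous.aestronglyMeasurable (Continuous.rpow_const (by fun_prop)
      fun x => Or.inr h0)).mul (hm.norm.pow 2)) (Filter.Eventually.of_forall fun x => ?_)
  rw [Real.norm_of_nonneg (by positivity)]
  have e1 : (1 + |x|) ^ s ≤ (1 + |x|) ^ t :=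
    Real.rpow_le_rpow_of_exponent_le (by linarith [abs_nonneg x]) hst
  have e2 : (1 + |x|) ^ t ≤ 2 ^ t * (1 + |x| ^ t) := by
    rcases le_total |x| 1 with hx | hx
    · calc (1 + |x|) ^ t ≤ 2 ^ t := Real.rpow_le_rpow (by positivity) (by linarith) ht
        _ ≤ 2 ^ t * (1 + |x| ^ t) := le_mul_of_one_le_right (by positivity)
            (by linarith [Real.rpow_nonneg (abs_nonneg x) t])
    · calc (1 + |x|) ^ t ≤ (2 * |x|) ^ t := Real.rpow_le_rpow (by positivity) (by linarith) ht
        _ = 2 ^ t * |x| ^ t := Real.mul_rpow (by norm_num) (abs_nonneg x)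
        _ ≤ _ := by gcongr; linarith
  calc (1 + |x|) ^ s * ‖h x‖ ^ 2 ≤ 2 ^ t * (1 + |x| ^ t) * ‖h x‖ ^ 2 := by
        gcongr; exact e1.trans e2
    _ = _ := by simp only [Pi.add_apply]; ring

/-- The weight `1 + |m| + |n|` on `ℤ²`. -/
def latticeWeight (k : ℤ × ℤ) : ℝ := 1 + |(k.1 : ℝ)| + |(k.2 : ℝ)|

theorem one_le_latticeWeight (k : ℤ × ℤ) : 1 ≤ latticeWeight k := by
  have := abs_nonneg (k.1 : ℝ)
  have := abs_nonneg (k.2 : ℝ)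
  unfold latticeWeight; linarith

theorem latticeWeight_rpow_le {t : ℝ} (h0 : 0 ≤ t) (k : ℤ × ℤ) :
    latticeWeight k ^ t ≤ 2 ^ t * ((1 + |(k.1 : ℝ)|) ^ t + (1 + |(k.2 : ℝ)|) ^ t) := by
  have h1 := abs_nonneg (k.1 : ℝ)
  have h2 := abs_nonneg (k.2 : ℝ)
  have p1 : 0 ≤ (1 + |(k.1 : ℝ)|) ^ t := by positivity
  have p2 : 0 ≤ (1 + |(k.2 : ℝ)|) ^ t := by positivity
  have hw : 0 ≤ latticeWeight k := zero_le_one.trans (one_le_latticeWeight k)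
  rcases le_total |(k.1 : ℝ)| |(k.2 : ℝ)| with h | h
  · calc latticeWeight k ^ t ≤ (2 * (1 + |(k.2 : ℝ)|)) ^ t :=
          Real.rpow_le_rpow hw (by unfold latticeWeight; linarith) h0
      _ = 2 ^ t * (1 + |(k.2 : ℝ)|) ^ t := Real.mul_rpow (by norm_num) (by positivity)
      _ ≤ _ := by gcongr; linarith
  · calc latticeWeight k ^ t ≤ (2 * (1 + |(k.1 : ℝ)|)) ^ t :=
          Real.rpow_le_rpow hw (by unfold latticeWeight; linarith) h0
      _ = 2 ^ t * (1 + |(k.1 : ℝ)|) ^ t := Real.mul_rpow (by norm_num) (by positivity)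
      _ ≤ _ := by gcongr; linarith

/-- Localization of `g` controls the weight in the translation index n, and localization of its
Fourier transform controls the weight in the modulation index m, since the Fourier transform
exchanges the two. -/
theorem summable_latticeWeight_mul {v : ℝ → ℂ} (hv : Continuous v)
    (hd : HasCubicDecay (𝓕 (cutoff v))) {t : ℝ} (h0 : 0 ≤ t) (h4 : t < 4)
    {g : Lp ℂ 2 (volume : Measure ℝ)} (h1 : Integrable fun x => (1 + |x|) ^ t * ‖g x‖ ^ 2)
    (h2 : Integrable fun x => (1 + |x|) ^ t *
      ‖(𝓕 g : Lp ℂ 2 (volume : Measure ℝ)) x‖ ^ 2) :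
    Summable fun k => latticeWeight k ^ t * ‖inner ℂ (gaborShift k (cutoffLp v hv)) g‖ ^ 2 := by
  obtain ⟨B₁, hB₁⟩ := (hasCubicDecay_cutoff hv).exists_sum_weight_le h0 h4 g h1
  obtain ⟨B₂, hB₂⟩ := hd.exists_sum_weight_le h0 h4 (𝓕 g) h2
  set c : ℤ × ℤ → ℂ := fun k => inner ℂ (gaborShift k (cutoffLp v hv)) g with hc
  have hc1 : ∀ m n : ℤ, c (m, n) = ∫ x : ℝ, unitExp (-(m * x)) *
      ((starRingEnd ℂ) (cutoff v (x - n)) * g x) := fun m n =>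
    inner_gaborShift_eq (memLp_cutoff hv).coeFn_toLp (m, n) g
  have hc2 : ∀ m n : ℤ, c (m, n) = ∫ x : ℝ, unitExp (-(((-n : ℤ) : ℝ) * x)) *
      ((starRingEnd ℂ) (𝓕 (cutoff v) (x - m)) *
        (𝓕 g : Lp ℂ 2 (volume : Measure ℝ)) x) := fun m n => by
    rw [← inner_gaborShift_eq (fourier_toLp_ae_eq (integrable_cutoff hv) (memLp_cutoff hv)) (-n, m),
      ← fourier_gaborShift]
    exact ((Lp.fourierTransformₗᵢ ℝ ℂ).inner_map_map _ _).symm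
  refine summable_of_sum_le (c := 2 ^ t * (B₁ + B₂)) (fun k => ?_) fun S => ?_
  · have := one_le_latticeWeight k
    positivity
  · classical
    set M := S.image Prod.fst
    set N := S.image Prod.snd
    have hS : S ⊆ M ×ˢ N := fun k hk => Finset.mem_product.2
      ⟨Finset.mem_image_of_mem _ hk, Finset.mem_image_of_mem _ hk⟩
    calc ∑ k ∈ S, latticeWeight k ^ t * ‖c k‖ ^ 2
        ≤ ∑ k ∈ M ×ˢ N, 2 ^ t * ((1 + |(k.1 : ℝ)|) ^ t + (1 + |(k.2 : ℝ)|) ^ t) * ‖c k‖ ^ 2 := by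
          refine (Finset.sum_le_sum fun k _ => mul_le_mul_of_nonneg_right
            (latticeWeight_rpow_le h0 k) (sq_nonneg _)).trans
            (Finset.sum_le_sum_of_subset_of_nonneg hS fun k _ _ => by positivity)
      _ = 2 ^ t * (∑ n ∈ N, ∑ m ∈ M, (1 + |(n : ℝ)|) ^ t * ‖c (m, n)‖ ^ 2 +
            ∑ m ∈ M, ∑ n ∈ N, (1 + |(m : ℝ)|) ^ t * ‖c (m, n)‖ ^ 2) := by
          rw [Finset.sum_comm (s := N), ← Finset.sum_add_distrib, Finset.sum_product,
            Finset.mul_sum]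
          refine Finset.sum_congr rfl fun m _ => ?_
          rw [← Finset.sum_add_distrib, Finset.mul_sum]
          exact Finset.sum_congr rfl fun n _ => by ring
      _ ≤ 2 ^ t * (B₁ + B₂) := by
          have e1 := hB₁ M N
          -- The Fourier transform takes the shift (m, n) to (-n, m), so the index set is reflected.
          have e2 := hB₂ (N.map (Equiv.neg ℤ).toEmbedding) M
          simp only [← hc1] at e1
          simp only [Finset.sum_map, Equiv.coe_toEmbedding, Equiv.neg_apply, ← hc2] at e2
          gcongr

/-! ### Sums over the lattice -/

theorem rpow_neg_le_sub_div {α : ℝ} (h0 : 0 < α) (h1 : α < 1) (n : ℕ) :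
    ((n : ℝ) + 1) ^ (-α) ≤ (((n : ℝ) + 1) ^ (1 - α) - (n : ℝ) ^ (1 - α)) / (1 - α) := by
  set y : ℝ := (n : ℝ) + 1 with hy
  have hy0 : 0 < y := by positivity
  have hy1 : 1 ≤ y := by rw [hy]; linarith [(Nat.cast_nonneg n : (0 : ℝ) ≤ n)]
  have hb := rpow_one_add_le_one_add_mul_self (s := -(1 / y)) (p := 1 - α)
    (by rw [neg_le_neg_iff, div_le_one hy0]; exact hy1) (by linarith) (by linarith)
  have hn : (n : ℝ) = y * (1 + -(1 / y)) := by field_simp; rw [hy]; ring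
  have h2 : 0 ≤ 1 + -(1 / y) := by
    have : 1 / y ≤ 1 := by rw [div_le_one hy0]; exact hy1
    linarith
  rw [le_div_iff₀ (by linarith)]
  conv_rhs => rw [hn, Real.mul_rpow hy0.le h2]
  have h3 : y ^ (1 - α) = y * y ^ (-α) := by
    rw [sub_eq_add_neg, Real.rpow_add hy0, Real.rpow_one]
  have h4 := mul_le_mul_of_nonneg_left hb (Real.rpow_nonneg hy0.le (1 - α))
  have h5 : y ^ (1 - α) * (1 + (1 - α) * -(1 / y)) = y ^ (1 - α) - (1 - α) * y ^ (-α) := by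
    rw [h3]; field_simp; ring
  rw [h5] at h4
  linarith

theorem rpow_neg_one_sub_le_sub_div {p : ℝ} (hp : 0 < p) {n : ℕ} (hn : 1 ≤ n) :
    ((n : ℝ) + 1) ^ (-1 - p) ≤ ((n : ℝ) ^ (-p) - ((n : ℝ) + 1) ^ (-p)) / p := by
  set y : ℝ := (n : ℝ) + 1 with hy
  have hn1 : (1 : ℝ) ≤ n := by exact_mod_cast hn
  have hy0 : 0 < y := by positivity
  have hs : 0 < 1 + -(1 / y) := by
    have : 1 / y < 1 := by rw [div_lt_one hy0, hy]; linarith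
    linarith
  have hny : (n : ℝ) = y * (1 + -(1 / y)) := by field_simp; rw [hy]; ring
  have hb : 1 + p * (1 / y) ≤ (1 + -(1 / y)) ^ (-p) := by
    rw [Real.rpow_def_of_pos hs]
    have h1 := Real.log_le_sub_one_of_pos hs
    have h2 := Real.add_one_le_exp (Real.log (1 + -(1 / y)) * -p)
    nlinarith
  rw [le_div_iff₀ hp]
  conv_rhs => rw [hny, Real.mul_rpow hy0.le hs.le]
  have h3 : y ^ (-1 - p) = y ^ (-p) * (1 / y) := by
    rw [sub_eq_add_neg, add_comm, Real.rpow_add hy0, Real.rpow_neg_one, one_div]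
  have h4 := mul_le_mul_of_nonneg_left hb (Real.rpow_nonneg hy0.le (-p))
  rw [h3]
  linarith

/-- The sum of n^{1-2α} up to N and N² times the sum of n^{-1-2α} beyond N both have size N^{2-2α}.
The telescoping sequences `a` and `b` majorize the two ranges, each being constant on the range of
the other. Writing n^{1-2α} as n^{1-α}·n^{-α} avoids distinguishing the sign of 1 - 2α. -/
theorem sum_range_min_sq_le {α : ℝ} (h0 : 0 < α) (h1 : α < 1) {N : ℕ} (hN : 1 ≤ N) (M : ℕ) :
    ∑ n ∈ Finset.range M, ((n : ℝ) + 1) * (min (N : ℝ) (n + 1) ^ 2 * ((n : ℝ) + 1) ^ (-(2 + 2 * α)))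
      ≤ (1 / (1 - α) + 1 / (2 * α)) * (N : ℝ) ^ (2 - 2 * α) := by
  have hN0 : (0 : ℝ) < N := by exact_mod_cast hN
  set a : ℕ → ℝ := fun n => (N : ℝ) ^ (1 - α) / (1 - α) * ((min n N : ℕ) : ℝ) ^ (1 - α) with ha
  set b : ℕ → ℝ := fun n => (N : ℝ) ^ 2 / (2 * α) * -((max n N : ℕ) : ℝ) ^ (-(2 * α)) with hb
  have h1α : 0 < 1 - α := by linarith
  have hterm : ∀ n ∈ Finset.range M,
      ((n : ℝ) + 1) * (min (N : ℝ) (n + 1) ^ 2 * ((n : ℝ) + 1) ^ (-(2 + 2 * α))) ≤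
        (a (n + 1) - a n) + (b (n + 1) - b n) := by
    intro n _
    have hp : (0 : ℝ) < n + 1 := by positivity
    rcases Nat.lt_or_ge n N with h | h
    · have hle : ((n : ℝ) + 1) ≤ N := by exact_mod_cast h
      have e1 : b (n + 1) - b n = 0 := by
        simp only [hb]; rw [max_eq_right h, max_eq_right h.le, sub_self]
      rw [e1, add_zero, min_eq_right hle]
      simp only [ha]
      rw [min_eq_left (show n + 1 ≤ N from h), min_eq_left h.le, ← mul_sub]
      have e2 : ((n : ℝ) + 1) * (((n : ℝ) + 1) ^ 2 * ((n : ℝ) + 1) ^ (-(2 + 2 * α))) =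
          ((n : ℝ) + 1) ^ (1 - α) * ((n : ℝ) + 1) ^ (-α) := by
        rw [← mul_assoc, ← pow_succ', ← Real.rpow_natCast, ← Real.rpow_add hp, ← Real.rpow_add hp]
        congr 1; push_cast; ring
      rw [e2]
      have e3 := rpow_neg_le_sub_div h0 h1 n
      calc _ ≤ (N : ℝ) ^ (1 - α) * ((((n : ℝ) + 1) ^ (1 - α) - (n : ℝ) ^ (1 - α)) / (1 - α)) :=
            mul_le_mul (Real.rpow_le_rpow hp.le hle h1α.le) e3 (by positivity) (by positivity)
        _ = _ := by push_cast; ring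
    · have hle : (N : ℝ) ≤ (n : ℝ) + 1 := by
        have : (N : ℝ) ≤ n := by exact_mod_cast h
        linarith
      have e1 : a (n + 1) - a n = 0 := by
        simp only [ha]; rw [min_eq_right h, min_eq_right (by omega), sub_self]
      rw [e1, zero_add, min_eq_left hle]
      simp only [hb]
      rw [max_eq_left h, max_eq_left (by omega : N ≤ n + 1), ← mul_sub]
      have e2 : ((n : ℝ) + 1) * ((N : ℝ) ^ 2 * ((n : ℝ) + 1) ^ (-(2 + 2 * α))) =
          (N : ℝ) ^ 2 * ((n : ℝ) + 1) ^ (-1 - 2 * α) := by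
        have : ((n : ℝ) + 1) ^ (-1 - 2 * α) = ((n : ℝ) + 1) * ((n : ℝ) + 1) ^ (-(2 + 2 * α)) := by
          rw [mul_comm ((n : ℝ) + 1) (_ ^ _), ← Real.rpow_add_one hp.ne']; congr 1; ring
        rw [this]; ring
      rw [e2]
      have e3 := rpow_neg_one_sub_le_sub_div (p := 2 * α) (by linarith) (hN.trans h)
      calc _ ≤ (N : ℝ) ^ 2 * (((n : ℝ) ^ (-(2 * α)) - ((n : ℝ) + 1) ^ (-(2 * α))) / (2 * α)) := by
            gcongr
        _ = _ := by push_cast; ring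
  refine (Finset.sum_le_sum hterm).trans ?_
  rw [Finset.sum_add_distrib, Finset.sum_range_sub, Finset.sum_range_sub]
  have e1 : a M ≤ (N : ℝ) ^ (1 - α) / (1 - α) * (N : ℝ) ^ (1 - α) := by
    simp only [ha]
    refine mul_le_mul_of_nonneg_left (Real.rpow_le_rpow (Nat.cast_nonneg _) ?_ h1α.le)
      (by positivity)
    exact_mod_cast min_le_right _ _
  have e2 : 0 ≤ a 0 := by simp only [ha]; positivity
  have e3 : b M ≤ 0 := by
    simp only [hb]
    exact mul_nonpos_of_nonneg_of_nonpos (by positivity) (neg_nonpos.2 (by positivity))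
  have e4 : b 0 = -((N : ℝ) ^ 2 / (2 * α) * (N : ℝ) ^ (-(2 * α))) := by
    simp only [hb, Nat.zero_max]; ring
  have e5 : (N : ℝ) ^ (1 - α) * (N : ℝ) ^ (1 - α) = (N : ℝ) ^ (2 - 2 * α) := by
    rw [← Real.rpow_add hN0]; congr 1; ring
  have e6 : (N : ℝ) ^ 2 * (N : ℝ) ^ (-(2 * α)) = (N : ℝ) ^ (2 - 2 * α) := by
    rw [← Real.rpow_natCast, ← Real.rpow_add hN0]; congr 1
  rw [e4]
  calc _ ≤ (N : ℝ) ^ (1 - α) / (1 - α) * (N : ℝ) ^ (1 - α) +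
        (N : ℝ) ^ 2 / (2 * α) * (N : ℝ) ^ (-(2 * α)) := by linarith
    _ = 1 / (1 - α) * ((N : ℝ) ^ (1 - α) * (N : ℝ) ^ (1 - α)) +
        1 / (2 * α) * ((N : ℝ) ^ 2 * (N : ℝ) ^ (-(2 * α))) := by ring
    _ = _ := by rw [e5, e6]; ring

/-- The lattice is cut into square shells with max(|m|, |n|) = n. A shell has at most 8(n+1) points,
and the weight on it is n + 1 up to a factor 2. -/
theorem exists_sum_latticeWeight_le {α : ℝ} (h0 : 0 < α) (h1 : α < 1) :
    ∃ D, 0 < D ∧ ∀ N : ℕ, 1 ≤ N → ∀ S : Finset (ℤ × ℤ),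
      ∑ k ∈ S, min (N : ℝ) (latticeWeight k) ^ 2 * latticeWeight k ^ (-(2 + 2 * α)) ≤
        D * (N : ℝ) ^ (2 - 2 * α) := by
  classical
  have h1α : 0 < 1 - α := by linarith
  refine ⟨32 * (1 / (1 - α) + 1 / (2 * α)), by positivity, fun N hN S => ?_⟩
  set ρ : ℤ × ℤ → ℕ := fun k => max k.1.natAbs k.2.natAbs with hρ
  have hN0 : (0 : ℝ) < N := by exact_mod_cast hN
  obtain ⟨M, hM⟩ : ∃ M : ℕ, ∀ k ∈ S, ρ k ∈ Finset.range M := by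
    refine ⟨S.sup ρ + 1, fun k hk => Finset.mem_range.2 ?_⟩
    have := Finset.le_sup (f := ρ) hk
    omega
  rw [← Finset.sum_fiberwise_of_maps_to hM]
  have hfib : ∀ n ∈ Finset.range M, ∑ k ∈ S with ρ k = n,
      min (N : ℝ) (latticeWeight k) ^ 2 * latticeWeight k ^ (-(2 + 2 * α)) ≤
      32 * (((n : ℝ) + 1) * (min (N : ℝ) (n + 1) ^ 2 * ((n : ℝ) + 1) ^ (-(2 + 2 * α)))) := by
    intro n _
    have hcard : ((S.filter fun k => ρ k = n).card : ℝ) ≤ 8 * ((n : ℝ) + 1) := by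
      have hsub : (S.filter fun k => ρ k = n) ⊆ Finset.box n := fun k hk =>
        Int.mem_box.2 (Finset.mem_filter.1 hk).2
      have h2 : (Finset.box n : Finset (ℤ × ℤ)).card ≤ 8 * (n + 1) := by
        rcases Nat.eq_zero_or_pos n with rfl | hn
        · simp
        · rw [Int.card_box hn.ne']; omega
      exact_mod_cast (Finset.card_le_card hsub).trans h2
    have hp : (0 : ℝ) < n + 1 := by positivity
    have hbd : ∀ k ∈ S.filter fun k => ρ k = n,
        min (N : ℝ) (latticeWeight k) ^ 2 * latticeWeight k ^ (-(2 + 2 * α)) ≤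
        4 * (min (N : ℝ) (n + 1) ^ 2 * ((n : ℝ) + 1) ^ (-(2 + 2 * α))) := by
      intro k hk
      have hk' : max k.1.natAbs k.2.natAbs = n := (Finset.mem_filter.1 hk).2
      have a1 : |(k.1 : ℝ)| = k.1.natAbs := by rw [Nat.cast_natAbs, Int.cast_abs]
      have a2 : |(k.2 : ℝ)| = k.2.natAbs := by rw [Nat.cast_natAbs, Int.cast_abs]
      have l1 : (n : ℝ) + 1 ≤ latticeWeight k := by
        rw [latticeWeight, a1, a2]
        have : n + 1 ≤ 1 + k.1.natAbs + k.2.natAbs := by omega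
        exact_mod_cast this
      have l2 : latticeWeight k ≤ 2 * ((n : ℝ) + 1) := by
        rw [latticeWeight, a1, a2]
        have : 1 + k.1.natAbs + k.2.natAbs ≤ 2 * (n + 1) := by omega
        exact_mod_cast this
      have l3 : min (N : ℝ) (latticeWeight k) ≤ 2 * min (N : ℝ) (n + 1) := by
        rcases le_total (N : ℝ) (n + 1) with h | h
        · rw [min_eq_left h]; exact (min_le_left _ _).trans (by linarith)
        · rw [min_eq_right h]; exact (min_le_right _ _).trans l2
      have l4 : 0 ≤ min (N : ℝ) (latticeWeight k) := le_min hN0.le (hp.le.trans l1)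
      calc _ ≤ (2 * min (N : ℝ) (n + 1)) ^ 2 * ((n : ℝ) + 1) ^ (-(2 + 2 * α)) :=
            mul_le_mul (pow_le_pow_left₀ l4 l3 2)
              (Real.rpow_le_rpow_of_nonpos hp l1 (by linarith))
              (Real.rpow_nonneg (hp.le.trans l1) _) (sq_nonneg _)
        _ = _ := by ring
    have hnn : 0 ≤ 4 * (min (N : ℝ) (n + 1) ^ 2 * ((n : ℝ) + 1) ^ (-(2 + 2 * α))) := by positivity
    refine (Finset.sum_le_card_nsmul _ _ _ hbd).trans ?_
    rw [nsmul_eq_mul]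
    refine (mul_le_mul_of_nonneg_right hcard hnn).trans (le_of_eq ?_)
    ring
  refine (Finset.sum_le_sum hfib).trans ?_
  rw [← Finset.mul_sum, mul_assoc]
  exact mul_le_mul_of_nonneg_left (sum_range_min_sq_le h0 h1 hN M) (by norm_num)

theorem mul_le_weighted_sq {c μ w l : ℝ} (hw : 0 < w) (hl : 0 < l) :
    c * μ ≤ 1 / 2 * (l * (w * c ^ 2) + l⁻¹ * (μ ^ 2 * w⁻¹)) := by
  have : l * (w * c ^ 2) + l⁻¹ * (μ ^ 2 * w⁻¹) - 2 * (c * μ) = (l * w * c - μ) ^ 2 / (l * w) := by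
    field_simp; ring
  have : 0 ≤ (l * w * c - μ) ^ 2 / (l * w) := by positivity
  linarith

theorem summable_of_summable_latticeWeight {α : ℝ} (h0 : 0 < α) (h1 : α < 1) {c : ℤ × ℤ → ℝ}
    (hc0 : ∀ k, 0 ≤ c k) (hc : Summable fun k => latticeWeight k ^ (2 + 2 * α) * c k ^ 2) :
    Summable c := by
  obtain ⟨D, hD, hDb⟩ := exists_sum_latticeWeight_le h0 h1
  have hw : ∀ k, 0 < latticeWeight k := fun k => zero_lt_one.trans_le (one_le_latticeWeight k)
  have hs : Summable fun k => (1 : ℝ) ^ 2 * (latticeWeight k ^ (2 + 2 * α))⁻¹ := by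
    refine summable_of_sum_le (c := D) (fun k => by have := hw k; positivity) fun S => ?_
    -- At N = 1 the minimum is always 1, so the lattice bound becomes summability of the inverse
    -- weight.
    refine le_trans (le_of_eq (Finset.sum_congr rfl fun k _ => ?_)) ((hDb 1 le_rfl S).trans
      (by simp))
    rw [Real.rpow_neg (hw k).le, Nat.cast_one, min_eq_left (one_le_latticeWeight k)]
  refine Summable.of_nonneg_of_le hc0 (fun k => ?_) ((hc.mul_left 1).add (hs.mul_left 1⁻¹)
    |>.mul_left (1 / 2))
  have := mul_le_weighted_sq (c := c k) (μ := 1) (Real.rpow_pos_of_pos (hw k) (2 + 2 * α))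
    one_pos
  rwa [mul_one] at this

/-- Plain Cauchy-Schwarz gives O(N^{1-α}). To get an arbitrarily small constant, a finite set `K`
carries all but a little of the weighted series; its contribution is bounded in N, hence negligible
against N^{1-α}. -/
theorem exists_sum_mul_min_latticeWeight_le {α : ℝ} (h0 : 0 < α) (h1 : α < 1) {c : ℤ × ℤ → ℝ}
    (hc0 : ∀ k, 0 ≤ c k) (hc : Summable fun k => latticeWeight k ^ (2 + 2 * α) * c k ^ 2)
    {ε : ℝ} (hε : 0 < ε) :
    ∃ N₀ : ℕ, ∀ N : ℕ, N₀ ≤ N → 1 ≤ N → ∀ S : Finset (ℤ × ℤ),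
      ∑ k ∈ S, c k * min (N : ℝ) (latticeWeight k) ≤ ε * (N : ℝ) ^ (1 - α) := by
  classical
  obtain ⟨D, hD, hDb⟩ := exists_sum_latticeWeight_le h0 h1
  have hw : ∀ k, 0 < latticeWeight k := fun k => zero_lt_one.trans_le (one_le_latticeWeight k)
  obtain ⟨K, hK⟩ := summable_iff_vanishing_norm.1 hc (ε ^ 2 / (4 * D)) (by positivity)
  have hlim : Filter.Tendsto (fun N : ℕ => ε / 2 * (N : ℝ) ^ (1 - α)) Filter.atTop Filter.atTop :=
    ((tendsto_rpow_atTop (by linarith : 0 < 1 - α)).comp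
      tendsto_natCast_atTop_atTop).const_mul_atTop (by positivity)
  obtain ⟨N₀, hN₀⟩ := Filter.eventually_atTop.1
    (hlim.eventually_ge_atTop (∑ k ∈ K, c k * latticeWeight k))
  refine ⟨N₀, fun N hN hN1 S => ?_⟩
  have hN0 : (0 : ℝ) < N := by exact_mod_cast hN1
  have hp : 0 < (N : ℝ) ^ (1 - α) := Real.rpow_pos_of_pos hN0 _
  have hmin : ∀ k, 0 ≤ min (N : ℝ) (latticeWeight k) := fun k => le_min hN0.le (hw k).le
  rw [← Finset.sum_inter_add_sum_sdiff S K]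
  have e1 : ∑ k ∈ S ∩ K, c k * min (N : ℝ) (latticeWeight k) ≤ ε / 2 * (N : ℝ) ^ (1 - α) := by
    refine le_trans ?_ (hN₀ N hN)
    refine (Finset.sum_le_sum fun k _ => mul_le_mul_of_nonneg_left (min_le_right _ _)
      (hc0 k)).trans (Finset.sum_le_sum_of_subset_of_nonneg Finset.inter_subset_right
        fun k _ _ => mul_nonneg (hc0 k) (hw k).le)
  -- The balancing parameter of AM-GM: both halves become equal to half of ε/2·N^{1-α}.
  set l := 2 * D / ε * (N : ℝ) ^ (1 - α) with hl
  have hl0 : 0 < l := by positivity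
  have e2 : ∑ k ∈ S \ K, c k * min (N : ℝ) (latticeWeight k) ≤ ε / 2 * (N : ℝ) ^ (1 - α) := by
    have t1 : ∑ k ∈ S \ K, latticeWeight k ^ (2 + 2 * α) * c k ^ 2 ≤ ε ^ 2 / (4 * D) :=
      (Real.le_norm_self _).trans (hK _ Finset.sdiff_disjoint).le
    have t2 := hDb N hN1 (S \ K)
    have t3 : (N : ℝ) ^ (2 - 2 * α) = (N : ℝ) ^ (1 - α) * (N : ℝ) ^ (1 - α) := by
      rw [← Real.rpow_add hN0]; congr 1; ring
    calc _ ≤ ∑ k ∈ S \ K, 1 / 2 * (l * (latticeWeight k ^ (2 + 2 * α) * c k ^ 2) +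
          l⁻¹ * (min (N : ℝ) (latticeWeight k) ^ 2 * latticeWeight k ^ (-(2 + 2 * α)))) := by
          refine Finset.sum_le_sum fun k _ => ?_
          rw [Real.rpow_neg (hw k).le]
          exact mul_le_weighted_sq (Real.rpow_pos_of_pos (hw k) _) hl0
      _ = 1 / 2 * (l * ∑ k ∈ S \ K, latticeWeight k ^ (2 + 2 * α) * c k ^ 2 + l⁻¹ *
          ∑ k ∈ S \ K, min (N : ℝ) (latticeWeight k) ^ 2 * latticeWeight k ^ (-(2 + 2 * α))) := by
          rw [← Finset.mul_sum, Finset.sum_add_distrib, Finset.mul_sum, Finset.mul_sum]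
      _ ≤ 1 / 2 * (l * (ε ^ 2 / (4 * D)) + l⁻¹ * (D * (N : ℝ) ^ (2 - 2 * α))) := by
          gcongr
      _ = ε / 2 * (N : ℝ) ^ (1 - α) := by
          rw [t3, hl]; field_simp; ring
  linarith

/-! ### Obstruction: the common zero, concentrated polynomials and the contradiction. -/

/-! ### Common zeros of window correlations -/

/-- The Zak transform of the modulated window. -/
def zakModWindow (z : ℝ × ℝ) : ℂ := modWindowFun z.1 + modWindowFun (z.1 - 1) * unitExp (-z.2)

@[fun_prop] theorem continuous_zakModWindow : Continuous zakModWindow := by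
  unfold zakModWindow; fun_prop

theorem unitExp_neg_half : unitExp (-(1 / 2)) = -1 := by
  rw [unitExp_eq]
  have : ((2 * Real.pi * -(1 / 2) : ℝ) : ℂ) * Complex.I = -(Real.pi * Complex.I) := by
    push_cast; ring
  rw [this, Complex.exp_neg, Complex.exp_pi_mul_I]
  norm_num

theorem zakModWindow_eq (z : ℝ × ℝ) :
    zakModWindow z = unitExp (z.1 / 2) * (windowFun z.1 - windowFun (z.1 - 1) * unitExp (-z.2)) := by
  have : (z.1 - 1) / 2 = z.1 / 2 + -(1 / 2) := by ring
  simp only [zakModWindow, modWindowFun, this, unitExp_add, unitExp_neg_half]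
  ring

/-- The half-integer modulation flips the sign of the second term of the Zak transform, so the
parallelogram law makes the cross terms cancel. The two windows therefore have no common zero. -/
theorem norm_sq_zakWindow_add (z : ℝ × ℝ) :
    ‖zakWindow z‖ ^ 2 + ‖zakModWindow z‖ ^ 2 = 1 + Real.cos (Real.pi * z.1) ^ 2 := by
  have h := parallelogram_law_with_norm ℂ (windowFun z.1) (windowFun (z.1 - 1) * unitExp (-z.2))
  have hc : Real.cos (Real.pi * (z.1 - 1)) = -Real.cos (Real.pi * z.1) := by
    rw [mul_sub, mul_one, Real.cos_sub_pi]
  rw [zakModWindow_eq, norm_mul, norm_unitExp, one_mul, zakWindow, h, norm_mul, norm_unitExp,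
    mul_one, windowFun, windowFun, Complex.norm_real, Complex.norm_real, Real.norm_eq_abs,
    Real.norm_eq_abs, sq_abs, sq_abs, hc]
  ring

theorem eq_zero_of_ae_unitSq {f : ℝ × ℝ → ℂ} (hf : Continuous f) (h : ∀ᵐ z ∂unitSq, f z = 0)
    {z : ℝ × ℝ} (hz : z ∈ Set.Icc (0 : ℝ) 1 ×ˢ Set.Icc (0 : ℝ) 1) : f z = 0 := by
  have hμ : unitSq = (volume : Measure (ℝ × ℝ)).restrict
      (Set.Ioc (0 : ℝ) 1 ×ˢ Set.Ioc (0 : ℝ) 1) := by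
    rw [unitSq, Measure.prod_restrict]; rfl
  rw [hμ] at h
  have h1 := Measure.eqOn_of_ae_eq (g := fun _ => 0) h hf.continuousOn continuousOn_const (by
    rw [interior_prod_eq, interior_Ioc, closure_prod_eq, closure_Ioo zero_ne_one]
    exact Set.prod_mono Set.Ioc_subset_Icc_self Set.Ioc_subset_Icc_self)
  have h2 := h1.closure hf continuous_const
  rw [closure_prod_eq, closure_Ioc zero_ne_one] at h2
  exact h2 hz

theorem windowFun_values : windowFun 0 = 1 ∧ windowFun 1 = 0 ∧ windowFun (-1) = 0 := by
  refine ⟨?_, ?_, ?_⟩ <;> simp [windowFun]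

theorem exists_common_zero {H₁ H₂ G : ℝ × ℝ → ℂ} (c₁ : Continuous H₁) (c₂ : Continuous H₂)
    (p₁ : ∀ x, H₁ (x, 1) = H₁ (x, 0)) (p₂ : ∀ x, H₂ (x, 1) = H₂ (x, 0))
    (r₁ : ∀ y, H₁ (1, y) = H₁ (0, y)) (r₂ : ∀ y, H₂ (1, y) = H₂ (0, y))
    (e₁ : ∀ᵐ z ∂unitSq, H₁ z = (starRingEnd ℂ) (zakWindow z) * G z)
    (e₂ : ∀ᵐ z ∂unitSq, H₂ z = (starRingEnd ℂ) (zakModWindow z) * G z) :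
    ∃ z, H₁ z = 0 ∧ H₂ z = 0 := by
  obtain ⟨w0, w1, w2⟩ := windowFun_values
  have hu1 : unitExp (-1) = 1 := by simpa using unitExp_int (-1)
  -- Both products equal conj(Zφ)·conj(Zψ)·G almost everywhere; continuity extends the identity to
  -- the closed square, although G itself need not be continuous.
  have hE : ∀ z ∈ Set.Icc (0 : ℝ) 1 ×ˢ Set.Icc (0 : ℝ) 1,
      H₁ z * (starRingEnd ℂ) (zakModWindow z) - H₂ z * (starRingEnd ℂ) (zakWindow z) = 0 := by
    refine fun z hz => eq_zero_of_ae_unitSq (f := fun z => H₁ z * (starRingEnd ℂ) (zakModWindow z) -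
      H₂ z * (starRingEnd ℂ) (zakWindow z)) ?_ ?_ hz
    · have := Complex.continuous_conj
      exact (c₁.mul (this.comp continuous_zakModWindow)).sub
        (c₂.mul (this.comp continuous_zakWindow))
    · filter_upwards [e₁, e₂] with z h1 h2
      rw [h1, h2]; ring
  -- At this zero, `hV` and `hE` form a homogeneous linear system in H₁, H₂ whose determinant is, up
  -- to sign, 1 + cos²πx, so both values vanish.
  obtain ⟨z, hz, hV⟩ := exists_zero_of_quasiperiodic
    (V := fun z => H₁ z * zakWindow z + H₂ z * zakModWindow z) (by fun_prop)
    (fun x => by simp [p₁, p₂, zakWindow, zakModWindow, hu1])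
    (fun y => by simp [r₁, r₂, zakWindow, zakModWindow, modWindowFun, w0, w1, w2]; ring)
  have hρ : ((1 + Real.cos (Real.pi * z.1) ^ 2 : ℝ) : ℂ) ≠ 0 := by
    have : 0 < 1 + Real.cos (Real.pi * z.1) ^ 2 := by positivity
    exact_mod_cast this.ne'
  have hn : zakWindow z * (starRingEnd ℂ) (zakWindow z) +
      zakModWindow z * (starRingEnd ℂ) (zakModWindow z) =
      ((1 + Real.cos (Real.pi * z.1) ^ 2 : ℝ) : ℂ) := by
    rw [Complex.mul_conj', Complex.mul_conj', ← norm_sq_zakWindow_add]; push_cast; rfl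
  have hD := hE z hz
  refine ⟨z, ?_, ?_⟩
  · refine (mul_eq_zero.1 (?_ : ((1 + Real.cos (Real.pi * z.1) ^ 2 : ℝ) : ℂ) * H₁ z = 0)).resolve_left
      hρ
    rw [← hn]
    linear_combination (starRingEnd ℂ) (zakWindow z) * hV + zakModWindow z * hD
  · refine (mul_eq_zero.1 (?_ : ((1 + Real.cos (Real.pi * z.1) ^ 2 : ℝ) : ℂ) * H₂ z = 0)).resolve_left
      hρ
    rw [← hn]
    linear_combination (starRingEnd ℂ) (zakModWindow z) * hV - zakWindow z * hD

/-! ### Continuity of window correlations -/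

/-- The absolutely convergent double Fourier series with coefficients `c`. -/
def sqSeries (c : ℤ × ℤ → ℂ) (z : ℝ × ℝ) : ℂ := ∑' k, c k * sqChar k z

theorem summable_sqSeries {c : ℤ × ℤ → ℂ} (hc : Summable fun k => ‖c k‖) (z : ℝ × ℝ) :
    Summable fun k => c k * sqChar k z :=
  Summable.of_norm (by simpa only [norm_mul, norm_sqChar, mul_one] using hc)

theorem continuous_sqSeries {c : ℤ × ℤ → ℂ} (hc : Summable fun k => ‖c k‖) :
    Continuous (sqSeries c) :=
  continuous_tsum (fun k => by fun_prop) hc fun k z => by rw [norm_mul, norm_sqChar, mul_one]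

theorem sqSeries_add_int (c : ℤ × ℤ → ℂ) (z : ℝ × ℝ) (m n : ℤ) :
    sqSeries c (z.1 + m, z.2 + n) = sqSeries c z := by
  unfold sqSeries
  congr 1; ext k
  congr 1
  have : (k.1 : ℝ) * (z.1 + m) + k.2 * (z.2 + n) =
      k.1 * z.1 + k.2 * z.2 + (k.1 * m + k.2 * n : ℤ) := by push_cast; ring
  simp only [sqChar, this, unitExp_add_int]

/-- The inner products are the Fourier coefficients of conj(Zv)·Zg, so their absolutely convergent
series supplies a continuous representative. -/
theorem sqSeries_ae_eq {v : ℝ → ℂ} (hv : Continuous v) (g : Lp ℂ 2 (volume : Measure ℝ))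
    (hc : Summable fun k => ‖inner ℂ (gaborShift k (cutoffLp v hv)) g‖) :
    ∀ᵐ z ∂unitSq, sqSeries (fun k => inner ℂ (gaborShift k (cutoffLp v hv)) g) z =
      (starRingEnd ℂ) (zak (cutoffLp v hv) z) * zak g z := by
  obtain ⟨B, -, hB⟩ := exists_norm_zak_cutoffLp_le hv
  have hm : MemLp (fun z => (starRingEnd ℂ) (zak (cutoffLp v hv) z) * zak g z) 2 unitSq := by
    refine (Lp.memLp (zak g)).of_le_mul (c := B) ?_ ?_
    · exact (Complex.continuous_conj.comp_aestronglyMeasurable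
        (Lp.memLp (zak (cutoffLp v hv))).1).mul (Lp.memLp (zak g)).1
    · filter_upwards [hB] with z hz
      rw [norm_mul, RCLike.norm_conj]
      gcongr
  have h1 := sqBasis.hasSum_repr (hm.toLp _)
  have h2 : ∀ k, sqBasis.repr (hm.toLp _) k = inner ℂ (gaborShift k (cutoffLp v hv)) g := fun k => by
    rw [HilbertBasis.repr_apply_apply, sqBasis_apply, inner_sqCharLp, gaborShift_apply,
      inner_gaborSystem_eq]
    refine integral_congr_ae ?_
    filter_upwards [hm.coeFn_toLp] with z hz
    rw [hz]
  simp_rw [h2] at h1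
  have h3 := ae_eq_of_hasSum h1 (v := fun k z =>
    inner ℂ (gaborShift k (cutoffLp v hv)) g * sqChar k z) (fun k => by
      filter_upwards [Lp.coeFn_smul (inner ℂ (gaborShift k (cutoffLp v hv)) g) (sqBasis k),
        (memLp_sqChar k).coeFn_toLp] with z e1 e2
      rw [e1, Pi.smul_apply, sqBasis_apply, sqCharLp, e2, smul_eq_mul])
    (Filter.Eventually.of_forall fun z => (summable_sqSeries hc z).hasSum)
  filter_upwards [h3, hm.coeFn_toLp] with z e1 e2
  rw [← e2, e1]; rfl

/-! ### Concentrated trigonometric polynomials -/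

/-- The exponential sum `∑_{k < N} e^{2πikx}`. -/
def expSum (N : ℕ) (x : ℝ) : ℂ := ∑ k ∈ Finset.range N, unitExp (k * x)

@[fun_prop] theorem continuous_expSum (N : ℕ) : Continuous (expSum N) := by
  unfold expSum; fun_prop

theorem norm_expSum_le (N : ℕ) (x : ℝ) : ‖expSum N x‖ ≤ N :=
  (norm_sum_le _ _).trans (by simp [norm_unitExp])

theorem expSum_zero (N : ℕ) : expSum N 0 = N := by simp [expSum]

theorem unitExp_nat_mul (k : ℕ) (x : ℝ) : unitExp (k * x) = unitExp x ^ k := by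
  induction k with
  | zero => simp
  | succ k ih => rw [pow_succ, ← ih, ← unitExp_add]; congr 1; push_cast; ring

theorem norm_unitExp_sub_one_mul_expSum_le (N : ℕ) (x : ℝ) :
    ‖unitExp x - 1‖ * ‖expSum N x‖ ≤ 2 := by
  have h : (unitExp x - 1) * expSum N x = unitExp x ^ N - 1 := by
    rw [mul_comm]
    simp only [expSum, unitExp_nat_mul]
    exact geom_sum_mul _ _
  rw [← norm_mul, h]
  refine (norm_sub_le _ _).trans ?_
  rw [norm_pow, norm_unitExp]; norm_num

theorem integral_norm_sq_expSum (N : ℕ) (a : ℝ) :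
    ∫ x in Set.Ioc (0 : ℝ) 1, ‖expSum N (x - a)‖ ^ 2 = N := by
  have h := integral_norm_sq_trigSum ((Finset.range N).map Nat.castEmbedding)
    (fun m => unitExp (-(m * a))) 0
  simp only [Finset.sum_map, Nat.castEmbedding_apply, norm_unitExp, Int.cast_natCast,
    Int.cast_zero, zero_add, ← unitExp_add, one_pow, Finset.sum_const, Finset.card_map,
    Finset.card_range, nsmul_eq_mul, mul_one] at h
  rw [← h]
  congr 1; ext x
  congr 3
  exact Finset.sum_congr rfl fun k _ => by congr 1; ring

theorem norm_unitExp_int_mul_sub_one_le (m : ℤ) (x : ℝ) :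
    ‖unitExp (m * x) - 1‖ ≤ |(m : ℝ)| * ‖unitExp x - 1‖ := by
  have hnat : ∀ k : ℕ, ‖unitExp (k * x) - 1‖ ≤ k * ‖unitExp x - 1‖ := fun k => by
    have h : unitExp (k * x) - 1 = expSum k x * (unitExp x - 1) := by
      simp only [expSum, unitExp_nat_mul]
      exact (geom_sum_mul _ _).symm
    rw [h, norm_mul]
    exact mul_le_mul_of_nonneg_right (norm_expSum_le k x) (norm_nonneg _)
  obtain ⟨k, rfl | rfl⟩ := m.eq_nat_or_neg
  · simpa using hnat k
  · have h : unitExp (((-(k : ℤ) : ℤ) : ℝ) * x) - 1 =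
        -(unitExp (-(k * x)) * (unitExp (k * x) - 1)) := by
      rw [mul_sub, unitExp_neg_mul]
      push_cast
      rw [neg_mul]; ring
    rw [h, norm_neg, norm_mul, norm_unitExp, one_mul]
    simpa using hnat k

theorem exists_expSum_sq_eq (N : ℕ) (a : ℝ) :
    ∃ r : ℕ → ℂ, ∀ x, expSum N (x - a) ^ 2 = ∑ m ∈ Finset.range (2 * N), r m * unitExp (m * x) := by
  classical
  refine ⟨fun m => ∑ k ∈ Finset.range N ×ˢ Finset.range N with k.1 + k.2 = m, unitExp (-(m * a)),
    fun x => ?_⟩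
  rw [sq, expSum, Finset.sum_mul_sum, ← Finset.sum_product',
    ← Finset.sum_fiberwise_of_maps_to (g := fun k : ℕ × ℕ => k.1 + k.2)
      (t := Finset.range (2 * N)) (fun k hk => by
        have := Finset.mem_product.1 hk
        simp only [Finset.mem_range] at this ⊢
        omega)]
  refine Finset.sum_congr rfl fun m _ => ?_
  rw [Finset.sum_mul]
  refine Finset.sum_congr rfl fun k hk => ?_
  rw [← (Finset.mem_filter.1 hk).2, ← unitExp_add, ← unitExp_add]
  congr 1; push_cast; ring

theorem norm_sqChar_sub_le (k : ℤ × ℤ) (z w : ℝ × ℝ) :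
    ‖sqChar k z - sqChar k w‖ ≤
      |(k.1 : ℝ)| * ‖unitExp (z.1 - w.1) - 1‖ + |(k.2 : ℝ)| * ‖unitExp (z.2 - w.2) - 1‖ := by
  have e : sqChar k z - sqChar k w = sqChar k w *
      ((unitExp (k.1 * (z.1 - w.1)) - 1) * unitExp (k.2 * (z.2 - w.2)) +
        (unitExp (k.2 * (z.2 - w.2)) - 1)) := by
    have : sqChar k z = sqChar k w * (unitExp (k.1 * (z.1 - w.1)) * unitExp (k.2 * (z.2 - w.2))) := by
      simp only [sqChar, ← unitExp_add]; congr 1; ring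
    rw [this]; ring
  rw [e, norm_mul, norm_sqChar, one_mul]
  refine (norm_add_le _ _).trans (add_le_add ?_ (norm_unitExp_int_mul_sub_one_le _ _))
  rw [norm_mul, norm_unitExp, mul_one]
  exact norm_unitExp_int_mul_sub_one_le _ _

/-- P is N^{-2} times the squares of Dirichlet-type sums in both variables, centred at w. One copy
D(x)D(ξ) absorbs the character difference, using |e^{2πix} - 1||D| ≤ 2 near w and |D| ≤ N elsewhere;
the other copy is Q, of L² norm N. The value P(w) = N² bounds the coefficient sum from below, and
degrees below 2N give at most 4N² coefficients. -/
theorem exists_concentrated_trigPoly {N : ℕ} (hN : 1 ≤ N) (w : ℝ × ℝ) :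
    ∃ (K : Finset (ℤ × ℤ)) (p : ℤ × ℤ → ℂ) (Q : ℝ × ℝ → ℝ),
      (K.card : ℝ) ≤ 4 * (N : ℝ) ^ 2 ∧ (N : ℝ) ^ 2 ≤ ∑ k ∈ K, ‖p k‖ ∧ Continuous Q ∧ (∀ z, 0 ≤ Q z) ∧
      Integrable (fun z => Q z ^ 2) unitSq ∧ ∫ z, Q z ^ 2 ∂unitSq = (N : ℝ) ^ 2 ∧
      ∀ l z, ‖sqChar l z - sqChar l w‖ * ‖∑ k ∈ K, p k * sqChar k z‖ ≤
        2 / N * min (N : ℝ) (latticeWeight l) * Q z := by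
  obtain ⟨r₁, hr₁⟩ := exists_expSum_sq_eq N w.1
  obtain ⟨r₂, hr₂⟩ := exists_expSum_sq_eq N w.2
  have hN0 : (0 : ℝ) < N := by exact_mod_cast hN
  have hNc : (N : ℂ) ≠ 0 := by exact_mod_cast hN0.ne'
  set K : Finset (ℤ × ℤ) := (Finset.range (2 * N) ×ˢ Finset.range (2 * N)).map
    (Nat.castEmbedding.prodMap Nat.castEmbedding) with hK
  set p : ℤ × ℤ → ℂ := fun k => ((N : ℂ) ^ 2)⁻¹ * (r₁ k.1.toNat * r₂ k.2.toNat) with hp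
  have hP : ∀ z, ∑ k ∈ K, p k * sqChar k z =
      ((N : ℂ) ^ 2)⁻¹ * (expSum N (z.1 - w.1) ^ 2 * expSum N (z.2 - w.2) ^ 2) := fun z => by
    rw [hr₁, hr₂, Finset.sum_mul_sum, ← Finset.sum_product', Finset.mul_sum, hK, Finset.sum_map]
    refine Finset.sum_congr rfl fun k _ => ?_
    simp only [hp, Function.Embedding.prodMap, Function.Embedding.coeFn_mk, Prod.map,
      Nat.castEmbedding_apply, Int.toNat_natCast, sqChar, Int.cast_natCast, unitExp_add]
    ring
  refine ⟨K, p, fun z => ‖expSum N (z.1 - w.1)‖ * ‖expSum N (z.2 - w.2)‖, ?_, ?_, by fun_prop,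
    fun z => by positivity, ?_, ?_, fun l z => ?_⟩
  · rw [hK, Finset.card_map, Finset.card_product, Finset.card_range]
    push_cast
    exact le_of_eq (by ring)
  · have h1 : ‖∑ k ∈ K, p k * sqChar k w‖ = (N : ℝ) ^ 2 := by
      rw [hP, sub_self, sub_self, expSum_zero, norm_mul, norm_inv, norm_mul, norm_pow,
        Complex.norm_natCast]
      field_simp
    rw [← h1]
    refine (norm_sum_le _ _).trans (le_of_eq (Finset.sum_congr rfl fun k _ => ?_))
    rw [norm_mul, norm_sqChar, mul_one]
  · refine integrable_of_continuous_of_bounded (C := ((N : ℝ) * N) ^ 2) (by fun_prop) fun z => ?_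
    change |(‖expSum N (z.1 - w.1)‖ * ‖expSum N (z.2 - w.2)‖) ^ 2| ≤ _
    rw [abs_of_nonneg (sq_nonneg _)]
    gcongr <;> exact norm_expSum_le _ _
  · simp only [mul_pow]
    rw [unitSq, integral_prod_mul (fun x : ℝ => ‖expSum N (x - w.1)‖ ^ 2)
      (fun x : ℝ => ‖expSum N (x - w.2)‖ ^ 2), integral_norm_sq_expSum, integral_norm_sq_expSum, sq]
  · rw [hP]
    set A := ‖expSum N (z.1 - w.1)‖ with hA
    set B := ‖expSum N (z.2 - w.2)‖ with hB
    set δ := ‖sqChar l z - sqChar l w‖ with hδ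
    have hA0 : 0 ≤ A := norm_nonneg _
    have hB0 : 0 ≤ B := norm_nonneg _
    have hAN : A ≤ N := norm_expSum_le _ _
    have hBN : B ≤ N := norm_expSum_le _ _
    have hδ2 : δ ≤ 2 := (norm_sub_le _ _).trans (by rw [norm_sqChar, norm_sqChar]; norm_num)
    have hδl := norm_sqChar_sub_le l z w
    have k1 := norm_unitExp_sub_one_mul_expSum_le N (z.1 - w.1)
    have k2 := norm_unitExp_sub_one_mul_expSum_le N (z.2 - w.2)
    set a := ‖unitExp (z.1 - w.1) - 1‖
    set b := ‖unitExp (z.2 - w.2) - 1‖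
    have hl1 := abs_nonneg (l.1 : ℝ)
    have hl2 := abs_nonneg (l.2 : ℝ)
    have main : δ * (A * B) ≤ 2 * N * min (N : ℝ) (latticeWeight l) := by
      rw [mul_min_of_nonneg _ _ (by positivity)]
      refine le_min ?_ ?_
      · calc δ * (A * B) ≤ 2 * (N * N) := by gcongr
          _ = _ := by ring
      · calc δ * (A * B) ≤ (|(l.1 : ℝ)| * a + |(l.2 : ℝ)| * b) * (A * B) := by gcongr
          _ = |(l.1 : ℝ)| * ((a * A) * B) + |(l.2 : ℝ)| * ((b * B) * A) := by ring
          _ ≤ |(l.1 : ℝ)| * (2 * N) + |(l.2 : ℝ)| * (2 * N) := by gcongr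
          _ ≤ 2 * N * latticeWeight l := by unfold latticeWeight; nlinarith
    rw [norm_mul, norm_inv, norm_pow, Complex.norm_natCast, norm_mul, norm_pow, norm_pow]
    calc δ * (((N : ℝ) ^ 2)⁻¹ * (A ^ 2 * B ^ 2)) = (δ * (A * B)) * (((N : ℝ) ^ 2)⁻¹ * (A * B)) := by
          ring
      _ ≤ (2 * N * min (N : ℝ) (latticeWeight l)) * (((N : ℝ) ^ 2)⁻¹ * (A * B)) := by gcongr
      _ = 2 / N * min (N : ℝ) (latticeWeight l) * (A * B) := by field_simp

/-! ### Poor localization of exact `(C_q)` Gabor systems -/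

/-- Since the series vanishes at w, its value at z is the sum of the coefficients times character
differences, which the concentration of P controls. -/
theorem norm_sqSeries_mul_le {c : ℤ × ℤ → ℂ} (hc : Summable fun k => ‖c k‖) {w z : ℝ × ℝ}
    (hw : sqSeries c w = 0) {P : ℂ} {R : ℝ} {μ : ℤ × ℤ → ℝ}
    (h : ∀ k, ‖sqChar k z - sqChar k w‖ * ‖P‖ ≤ μ k)
    (hR : ∀ S : Finset (ℤ × ℤ), ∑ k ∈ S, ‖c k‖ * μ k ≤ R) : ‖sqSeries c z * P‖ ≤ R := by
  have e : HasSum (fun k => (c k * sqChar k z - c k * sqChar k w) * P) (sqSeries c z * P) := by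
    have h1 := (summable_sqSeries hc z).hasSum
    have h2 := (summable_sqSeries hc w).hasSum
    have := (h1.sub h2).mul_right P
    change HasSum _ ((sqSeries c z - sqSeries c w) * P) at this
    rwa [hw, sub_zero] at this
  refine le_of_tendsto e.norm (Filter.Eventually.of_forall fun S => ?_)
  refine (norm_sum_le _ _).trans ((Finset.sum_le_sum fun k _ => ?_).trans (hR S))
  rw [← mul_sub, norm_mul, norm_mul, mul_assoc]
  exact mul_le_mul_of_nonneg_left (h k) (norm_nonneg _)

theorem zak_sum_smul_gaborSystem (g : Lp ℂ 2 (volume : Measure ℝ)) (K : Finset (ℤ × ℤ))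
    (p : ℤ × ℤ → ℂ) : zak (∑ k ∈ K, p k • gaborSystem g k) =ᵐ[unitSq]
      fun z => (∑ k ∈ K, p k * sqChar k z) * zak g z := by
  classical
  induction K using Finset.induction_on with
  | empty =>
    simp only [Finset.sum_empty, map_zero, zero_mul]
    exact Lp.coeFn_zero _ _ _
  | insert k K hk ih =>
    rw [Finset.sum_insert hk, map_add, map_smul]
    filter_upwards [ih, zak_gaborShift k g, Lp.coeFn_add (p k • zak (gaborSystem g k))
      (zak (∑ k ∈ K, p k • gaborSystem g k)), Lp.coeFn_smul (p k) (zak (gaborSystem g k))]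
      with z h1 h2 h3 h4
    rw [gaborShift_apply] at h2
    rw [h3, Pi.add_apply, h4, Pi.smul_apply, h1, h2, Finset.sum_insert hk, smul_eq_mul]
    ring

theorem weightedIntegral_eq_top_or {q : ℝ} (hq : 2 < q) {g : Lp ℂ 2 (volume : Measure ℝ)}
    (hmin : IsMinimalSystem (gaborSystem g)) (hcq : IsCqSystem q (gaborSystem g)) {t : ℝ}
    (ht : 4 / (q / (q - 1)) ≤ t) :
    weightedIntegral t g = ∞ ∨ weightedIntegral t (𝓕 g) = ∞ := by
  by_contra! hcon
  obtain ⟨ht1, ht2⟩ := hcon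
  have hq0 : 0 < q := by linarith
  -- Then 4/q' = 2 + 2α and 1 - α = 2/q. Larger t are reduced to 2 + 2α, which is below 4 as the
  -- window estimates require.
  set α := 1 - 2 / q with hα
  have hq2 : 0 < 2 / q := by positivity
  have hα0 : 0 < α := by rw [hα, sub_pos, div_lt_one hq0]; exact hq
  have hα1 : α < 1 := by rw [hα]; linarith
  have hαt : 2 + 2 * α ≤ t := by
    refine le_trans (le_of_eq ?_) ht
    rw [hα]; field_simp; ring
  have i1 := integrable_of_weightedIntegral (by linarith) hαt ht1
  have i2 := integrable_of_weightedIntegral (by linarith) hαt ht2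
  have s1 := summable_latticeWeight_mul continuous_windowFun hasCubicDecay_fourier_cutoff_windowFun
    (by linarith) (by linarith) i1 i2
  have s2 := summable_latticeWeight_mul continuous_modWindowFun
    hasCubicDecay_fourier_cutoff_modWindowFun (by linarith) (by linarith) i1 i2
  set c₁ : ℤ × ℤ → ℂ := fun k => inner ℂ (gaborShift k (cutoffLp windowFun continuous_windowFun)) g
  set c₂ : ℤ × ℤ → ℂ := fun k =>
    inner ℂ (gaborShift k (cutoffLp modWindowFun continuous_modWindowFun)) g
  have n1 : Summable fun k => ‖c₁ k‖ :=
    summable_of_summable_latticeWeight hα0 hα1 (fun k => norm_nonneg _) s1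
  have n2 : Summable fun k => ‖c₂ k‖ :=
    summable_of_summable_latticeWeight hα0 hα1 (fun k => norm_nonneg _) s2
  have e1 : ∀ᵐ z ∂unitSq, sqSeries c₁ z = (starRingEnd ℂ) (zakWindow z) * zak g z := by
    filter_upwards [sqSeries_ae_eq continuous_windowFun g n1, zak_cutoffLp continuous_windowFun]
      with z h1 h2
    rw [h1, h2]; rfl
  have e2 : ∀ᵐ z ∂unitSq, sqSeries c₂ z = (starRingEnd ℂ) (zakModWindow z) * zak g z := by
    filter_upwards [sqSeries_ae_eq continuous_modWindowFun g n2,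
      zak_cutoffLp continuous_modWindowFun] with z h1 h2
    rw [h1, h2]; rfl
  have hper1 : ∀ c x, sqSeries c (x, 1) = sqSeries c (x, 0) := fun c x => by
    simpa using sqSeries_add_int c (x, 0) 0 1
  have hper2 : ∀ c y, sqSeries c (1, y) = sqSeries c (0, y) := fun c y => by
    simpa using sqSeries_add_int c (0, y) 1 0
  obtain ⟨w, hw1, hw2⟩ := exists_common_zero (continuous_sqSeries n1) (continuous_sqSeries n2)
    (hper1 _) (hper1 _) (hper2 _) (hper2 _) e1 e2
  obtain ⟨C, hC, hCb⟩ := hcq.exists_sum_rpow_le hq0 hmin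
  -- Makes C·3ε equal to 1/8, small enough to beat the constant 4^{q-1} from Hölder's inequality.
  set ε := 1 / (24 * C) with hε
  have hε0 : 0 < ε := by positivity
  obtain ⟨N₁, hN₁⟩ := exists_sum_mul_min_latticeWeight_le hα0 hα1 (fun k => norm_nonneg (c₁ k)) s1 hε0
  obtain ⟨N₂, hN₂⟩ := exists_sum_mul_min_latticeWeight_le hα0 hα1 (fun k => norm_nonneg (c₂ k)) s2 hε0
  set N := max (max N₁ N₂) 1 with hN
  have hN1 : 1 ≤ N := le_max_right _ _
  have hN0 : (0 : ℝ) < N := by exact_mod_cast hN1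
  replace hN₁ := hN₁ N ((le_max_left _ _).trans (le_max_left _ _)) hN1
  replace hN₂ := hN₂ N ((le_max_right _ _).trans (le_max_left _ _)) hN1
  obtain ⟨K, p, Q, hKc, hp, hQc, hQ0, hQi, hQI, hb⟩ := exists_concentrated_trigPoly hN1 w
  set P : ℝ × ℝ → ℂ := fun z => ∑ k ∈ K, p k * sqChar k z with hP
  set y := (N : ℝ) ^ (1 - α) with hy
  have hy0 : 0 < y := Real.rpow_pos_of_pos hN0 _
  have hHP : ∀ (c : ℤ × ℤ → ℂ), (Summable fun k => ‖c k‖) → sqSeries c w = 0 →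
      (∀ S : Finset (ℤ × ℤ), ∑ k ∈ S, ‖c k‖ * min (N : ℝ) (latticeWeight k) ≤ ε * y) →
      ∀ z, ‖sqSeries c z * P z‖ ≤ 2 / N * (ε * y) * Q z := by
    intro c hc hcw hS z
    refine norm_sqSeries_mul_le hc hcw (fun k => hb k z) fun S => ?_
    calc _ = 2 / N * (∑ k ∈ S, ‖c k‖ * min (N : ℝ) (latticeWeight k)) * Q z := by
          rw [Finset.mul_sum, Finset.sum_mul]
          exact Finset.sum_congr rfl fun k _ => by ring
      _ ≤ _ := by
          have := hQ0 z
          gcongr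
          exact hS S
  set f := ∑ k ∈ K, p k • gaborSystem g k with hf
  -- |P·Zg|² is at most |P·H₁|² + |P·H₂|² because |Zφ|² + |Zψ|² ≥ 1. The integral of Q² is N², which
  -- cancels the factor (2/N)² up to a constant.
  have hf2 : ‖f‖ ^ 2 ≤ 8 * (ε * y) ^ 2 := by
    rw [← zak.norm_map f]
    refine (norm_sq_le_integral (zak f)
      (hQi.const_mul (2 * (2 / N * (ε * y)) ^ 2)) ?_).trans (le_of_eq ?_)
    · filter_upwards [zak_sum_smul_gaborSystem g K p, e1, e2] with z h0 h1 h2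
      have b1 := hHP c₁ n1 hw1 hN₁ z
      have b2 := hHP c₂ n2 hw2 hN₂ z
      have b1' := pow_le_pow_left₀ (norm_nonneg _) b1 2
      have b2' := pow_le_pow_left₀ (norm_nonneg _) b2 2
      rw [h1, norm_mul, norm_mul, RCLike.norm_conj] at b1'
      rw [h2, norm_mul, norm_mul, RCLike.norm_conj] at b2'
      have hsum := norm_sq_zakWindow_add z
      rw [h0, norm_mul]
      have hge : 1 ≤ ‖zakWindow z‖ ^ 2 + ‖zakModWindow z‖ ^ 2 := by
        rw [hsum]; linarith [sq_nonneg (Real.cos (Real.pi * z.1))]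
      calc (‖P z‖ * ‖zak g z‖) ^ 2
          ≤ (‖zakWindow z‖ ^ 2 + ‖zakModWindow z‖ ^ 2) * (‖P z‖ * ‖zak g z‖) ^ 2 :=
            le_mul_of_one_le_left (sq_nonneg _) hge
        _ = (‖zakWindow z‖ * ‖zak g z‖ * ‖P z‖) ^ 2 + (‖zakModWindow z‖ * ‖zak g z‖ * ‖P z‖) ^ 2 := by
            ring
        _ ≤ (2 / N * (ε * y) * Q z) ^ 2 + (2 / N * (ε * y) * Q z) ^ 2 := add_le_add b1' b2'
        _ = _ := by ring
    · rw [integral_const_mul, hQI]; field_simp; ring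
  have hfn : ‖f‖ ≤ 3 * (ε * y) := by
    refine abs_le_of_sq_le_sq' ?_ (by positivity) |>.2
    nlinarith [sq_nonneg (ε * y)]
  have hholder := Real.rpow_sum_le_const_mul_sum_rpow K (fun k => ‖p k‖) (p := q) (by linarith)
  simp only [abs_norm] at hholder
  have hN2 : (0 : ℝ) < (N : ℝ) ^ 2 := by positivity
  have hyq : y ^ q = (N : ℝ) ^ 2 := by
    rw [hy, ← Real.rpow_mul hN0.le, ← Real.rpow_natCast]
    congr 1
    rw [hα]; push_cast; field_simp; ring
  -- Hölder's lower bound meets the upper bound from (C_q). Both sides scale as N^{2q}, so the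
  -- contradiction lies in the constant 4^{q-1}·8^{-q} < 1.
  have hfin : ((N : ℝ) ^ 2) ^ q ≤ (4 * (N : ℝ) ^ 2) ^ (q - 1) * ((1 / 8) * y) ^ q := by
    calc ((N : ℝ) ^ 2) ^ q ≤ (∑ k ∈ K, ‖p k‖) ^ q := Real.rpow_le_rpow hN2.le hp hq0.le
      _ ≤ (K.card : ℝ) ^ (q - 1) * ∑ k ∈ K, ‖p k‖ ^ q := hholder
      _ ≤ (4 * (N : ℝ) ^ 2) ^ (q - 1) * ((1 / 8) * y) ^ q := by
          refine mul_le_mul (Real.rpow_le_rpow (by positivity) hKc (by linarith))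
            ((hCb K p).trans (Real.rpow_le_rpow (by positivity) ?_ hq0.le))
            (Finset.sum_nonneg fun k _ => by positivity) (by positivity)
          calc C * ‖f‖ ≤ C * (3 * (ε * y)) := by gcongr
            _ = 1 / 8 * y := by rw [hε]; field_simp; norm_num
  have h4 : (4 * (N : ℝ) ^ 2) ^ (q - 1) * ((1 / 8) * y) ^ q =
      (4 : ℝ) ^ (q - 1) * (1 / 8) ^ q * ((N : ℝ) ^ 2) ^ q := by
    rw [Real.mul_rpow (by norm_num) hN2.le, Real.mul_rpow (by norm_num) hy0.le, hyq,
      Real.rpow_sub_one hN2.ne' q]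
    field_simp
  rw [h4] at hfin
  have h5 : (4 : ℝ) ^ (q - 1) * (1 / 8) ^ q < 1 := by
    calc (4 : ℝ) ^ (q - 1) * (1 / 8) ^ q ≤ 4 ^ q * (1 / 8) ^ q := by
          gcongr
          · norm_num
          · linarith
      _ = (4 * (1 / 8)) ^ q := (Real.mul_rpow (by norm_num) (by norm_num)).symm
      _ < 1 := Real.rpow_lt_one (by norm_num) (by norm_num) hq0
  have h6 : 0 < ((N : ℝ) ^ 2) ^ q := by positivity
  nlinarith

end

theorem theorem1p6 (q : ℝ) (hq : 2 < q) :
    (∀ g : Lp ℂ 2 (volume : Measure ℝ),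
      IsExactSystem (gaborSystem g) → IsCqSystem q (gaborSystem g) →
        ∀ t : ℝ, 4 / (q / (q - 1)) ≤ t →
          weightedIntegral t g = ∞ ∨ weightedIntegral t (𝓕 g) = ∞) ∧
    (∀ t : ℝ, t < 4 / (q / (q - 1)) →
      ∃ g : Lp ℂ 2 (volume : Measure ℝ),
        IsExactSystem (gaborSystem g) ∧ IsCqSystem q (gaborSystem g) ∧
          weightedIntegral t g < ∞ ∧ weightedIntegral t (𝓕 g) < ∞) := by
  refine ⟨fun g hex hcq t ht => ?_, fun t ht => ?_⟩
  · exact weightedIntegral_eq_top_or hq hex.2 hcq ht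
  · rcases lt_or_ge t 0 with h | h
    · exact exists_exact_cq_gaborSystem_of_neg hq h
    · exact exists_exact_cq_gaborSystem_of_nonneg hq h ht
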